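/- All graphs are finite and simple. A *path in* $G$ is an induced subgraph of $G$ that is a path; its *interior* is the set of its vertices other than its ends. A *hole* is an induced cycle with at least four vertices. Two disjoint vertex sets are *anticomplete* if no edge joins them. "$G$ contains $H$" means that $H$ is (isomorphic to) an induced subgraph of $G$. * A *theta* consists of three paths of length at least $2$ with the same two ends, whose interiors are pairwise disjoint and anticomplete. A *prism* consists of three vertex-disjoint paths $a_i\text{-}\cdots\text{-}b_i$ ($i=1,2,3$) of length at least $1$ such that $a_1a_2a_3$ and $b_1b_2b_3$ are triangles and there are no other edges between the paths. * A *wheel* $(H,x)$ is a hole $H$ with a vertex $x$ having at least three neighbors in $H$. It is *even* if $|N(x)\cap H|$ is even; a *twin wheel* if $N(x)\cap H$ induces a path of length two; a *short pyramid* if $|N(x)\cap H|=3$ and exactly one pair of these three neighbors is adjacent; and *proper* if it is neither a twin wheel nor a short pyramid. A *hub* of $G$ is a vertex $x$ such that $(H,x)$ is a proper wheel in $G$ for some $H$; $\mathrm{Hub}(G)$ is the set of hubs. * A *generalized $k$-pyramid* is a graph whose vertex set is the disjoint union of the vertex sets of (non-empty) paths $P=p_0\text{-}\cdots\text{-}p_m$,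 $Q=q_0\text{-}\cdots\text{-}q_l$, $R_1,\dots,R_k$, where $R_i$ has ends $a_i,b_i$ (possibly $a_i=b_i$, and possibly $l=0$), such that: $P\cup Q$ is a hole with $p_0q_0$ and $p_mq_l$ edges; $a_i$ has exactly two neighbors $x_i,y_i$ in $P$, which are adjacent interior vertices of $P$; $b_i$ has exactly one neighbor $z_i$ in $Q$; there are no other edges between $R_i$ and $P\cup Q$; $R_i$ and $R_j$ are anticomplete for $i\ne j$; the vertices $x_1,y_1,\dots,x_k,y_k$ are distinct and occur in this order along $P$ from $p_0$ to $p_m$; and $z_1,\dots,z_k$, not necessarily distinct, occur in this order along $Q$ from $q_0$ to $q_l$. * For an integer $t\ge 1$, $\mathcal C_{tt}$ is the class of graphs containing no $C_4$, theta, prism, even wheel, clique of size $t$, or generalized $t$-pyramid. * A set $S\subseteq V(G)$ is a *minimal separator* of $G$ if there are $u,v\in V(G)$ in different components of $G\setminus S$ which are in the same component of $G\setminus S'$ for every $S'\subsetneq S$. A *potential maximal clique* of $G$ is a maximal clique of some minimal chordal completion of $G$ (an inclusion-wise minimal chordal graph obtained from $G$ by adding edges). A tree decomposition $(T,\chi)$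 of $G$ is *structured* if every bag $\chi(v)$, $v\in V(T)$, is a potential maximal clique of $G$. **Theorem.** For every integer $t\ge 1$ there is an integer $\tau=\tau(t)\ge 1$ such that the following hold for every $G\in\mathcal C_{tt}$. 1. If $S$ is a minimal separator of $G$ and $Y\subseteq S\setminus \mathrm{Hub}(G)$ is stable, then $|Y|\le\tau$. 2. If $(T,\chi)$ is a structured tree decomposition of $G$, $v\in V(T)$, and $Y\subseteq\chi(v)\setminus\mathrm{Hub}(G)$ is stable, then $|Y|\le 4\tau$. -/

import Mathlib

namespace SimpleGraph

universe u w

variable {V : Type u}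

/-- A set `A` of vertices is anticomplete to `B`: they are disjoint and no edge joins them. -/
def Anticomplete (G : SimpleGraph V) (A B : Set V) : Prop :=
  Disjoint A B ∧ ∀ a ∈ A, ∀ b ∈ B, ¬ G.Adj a b

/-- A path of length `n` in `G` (always meant as an induced subgraph) is an embedding
`p : pathGraph (n + 1) ↪g G`; its ends are `p 0` and `p (Fin.last n)`. This is its interior. -/
def pathInterior {G : SimpleGraph V} {n : ℕ} (p : pathGraph (n + 1) ↪g G) : Set V :=
  Set.range p \ {p 0, p (Fin.last n)}

/-- `H` is the vertex set of a hole of `G`: an induced cycle with at least four vertices. -/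
def IsHole (G : SimpleGraph V) (H : Set V) : Prop :=
  ∃ n : ℕ, 4 ≤ n ∧ ∃ f : cycleGraph n ↪g G, Set.range f = H

/-- A theta in `G` (as an induced subgraph): three paths of length at least two with the same
ends `a` and `b`, whose interiors are pairwise disjoint and anticomplete. -/
structure Theta (G : SimpleGraph V) where
  a : V
  b : V
  len : Fin 3 → ℕ
  path : ∀ i, pathGraph (len i + 1) ↪g G
  two_le_len : ∀ i, 2 ≤ len i
  path_first : ∀ i, path i 0 = a
  path_last : ∀ i, path i (Fin.last _) = b
  anticomplete : ∀ i j, i ≠ j → G.Anticomplete (pathInterior (path i)) (pathInterior (path j))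

/-- A prism in `G` (as an induced subgraph): three pairwise disjoint paths of length at least one
such that the first vertices form a triangle, the last vertices form a triangle, and there are no
other edges between the paths. -/
structure Prism (G : SimpleGraph V) where
  len : Fin 3 → ℕ
  path : ∀ i, pathGraph (len i + 1) ↪g G
  one_le_len : ∀ i, 1 ≤ len i
  disjoint : ∀ i j, i ≠ j → Disjoint (Set.range (path i)) (Set.range (path j))
  adj_iff : ∀ i j, i ≠ j → ∀ s s', G.Adj (path i s) (path j s') ↔
    (s = 0 ∧ s' = 0) ∨ (s = Fin.last _ ∧ s' = Fin.last _)

/-- A wheel `(H, x)`: a hole `H` and a vertex `x` with at least three neighbors in `H`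
(so that `x` is not in `H`). -/
def IsWheel (G : SimpleGraph V) (H : Set V) (x : V) : Prop :=
  G.IsHole H ∧ 3 ≤ (G.neighborSet x ∩ H).ncard

/-- A wheel `(H, x)` in which `x` has an even number of neighbors in `H`. -/
def IsEvenWheel (G : SimpleGraph V) (H : Set V) (x : V) : Prop :=
  G.IsWheel H x ∧ Even (G.neighborSet x ∩ H).ncard

/-- A wheel `(H, x)` such that the neighbors of `x` in `H` induce a path of length two. -/
def IsTwinWheel (G : SimpleGraph V) (H : Set V) (x : V) : Prop :=
  G.IsWheel H x ∧ ∃ p : pathGraph 3 ↪g G, Set.range p = G.neighborSet x ∩ H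

/-- A wheel `(H, x)` such that `x` has exactly three neighbors in `H`, exactly two of which are
adjacent to each other. -/
def IsShortPyramid (G : SimpleGraph V) (H : Set V) (x : V) : Prop :=
  G.IsWheel H x ∧ ∃ a b c : V, a ≠ b ∧ a ≠ c ∧ b ≠ c ∧ G.neighborSet x ∩ H = {a, b, c} ∧
    G.Adj a b ∧ ¬ G.Adj a c ∧ ¬ G.Adj b c

/-- A wheel that is neither a twin wheel nor a short pyramid. -/
def IsProperWheel (G : SimpleGraph V) (H : Set V) (x : V) : Prop :=
  G.IsWheel H x ∧ ¬ G.IsTwinWheel H x ∧ ¬ G.IsShortPyramid H x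

/-- The set of all hubs of `G`: the centers of proper wheels. -/
def hubs (G : SimpleGraph V) : Set V :=
  {x | ∃ H : Set V, G.IsProperWheel H x}

/-- A generalized `k`-pyramid in `G` (as an induced subgraph), consisting of the bottom path `P`,
the top path `Q` and the paths `R i`. The ends of `R i` are `a_i = R i 0` and
`b_i = R i (Fin.last _)`, which may coincide; `P` and `Q` may not be empty, but `Q` may have just
one vertex. Both `P` and `Q` are numbered from the same side of the hole `P ∪ Q`. -/
structure GeneralizedPyramid (G : SimpleGraph V) (k : ℕ) where
  lenP : ℕ
  lenQ : ℕ
  lenR : Fin k → ℕ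
  P : pathGraph (lenP + 1) ↪g G
  Q : pathGraph (lenQ + 1) ↪g G
  R : ∀ i, pathGraph (lenR i + 1) ↪g G
  disjoint_P_Q : Disjoint (Set.range P) (Set.range Q)
  disjoint_R_P : ∀ i, Disjoint (Set.range (R i)) (Set.range P)
  disjoint_R_Q : ∀ i, Disjoint (Set.range (R i)) (Set.range Q)
  /-- `P ∪ Q` is a hole, and the first (last) vertex of `P` is adjacent to that of `Q`. -/
  isHole : G.IsHole (Set.range P ∪ Set.range Q)
  adj_first : G.Adj (P 0) (Q 0)
  adj_last : G.Adj (P (Fin.last _)) (Q (Fin.last _))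
  /-- The positions in `P` of the two neighbors `x_i`, `y_i` of `a_i`. -/
  x : Fin k → Fin (lenP + 1)
  y : Fin k → Fin (lenP + 1)
  /-- The position in `Q` of the neighbor `z_i` of `b_i`. -/
  z : Fin k → Fin (lenQ + 1)
  /-- `a_i` has exactly the neighbors `x_i`, `y_i` in `P`; no other vertex of `R i` has any. -/
  adj_R_P : ∀ i s v, G.Adj (R i s) (P v) ↔ s = 0 ∧ (v = x i ∨ v = y i)
  /-- `b_i` has exactly the neighbor `z_i` in `Q`; no other vertex of `R i` has any. -/
  adj_R_Q : ∀ i s v, G.Adj (R i s) (Q v) ↔ s = Fin.last _ ∧ v = z i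
  anticomplete_R : ∀ i j, i < j → G.Anticomplete (Set.range (R i)) (Set.range (R j))
  /-- `x_i` and `y_i` are consecutive interior vertices of `P`. -/
  x_pos : ∀ i, 0 < x i
  y_eq : ∀ i, (y i : ℕ) = x i + 1
  y_lt : ∀ i, y i < Fin.last _
  /-- `P` traverses the distinct vertices `x_1, y_1, x_2, y_2, …, x_k, y_k` in this order. -/
  y_lt_x : ∀ i j, i < j → y i < x j
  /-- `Q` traverses `z_1, …, z_k` in this order; some of them may coincide. -/
  z_mono : Monotone z

/-- The class `𝒞` of all (C₄, theta, prism, even wheel)-free graphs. -/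
structure InClassC (G : SimpleGraph V) : Prop where
  c4_free : IsEmpty (cycleGraph 4 ↪g G)
  theta_free : IsEmpty G.Theta
  prism_free : IsEmpty G.Prism
  evenWheel_free : ∀ (H : Set V) (x : V), ¬ G.IsEvenWheel H x

/-- The class `𝒞_t` of all graphs in `𝒞` with no clique of size `t`. -/
structure InClassCt (G : SimpleGraph V) (t : ℕ) : Prop extends G.InClassC where
  cliqueFree : G.CliqueFree t

/-- The class `𝒞_tt` of all graphs in `𝒞_t` with no generalized `t`-pyramid. -/
structure InClassCtt (G : SimpleGraph V) (t : ℕ) : Prop extends G.InClassCt t where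
  generalizedPyramid_free : IsEmpty (G.GeneralizedPyramid t)

/-- `u` and `v` lie in the same connected component of `G \ X`. -/
def SameComponentOff (G : SimpleGraph V) (X : Set V) (u v : V) : Prop :=
  ∃ (hu : u ∈ Xᶜ) (hv : v ∈ Xᶜ), (G.induce Xᶜ).Reachable ⟨u, hu⟩ ⟨v, hv⟩

/-- `X` is a minimal separator: there are `u`, `v` in different connected components of `G \ X`
that are in the same connected component of `G \ Y` for every proper subset `Y` of `X`. -/
def IsMinimalSeparator (G : SimpleGraph V) (X : Set V) : Prop :=
  ∃ u v : V, u ∉ X ∧ v ∉ X ∧ ¬ G.SameComponentOff X u v ∧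
    ∀ Y : Set V, Y ⊂ X → G.SameComponentOff Y u v

/-- A graph is chordal if it has no hole. -/
def IsChordal (G : SimpleGraph V) : Prop :=
  ∀ H : Set V, ¬ G.IsHole H

/-- `G'` is a minimal chordal completion of `G`: a chordal graph obtained from `G` by adding an
inclusion-wise minimal set of edges. -/
def IsMinimalChordalCompletion (G G' : SimpleGraph V) : Prop :=
  Minimal (fun K : SimpleGraph V => G ≤ K ∧ K.IsChordal) G'

/-- A potential maximal clique of `G`: an inclusion-wise maximal clique of some minimal chordal
completion of `G`. -/
def IsPMC (G : SimpleGraph V) (Ω : Set V) : Prop :=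
  ∃ G' : SimpleGraph V, G.IsMinimalChordalCompletion G' ∧ Maximal G'.IsClique Ω

/-- `(T, χ)` is a tree decomposition of `G`. -/
structure IsTreeDecomposition (G : SimpleGraph V) {W : Type w} (T : SimpleGraph W)
    (χ : W → Set V) : Prop where
  isTree : T.IsTree
  exists_bag_of_vertex : ∀ v : V, ∃ s : W, v ∈ χ s
  exists_bag_of_edge : ∀ v₁ v₂ : V, G.Adj v₁ v₂ → ∃ s : W, v₁ ∈ χ s ∧ v₂ ∈ χ s
  connected : ∀ v : V, (T.induce {s : W | v ∈ χ s}).Connected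

/-- A tree decomposition is structured if all its bags are potential maximal cliques. -/
structure IsStructuredTreeDecomposition (G : SimpleGraph V) {W : Type w} (T : SimpleGraph W)
    (χ : W → Set V) : Prop extends G.IsTreeDecomposition T χ where
  isPMC : ∀ s : W, G.IsPMC (χ s)

end SimpleGraph

/-! Both parts rest on `exists_card_lt_of_anticomplete`: if `A` and `B` are connected and
anticomplete, only boundedly many pairwise nonadjacent non-hubs can have neighbors in both.

A connected set touched by many nonadjacent vertices contains a comb (`exists_isComb`): an induced
path with many pairwise anticomplete teeth ending in those vertices. Combs in `A` and in `B` with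
the same teeth glue to a ladder (`exists_ladder`): two anticomplete induced paths, the rails, joined
by many pairwise anticomplete legs. Each leg runs from `A` to `B`, so it passes through its tooth
vertex and contains a non-hub. Ramsey's theorem and the absence of thetas sort the legs along both
rails.

If the end of a leg has two nonadjacent neighbors on its rail, the rail can be rerouted through that
end, which shortens the leg. A leg with one vertex cannot be shortened, but then its vertex has
three pairwise nonadjacent neighbors in a hole and is a hub. So every inner leg may be assumed to
attach to each rail at one vertex or at two consecutive ones (`exists_narrow`). One and one gives a
theta; two and two gives a prism, or an even wheel if the leg is a single vertex. Hence every inner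
leg has one attachment on one rail and two on the other, and `t` legs of the same kind form a
generalized `t`-pyramid (`card_lt_of_ordered`).

A minimal separator has two full components, which serve as `A` and `B`; this is part 1. For part 2,
let `Ω` be a potential maximal clique. Every component `D` of its complement has an anticomplete
connected partner touched by all neighbors of `D` in `Ω` (`exists_opposite`), so few vertices of `Y`
touch `D`. But any two nonadjacent vertices of `Ω` touch a common component (`exists_component`). If
`Y` were large, four of its vertices and the components joining them in pairs would contain a theta
(`card_le_of_components`). -/

namespace SimpleGraph

universe u
variable {V : Type u} {G : SimpleGraph V}

/-! ### Induced paths as sequences -/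

/-- `p 0, …, p n` are the consecutive vertices of an induced path. -/
def IsInducedPath (G : SimpleGraph V) (p : ℕ → V) (n : ℕ) : Prop :=
  (∀ i ≤ n, ∀ j ≤ n, p i = p j → i = j) ∧
    ∀ i ≤ n, ∀ j ≤ n, (G.Adj (p i) (p j) ↔ i + 1 = j ∨ j + 1 = i)

namespace IsInducedPath

variable {p q : ℕ → V} {n m : ℕ}

lemma congr (h : G.IsInducedPath p n) (hq : ∀ i ≤ n, q i = p i) : G.IsInducedPath q n := by
  refine ⟨fun i hi j hj => ?_, fun i hi j hj => ?_⟩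
  · rw [hq i hi, hq j hj]; exact h.1 i hi j hj
  · rw [hq i hi, hq j hj]; exact h.2 i hi j hj

lemma segment (h : G.IsInducedPath p n) (a k : ℕ) (hk : a + k ≤ n) :
    G.IsInducedPath (fun i => p (a + i)) k := by
  refine ⟨fun i hi j hj e => ?_, fun i hi j hj => ?_⟩
  · have := h.1 (a + i) (by omega) (a + j) (by omega) e
    omega
  · rw [h.2 (a + i) (by omega) (a + j) (by omega)]
    omega

lemma reverse (h : G.IsInducedPath p n) : G.IsInducedPath (fun i => p (n - i)) n := by
  refine ⟨fun i hi j hj e => ?_, fun i hi j hj => ?_⟩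
  · have := h.1 (n - i) (by omega) (n - j) (by omega) e
    omega
  · rw [h.2 (n - i) (by omega) (n - j) (by omega)]
    omega

lemma singleton (a : V) : G.IsInducedPath (fun _ => a) 0 := by
  refine ⟨fun i hi j hj _ => by omega, fun i hi j hj => ?_⟩
  simp; omega

lemma append (hp : G.IsInducedPath p n) (hq : G.IsInducedPath q m)
    (hne : ∀ i ≤ n, ∀ j ≤ m, p i ≠ q j)
    (hadj : ∀ i ≤ n, ∀ j ≤ m, (G.Adj (p i) (q j) ↔ i = n ∧ j = 0)) :
    G.IsInducedPath (fun i => if i ≤ n then p i else q (i - (n + 1))) (n + 1 + m) := by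
  refine ⟨fun i hi j hj => ?_, fun i hi j hj => ?_⟩
  · by_cases h1 : i ≤ n <;> by_cases h2 : j ≤ n <;> simp only [h1, h2, if_true, if_false]
    · exact hp.1 i h1 j h2
    · exact fun e => (hne _ h1 _ (by omega) e).elim
    · exact fun e => (hne _ h2 _ (by omega) e.symm).elim
    · intro e
      have := hq.1 _ (by omega) _ (by omega) e
      omega
  · by_cases h1 : i ≤ n <;> by_cases h2 : j ≤ n <;> simp only [h1, h2, if_true, if_false]
    · exact hp.2 i h1 j h2
    · rw [hadj _ h1 _ (by omega)]; omega
    · rw [G.adj_comm, hadj _ h2 _ (by omega)]; omega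
    · rw [hq.2 _ (by omega) _ (by omega)]; omega

/-- The embedding of a path graph given by an induced path. -/
def embedding (h : G.IsInducedPath p n) : pathGraph (n + 1) ↪g G where
  toFun i := p i
  inj' i j e := Fin.ext (h.1 i (by omega) j (by omega) e)
  map_rel_iff' {i j} := by
    rw [pathGraph_adj]
    exact h.2 i (by omega) j (by omega)

@[simp] lemma embedding_apply (h : G.IsInducedPath p n) (i : Fin (n + 1)) :
    h.embedding i = p i := rfl

lemma range_embedding (h : G.IsInducedPath p n) :
    Set.range h.embedding = {v | ∃ i ≤ n, p i = v} := by
  ext v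
  constructor
  · rintro ⟨i, rfl⟩
    exact ⟨i, by omega, rfl⟩
  · rintro ⟨i, hi, rfl⟩
    exact ⟨⟨i, by omega⟩, rfl⟩

end IsInducedPath

/-- Two induced paths whose ends are joined by two edges form a hole. -/
lemma isHole_of_paths {p q : ℕ → V} {n m : ℕ} (hp : G.IsInducedPath p n)
    (hq : G.IsInducedPath q m) (hlen : 2 ≤ n + m)
    (hne : ∀ i ≤ n, ∀ j ≤ m, p i ≠ q j)
    (hadj : ∀ i ≤ n, ∀ j ≤ m, (G.Adj (p i) (q j) ↔ (i = n ∧ j = 0) ∨ (i = 0 ∧ j = m))) :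
    G.IsHole ({v | ∃ i ≤ n, p i = v} ∪ {v | ∃ i ≤ m, q i = v}) := by
  obtain ⟨c, hc1, hc2⟩ : ∃ c : ℕ → V, (∀ i ≤ n, c i = p i) ∧ ∀ i, ¬ i ≤ n → c i = q (i - (n + 1)) :=
    ⟨fun i => if i ≤ n then p i else q (i - (n + 1)), fun i hi => by simp [hi],
      fun i hi => by simp [hi]⟩
  have hinj : ∀ i < n + m + 2, ∀ j < n + m + 2, c i = c j → i = j := by
    intro i hi j hj
    by_cases h1 : i ≤ n <;> by_cases h2 : j ≤ n
    · rw [hc1 i h1, hc1 j h2]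
      exact hp.1 i h1 j h2
    · rw [hc1 i h1, hc2 j h2]
      exact fun e => (hne _ h1 _ (by omega) e).elim
    · rw [hc2 i h1, hc1 j h2]
      exact fun e => (hne _ h2 _ (by omega) e.symm).elim
    · rw [hc2 i h1, hc2 j h2]
      intro e
      have := hq.1 _ (by omega) _ (by omega) e
      omega
  have hcadj : ∀ i < n + m + 2, ∀ j < n + m + 2, (G.Adj (c i) (c j) ↔
      (i + 1 = j ∨ j + 1 = i ∨ (i = 0 ∧ j = n + m + 1) ∨ (j = 0 ∧ i = n + m + 1))) := by
    intro i hi j hj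
    by_cases h1 : i ≤ n <;> by_cases h2 : j ≤ n
    · rw [hc1 i h1, hc1 j h2, hp.2 i h1 j h2]; omega
    · rw [hc1 i h1, hc2 j h2, hadj _ h1 _ (by omega)]; omega
    · rw [hc2 i h1, hc1 j h2, G.adj_comm, hadj _ h2 _ (by omega)]; omega
    · rw [hc2 i h1, hc2 j h2, hq.2 _ (by omega) _ (by omega)]; omega
  -- Adjacency in `cycleGraph` says that a difference is 1 modulo the number `n + m + 2` of
  -- vertices; this resolves the modulus, the only wrap-around being from the last index to 0.
  have aux : ∀ a b : ℕ, a < n + m + 2 → b < n + m + 2 →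
      ((n + m + 2 - b + a) % (n + m + 2) = 1 ↔ (a = b + 1 ∨ (a = 0 ∧ b = n + m + 1))) := by
    intro a b ha hb
    by_cases hab : b ≤ a
    · rw [show n + m + 2 - b + a = (a - b) + (n + m + 2) by omega, Nat.add_mod_right,
        Nat.mod_eq_of_lt (by omega)]
      omega
    · rw [Nat.mod_eq_of_lt (by omega)]
      omega
  refine ⟨n + m + 2, by omega, ⟨⟨fun i => c i.val, fun i j e =>
    Fin.ext (hinj i i.2 j j.2 e)⟩, ?_⟩, ?_⟩
  · intro i j
    change G.Adj (c i) (c j) ↔ _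
    rw [cycleGraph_adj', hcadj i i.2 j j.2, Fin.sub_def, Fin.sub_def]
    simp only [aux i j i.2 j.2, aux j i j.2 i.2]
    omega
  · ext v
    constructor
    · rintro ⟨⟨i, hi⟩, rfl⟩
      change c i ∈ _
      by_cases h1 : i ≤ n
      · exact Or.inl ⟨i, h1, (hc1 i h1).symm⟩
      · exact Or.inr ⟨i - (n + 1), by omega, (hc2 i h1).symm⟩
    · rintro (⟨i, hi, rfl⟩ | ⟨i, hi, rfl⟩)
      · exact ⟨⟨i, by omega⟩, hc1 i hi⟩
      · refine ⟨⟨i + (n + 1), by omega⟩, ?_⟩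
        change c (i + (n + 1)) = q i
        rw [hc2 _ (by omega)]
        congr 1; omega

/-! ### Linked sets -/

/-- `a` and `b` are joined by a walk all of whose vertices are in `X` (or `a = b`). -/
def LinkedIn (G : SimpleGraph V) (X : Set V) (a b : V) : Prop :=
  Relation.ReflTransGen (fun x y => x ∈ X ∧ y ∈ X ∧ G.Adj x y) a b

/-- `X` induces a connected (or empty) subgraph. -/
def IsLinked (G : SimpleGraph V) (X : Set V) : Prop :=
  ∀ a ∈ X, ∀ b ∈ X, G.LinkedIn X a b

/-- Some vertex of `X` is adjacent to `a`. -/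
def Touches (G : SimpleGraph V) (a : V) (X : Set V) : Prop := ∃ x ∈ X, G.Adj a x

lemma Touches.mono {a : V} {X Y : Set V} (h : G.Touches a X) (hXY : X ⊆ Y) : G.Touches a Y :=
  let ⟨x, hx, hax⟩ := h
  ⟨x, hXY hx, hax⟩

namespace LinkedIn

variable {X Y : Set V} {a b c : V}

lemma refl (a : V) : G.LinkedIn X a a := Relation.ReflTransGen.refl

lemma trans (h : G.LinkedIn X a b) (h' : G.LinkedIn X b c) : G.LinkedIn X a c :=
  Relation.ReflTransGen.trans h h'

lemma single (ha : a ∈ X) (hb : b ∈ X) (h : G.Adj a b) : G.LinkedIn X a b :=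
  Relation.ReflTransGen.single ⟨ha, hb, h⟩

lemma symm (h : G.LinkedIn X a b) : G.LinkedIn X b a := by
  induction h with
  | refl => exact refl _
  | tail _ h ih => exact (single h.2.1 h.1 h.2.2.symm).trans ih

lemma mono (h : G.LinkedIn X a b) (hXY : X ⊆ Y) : G.LinkedIn Y a b := by
  induction h with
  | refl => exact refl _
  | tail _ h ih => exact ih.trans (single (hXY h.1) (hXY h.2.1) h.2.2)

/-- The form in which connectedness is used: a set that no edge into `X` leaves cannot be left by a
walk in `X`. -/
lemma mem_of_closed (h : G.LinkedIn X a b) {S : Set V} (ha : a ∈ S)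
    (hS : ∀ x ∈ S, ∀ y ∈ X, G.Adj x y → y ∈ S) : b ∈ S := by
  induction h with
  | refl => exact ha
  | tail _ h ih => exact hS _ ih _ h.2.1 h.2.2

lemma exists_chain (h : G.LinkedIn X a b) (ha : a ∈ X) :
    ∃ (n : ℕ) (p : ℕ → V), p 0 = a ∧ p n = b ∧ (∀ i < n, G.Adj (p i) (p (i + 1))) ∧
      ∀ i ≤ n, p i ∈ X := by
  induction h with
  | refl => exact ⟨0, fun _ => a, rfl, rfl, by simp, by simpa using ha⟩
  | @tail b c _ h ih =>
    obtain ⟨n, p, h0, hn, hadj, hX⟩ := ih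
    refine ⟨n + 1, fun i => if i ≤ n then p i else c, by simpa using h0, by simp, ?_, ?_⟩
    · intro i hi
      by_cases hin : i = n
      · subst hin
        simpa [hn] using h.2.2
      · have h1 : i ≤ n := by omega
        have h2 : i + 1 ≤ n := by omega
        simpa [h1, h2] using hadj i (by omega)
    · intro i _
      by_cases h1 : i ≤ n
      · simpa [h1] using hX i h1
      · simpa [h1] using h.2.1

end LinkedIn

namespace IsLinked

variable {X Y : Set V} {a b : V}

lemma singleton (a : V) : G.IsLinked {a} := by
  rintro x rfl y rfl
  exact LinkedIn.refl _

lemma empty : G.IsLinked ∅ := fun _ h => h.elim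

lemma union_of_mem (hX : G.IsLinked X) (hY : G.IsLinked Y) (ha : a ∈ X) (hb : a ∈ Y) :
    G.IsLinked (X ∪ Y) := by
  have key : ∀ x ∈ X ∪ Y, G.LinkedIn (X ∪ Y) x a := by
    rintro x (hx | hx)
    · exact (hX x hx a ha).mono Set.subset_union_left
    · exact (hY x hx a hb).mono Set.subset_union_right
  exact fun x hx y hy => (key x hx).trans (key y hy).symm

lemma union_of_adj (hX : G.IsLinked X) (hY : G.IsLinked Y) (ha : a ∈ X) (hb : b ∈ Y)
    (hab : G.Adj a b) : G.IsLinked (X ∪ Y) := by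
  have key : ∀ x ∈ X ∪ Y, G.LinkedIn (X ∪ Y) x a := by
    rintro x (hx | hx)
    · exact (hX x hx a ha).mono Set.subset_union_left
    · exact ((hY x hx b hb).mono Set.subset_union_right).trans
        (LinkedIn.single (Or.inr hb) (Or.inl ha) hab.symm)
  exact fun x hx y hy => (key x hx).trans (key y hy).symm

lemma insert_of_touches (hX : G.IsLinked X) (h : G.Touches a X) : G.IsLinked (insert a X) := by
  obtain ⟨x, hx, hax⟩ := h
  exact (singleton a).union_of_adj hX rfl hx hax

lemma segment {p : ℕ → V} {n : ℕ} (hp : G.IsInducedPath p n) (a b : ℕ) (hb : b ≤ n) :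
    G.IsLinked {v | ∃ i, a ≤ i ∧ i ≤ b ∧ p i = v} := by
  have key : ∀ i, a ≤ i → i ≤ b → G.LinkedIn {v | ∃ i, a ≤ i ∧ i ≤ b ∧ p i = v} (p a) (p i) := by
    intro i hi
    induction i, hi using Nat.le_induction with
    | base => exact fun _ => LinkedIn.refl _
    | succ i hi ih =>
      intro hib
      refine (ih (by omega)).trans (LinkedIn.single ⟨i, hi, by omega, rfl⟩
        ⟨i + 1, by omega, hib, rfl⟩ ?_)
      rw [hp.2 _ (by omega) _ (by omega)]
      omega
  rintro _ ⟨i, h1, h2, rfl⟩ _ ⟨j, h3, h4, rfl⟩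
  exact (key i h1 h2).symm.trans (key j h3 h4)

/-- A shortest path between two sets of vertices inside a linked set. -/
lemma exists_path_between (hX : G.IsLinked X) {S T : Set V} (hS : (S ∩ X).Nonempty)
    (hT : (T ∩ X).Nonempty) :
    ∃ (n : ℕ) (p : ℕ → V), G.IsInducedPath p n ∧ (∀ i ≤ n, p i ∈ X) ∧
      (∀ i ≤ n, p i ∈ S ↔ i = 0) ∧ (∀ i ≤ n, p i ∈ T ↔ i = n) := by
  classical
  have hex : ∃ n : ℕ, ∃ p : ℕ → V, p 0 ∈ S ∧ p n ∈ T ∧ (∀ i < n, G.Adj (p i) (p (i + 1))) ∧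
      ∀ i ≤ n, p i ∈ X := by
    obtain ⟨a, haS, haX⟩ := hS
    obtain ⟨b, hbT, hbX⟩ := hT
    obtain ⟨n, p, h0, hn, h⟩ := (hX a haX b hbX).exists_chain haX
    exact ⟨n, p, h0 ▸ haS, hn ▸ hbT, h⟩
  obtain ⟨p, h0, hn, hadj, hpX⟩ := Nat.find_spec hex
  have hmin : ∀ k < Nat.find hex, _ := fun k hk => Nat.find_min hex hk
  set n := Nat.find hex with hndef
  clear_value n
  -- A repeated vertex (`d = 0`) or a chord (`d = 1`) between positions `i` and `j` lets `j - i - d`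
  -- steps be cut out, against minimality of the length. The same minimality later shows that only
  -- the ends meet `S` and `T`.
  have shortcut : ∀ i j, i < j → j ≤ n → ∀ d, d ≤ 1 → i + d < j →
      (d = 0 → p i = p j) → (d = 1 → G.Adj (p i) (p j)) → False := by
    intro i j hij hj d hd hdj e0 e1
    refine hmin (n - (j - i - d)) (by omega) ⟨fun k => if k ≤ i then p k else p (k + (j - i - d)),
      by simpa using h0, ?_, ?_, ?_⟩
    · by_cases h : n - (j - i - d) ≤ i
      · have : d = 0 := by omega
        have h2 : n - (j - i - d) = i := by omega
        have h3 : j = n := by omega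
        simp only [h2, le_refl, if_true]
        rw [e0 this, h3]; exact hn
      · simp only [h, if_false]
        rw [show n - (j - i - d) + (j - i - d) = n by omega]; exact hn
    · intro k hk
      by_cases h : k + 1 ≤ i
      · have h' : k ≤ i := by omega
        simpa [h, h'] using hadj k (by omega)
      · by_cases h' : k ≤ i
        · have hki : k = i := by omega
          subst hki
          simp only [h, h', if_true, if_false]
          interval_cases d
          · rw [e0 rfl, show k + 1 + (j - k - 0) = j + 1 by omega]
            exact hadj j (by omega)
          · rw [show k + 1 + (j - k - 1) = j by omega]
            exact e1 rfl
        · simp only [h, h', if_false]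
          rw [show k + 1 + (j - i - d) = k + (j - i - d) + 1 by omega]
          exact hadj _ (by omega)
    · intro k hk
      by_cases h : k ≤ i
      · simpa [h] using hpX k (by omega)
      · simpa [h] using hpX _ (by omega)
  refine ⟨n, p, ⟨?_, ?_⟩, hpX, ?_, ?_⟩
  · intro i hi j hj e
    rcases lt_trichotomy i j with h | h | h
    · exact (shortcut i j h hj 0 (by omega) (by omega) (fun _ => e) (by omega)).elim
    · exact h
    · exact (shortcut j i h hi 0 (by omega) (by omega) (fun _ => e.symm) (by omega)).elim
  · intro i hi j hj
    constructor
    · intro e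
      by_contra hcon
      rcases lt_trichotomy i j with h | h | h
      · exact shortcut i j h hj 1 (by omega) (by omega) (by omega) (fun _ => e)
      · subst h; exact G.irrefl e
      · exact shortcut j i h hi 1 (by omega) (by omega) (by omega) (fun _ => e.symm)
    · rintro (rfl | rfl)
      · exact hadj i (by omega)
      · exact (hadj j (by omega)).symm
  · intro i hi
    refine ⟨fun h => ?_, fun h => h ▸ h0⟩
    by_contra hne
    refine hmin (n - i) (by omega) ⟨fun k => p (k + i), by simpa using h, ?_, ?_, ?_⟩
    · change p (n - i + i) ∈ T
      rw [show n - i + i = n by omega]; exact hn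
    · intro k hk
      have := hadj (k + i) (by omega)
      rwa [show k + i + 1 = k + 1 + i by omega] at this
    · exact fun k hk => hpX _ (by omega)
  · intro i hi
    refine ⟨fun h => ?_, fun h => h ▸ hn⟩
    by_contra hne
    exact hmin i (by omega) ⟨p, h0, h, fun k hk => hadj k (by omega), fun k hk => hpX k (by omega)⟩

lemma exists_path (hX : G.IsLinked X) (ha : a ∈ X) (hb : b ∈ X) :
    ∃ (n : ℕ) (p : ℕ → V), G.IsInducedPath p n ∧ (∀ i ≤ n, p i ∈ X) ∧ p 0 = a ∧ p n = b := by
  obtain ⟨n, p, hp, hpX, hS, hT⟩ := hX.exists_path_between (S := {a}) (T := {b})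
    ⟨a, rfl, ha⟩ ⟨b, rfl, hb⟩
  exact ⟨n, p, hp, hpX, (hS 0 (by omega)).2 rfl, (hT n le_rfl).2 rfl⟩

end IsLinked

/-! ### Components of a vertex set -/

/-- `D` is (the vertex set of) a connected component of the subgraph induced by `U`. -/
structure IsComponentIn (G : SimpleGraph V) (U D : Set V) : Prop where
  nonempty : D.Nonempty
  subset : D ⊆ U
  isLinked : G.IsLinked D
  closed : ∀ a ∈ D, ∀ b ∈ U, G.Adj a b → b ∈ D

lemma exists_isComponentIn {U : Set V} {a : V} (ha : a ∈ U) :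
    ∃ D, G.IsComponentIn U D ∧ a ∈ D := by
  refine ⟨{b | b ∈ U ∧ G.LinkedIn U a b}, ⟨⟨a, ha, LinkedIn.refl _⟩, fun b hb => hb.1, ?_, ?_⟩,
    ha, LinkedIn.refl _⟩
  · have key : ∀ b, G.LinkedIn U a b → G.LinkedIn {b | b ∈ U ∧ G.LinkedIn U a b} a b := by
      intro b hb
      induction hb with
      | refl => exact LinkedIn.refl _
      | tail h h' ih =>
        exact ih.trans (LinkedIn.single ⟨h'.1, h⟩
          ⟨h'.2.1, h.trans (LinkedIn.single h'.1 h'.2.1 h'.2.2)⟩ h'.2.2)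
    exact fun b hb c hc => (key b hb.2).symm.trans (key c hc.2)
  · exact fun b hb c hc hbc => ⟨hc, hb.2.trans (LinkedIn.single hb.1 hc hbc)⟩

namespace IsComponentIn

variable {U D D' : Set V}

lemma subset_of_mem (h : G.IsComponentIn U D) {X : Set V} (hX : G.IsLinked X) (hXU : X ⊆ U)
    {a : V} (haD : a ∈ D) (haX : a ∈ X) : X ⊆ D := fun b hb =>
  (hX a haX b hb).mem_of_closed haD fun x hx y hy => h.closed x hx y (hXU hy)

lemma eq_of_mem (h : G.IsComponentIn U D) (h' : G.IsComponentIn U D') {a : V} (ha : a ∈ D)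
    (ha' : a ∈ D') : D = D' :=
  (h'.subset_of_mem h.isLinked h.subset ha' ha).antisymm
    (h.subset_of_mem h'.isLinked h'.subset ha ha')

lemma anticomplete (h : G.IsComponentIn U D) (h' : G.IsComponentIn U D') (hne : D ≠ D') :
    G.Anticomplete D D' := by
  refine ⟨Set.disjoint_left.2 fun a ha ha' => hne (h.eq_of_mem h' ha ha'), fun a ha b hb hab => ?_⟩
  exact hne (h.eq_of_mem h' (h.closed a ha b (h'.subset hb) hab) hb)

/-- In a linked graph, every component of what is left after deleting `N` touches `N`. -/
lemma exists_adj (h : G.IsComponentIn (U \ D') D) (hU : G.IsLinked U) (hN : (D' ∩ U).Nonempty) :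
    ∃ w ∈ D', w ∈ U ∧ G.Touches w D := by
  by_contra hcon
  push Not at hcon
  obtain ⟨d, hd⟩ := h.nonempty
  obtain ⟨w, hw, hwU⟩ := hN
  have : w ∈ D := by
    refine (hU d (h.subset hd).1 w hwU).mem_of_closed hd fun x hx y hy hxy => ?_
    by_cases hyN : y ∈ D'
    · exact (hcon y hyN hy ⟨x, hx, hxy.symm⟩).elim
    · exact h.closed x hx y ⟨hy, hyN⟩ hxy
  exact (h.subset this).2 hw

end IsComponentIn

/-! ### Thetas and prisms from linked sets -/

lemma Anticomplete.symm {A B : Set V} (h : G.Anticomplete A B) : G.Anticomplete B A :=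
  ⟨h.1.symm, fun a ha b hb hab => h.2 b hb a ha hab.symm⟩

lemma Anticomplete.mono {A B A' B' : Set V} (h : G.Anticomplete A B) (hA : A' ⊆ A) (hB : B' ⊆ B) :
    G.Anticomplete A' B' :=
  ⟨h.1.mono hA hB, fun a ha b hb => h.2 a (hA ha) b (hB hb)⟩

/-- Three pairwise anticomplete linked sets touching two nonadjacent vertices yield a theta. -/
lemma nonempty_theta {a b : V} (hab : a ≠ b) (hnadj : ¬ G.Adj a b) (X : Fin 3 → Set V)
    (hX : ∀ i, G.IsLinked (X i))
    (hta : ∀ i, G.Touches a (X i)) (htb : ∀ i, G.Touches b (X i))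
    (hanti : ∀ i j, i < j → G.Anticomplete (X i) (X j)) : Nonempty G.Theta := by
  -- An induced path from `a` to `b` inside `X i` with `a` and `b` added has its interior in `X i`,
  -- so the interiors inherit anticompleteness.
  have hl : ∀ i, G.IsLinked (insert b (insert a (X i))) := fun i =>
    ((hX i).insert_of_touches (hta i)).insert_of_touches ((htb i).mono (Set.subset_insert _ _))
  choose n p hp hpX h0 hn using fun i => (hl i).exists_path (a := a) (b := b) (by simp) (by simp)
  have h2 : ∀ i, 2 ≤ n i := by
    intro i
    by_contra hlt
    have : n i = 0 ∨ n i = 1 := by omega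
    rcases this with h | h
    · exact hab (by rw [← h0 i, ← hn i, h])
    · refine hnadj ?_
      rw [← h0 i, ← hn i, (hp i).2 _ (by omega) _ (by omega)]
      omega
  have hint : ∀ i, pathInterior (hp i).embedding ⊆ X i := by
    rintro i _ ⟨⟨k, rfl⟩, hk⟩
    simp only [IsInducedPath.embedding_apply, Fin.val_zero, Fin.val_last, h0, hn,
      Set.mem_insert_iff, Set.mem_singleton_iff, not_or] at hk ⊢
    have := hpX i k (by omega)
    simp only [Set.mem_insert_iff] at this
    tauto
  refine ⟨⟨a, b, n, fun i => (hp i).embedding, h2, fun i => by simp [h0], fun i => by simp [hn],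
    fun i j hij => ?_⟩⟩
  rcases lt_or_gt_of_ne hij with h | h
  · exact (hanti i j h).mono (hint i) (hint j)
  · exact ((hanti j i h).mono (hint j) (hint i)).symm

/-- Three disjoint linked sets joined by exactly two disjoint triangles yield a prism. -/
lemma nonempty_prism (a b : Fin 3 → V) (X : Fin 3 → Set V) (hX : ∀ i, G.IsLinked (X i))
    (ha : ∀ i, a i ∈ X i) (hb : ∀ i, b i ∈ X i) (hab : ∀ i, a i ≠ b i)
    (hdisj : ∀ i j, i < j → Disjoint (X i) (X j))
    (haa : ∀ i j, i < j → G.Adj (a i) (a j)) (hbb : ∀ i j, i < j → G.Adj (b i) (b j))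
    (hadj : ∀ i j, i < j → ∀ u ∈ X i, ∀ v ∈ X j, G.Adj u v →
      (u = a i ∧ v = a j) ∨ (u = b i ∧ v = b j)) : Nonempty G.Prism := by
  choose n p hp hpX h0 hn using fun i => (hX i).exists_path (ha i) (hb i)
  have key : ∀ i j, i < j → ∀ (s : Fin (n i + 1)) (s' : Fin (n j + 1)),
      G.Adj ((hp i).embedding s) ((hp j).embedding s') ↔
      (s = 0 ∧ s' = 0) ∨ (s = Fin.last _ ∧ s' = Fin.last _) := by
    intro i j hij s s'
    simp only [IsInducedPath.embedding_apply]
    constructor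
    · intro h
      rcases hadj i j hij _ (hpX i _ (by omega)) _ (hpX j _ (by omega)) h with ⟨h1, h2⟩ | ⟨h1, h2⟩
      · left
        rw [← h0] at h1 h2
        exact ⟨Fin.ext ((hp i).1 _ (by omega) _ (by omega) h1),
          Fin.ext ((hp j).1 _ (by omega) _ (by omega) h2)⟩
      · right
        rw [← hn] at h1 h2
        exact ⟨Fin.ext ((hp i).1 _ (by omega) _ (by omega) h1),
          Fin.ext ((hp j).1 _ (by omega) _ (by omega) h2)⟩
    · rintro (⟨rfl, rfl⟩ | ⟨rfl, rfl⟩)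
      · simpa [h0] using haa i j hij
      · simpa [hn] using hbb i j hij
  have hsub : ∀ i, Set.range (hp i).embedding ⊆ X i := by
    rintro i _ ⟨k, rfl⟩
    exact hpX i _ (by omega)
  refine ⟨⟨n, fun i => (hp i).embedding, fun i => ?_, fun i j hij => ?_, fun i j hij s s' => ?_⟩⟩
  · by_contra h
    exact hab i (by rw [← h0 i, ← hn i]; congr 1; omega)
  · rcases lt_or_gt_of_ne hij with h | h
    · exact (hdisj i j h).mono (hsub i) (hsub j)
    · exact ((hdisj j i h).mono (hsub j) (hsub i)).symm
  · rcases lt_or_gt_of_ne hij with h | h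
    · exact key i j h s s'
    · rw [G.adj_comm, key j i h s' s]
      tauto

/-! ### Ramsey's theorem for two colors -/

/-- Ramsey's theorem for ordered pairs `x < y` in a linear order. -/
theorem exists_ramsey_bound (a b : ℕ) : ∃ N : ℕ, ∀ {α : Type u} [LinearOrder α]
    (r : α → α → Prop) (s : Finset α), N ≤ s.card →
      (∃ t ⊆ s, t.card = a ∧ ∀ x ∈ t, ∀ y ∈ t, x < y → r x y) ∨
      (∃ t ⊆ s, t.card = b ∧ ∀ x ∈ t, ∀ y ∈ t, x < y → ¬ r x y) := by
  classical
  induction a generalizing b with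
  | zero => exact ⟨0, fun r s _ => Or.inl ⟨∅, by simp, by simp, by simp⟩⟩
  | succ a iha =>
    induction b with
    | zero => exact ⟨0, fun r s _ => Or.inr ⟨∅, by simp, by simp, by simp⟩⟩
    | succ b ihb =>
      obtain ⟨N₁, h₁⟩ := iha (b + 1)
      obtain ⟨N₂, h₂⟩ := ihb
      -- The least element `m` is set aside; the others are split by whether `r m` holds. Either
      -- `N₁` are related to `m` or `N₂` are not, and `m` can be added in front of the set found
      -- there.
      refine ⟨N₁ + N₂ + 1, fun {α} _ r s hs => ?_⟩
      have hne : s.Nonempty := Finset.card_pos.1 (by omega)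
      set m := s.min' hne with hm
      have hms : m ∈ s := s.min'_mem hne
      have hlt : ∀ x ∈ s.erase m, m < x := fun x hx => s.min'_lt_of_mem_erase_min' hne hx
      have hcard : ((s.erase m).filter (r m)).card + ((s.erase m).filter (fun x => ¬ r m x)).card
          = s.card - 1 := by
        rw [Finset.card_filter_add_card_filter_not, Finset.card_erase_of_mem hms]
      have aux : ∀ (c : ℕ) (P r' : α → α → Prop) (t : Finset α),
          t ⊆ (s.erase m).filter (fun x => P m x) → t.card = c →
          (∀ x ∈ t, ∀ y ∈ t, x < y → P x y) →
          ∃ t ⊆ s, t.card = c + 1 ∧ ∀ x ∈ t, ∀ y ∈ t, x < y → P x y := by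
        intro c P _ t ht hc hP
        have ht' : ∀ x ∈ t, m < x ∧ P m x ∧ x ∈ s := fun x hx => by
          have := Finset.mem_filter.1 (ht hx)
          exact ⟨hlt x this.1, this.2, Finset.mem_of_mem_erase this.1⟩
        refine ⟨insert m t, ?_, ?_, ?_⟩
        · exact Finset.insert_subset hms fun x hx => (ht' x hx).2.2
        · rw [Finset.card_insert_of_notMem fun h => (ht' m h).1.false, hc]
        · intro x hx y hy hxy
          rcases Finset.mem_insert.1 hx with rfl | hx <;> rcases Finset.mem_insert.1 hy with rfl | hy
          · exact (hxy.false).elim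
          · exact (ht' y hy).2.1
          · exact ((ht' x hx).1.trans hxy).false.elim
          · exact hP x hx y hy hxy
      by_cases hbig : N₁ ≤ ((s.erase m).filter (r m)).card
      · rcases h₁ r _ hbig with ⟨t, ht, hc, hr⟩ | ⟨t, ht, hc, hr⟩
        · exact Or.inl (aux a r r t ht hc hr)
        · exact Or.inr ⟨t, ht.trans ((Finset.filter_subset _ _).trans (Finset.erase_subset _ _)),
            hc, hr⟩
      · rcases h₂ r ((s.erase m).filter (fun x => ¬ r m x)) (by omega) with
          ⟨t, ht, hc, hr⟩ | ⟨t, ht, hc, hr⟩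
        · exact Or.inl ⟨t, ht.trans ((Finset.filter_subset _ _).trans (Finset.erase_subset _ _)),
            hc, hr⟩
        · exact Or.inr (aux b (fun x y => ¬ r x y) r t (fun x hx => by simpa using ht hx) hc hr)

/-- Ramsey's theorem for a symmetric relation. -/
theorem exists_ramsey_bound_symm (a b : ℕ) : ∃ N : ℕ, ∀ {α : Type u} (r : α → α → Prop)
    (_ : ∀ x y, r x y → r y x) (s : Finset α), N ≤ s.card →
      (∃ t ⊆ s, t.card = a ∧ ∀ x ∈ t, ∀ y ∈ t, x ≠ y → r x y) ∨
      (∃ t ⊆ s, t.card = b ∧ ∀ x ∈ t, ∀ y ∈ t, x ≠ y → ¬ r x y) := by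
  obtain ⟨N, hN⟩ := exists_ramsey_bound.{u} a b
  refine ⟨N, fun {α} r hr s hs => ?_⟩
  let : LinearOrder α := WellOrderingRel.isWellOrder.linearOrder
  rcases hN r s hs with ⟨t, ht, hc, h⟩ | ⟨t, ht, hc, h⟩
  · refine Or.inl ⟨t, ht, hc, fun x hx y hy hxy => ?_⟩
    rcases lt_or_gt_of_ne hxy with hlt | hlt
    · exact h x hx y hy hlt
    · exact hr _ _ (h y hy x hx hlt)
  · refine Or.inr ⟨t, ht, hc, fun x hx y hy hxy => ?_⟩
    rcases lt_or_gt_of_ne hxy with hlt | hlt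
    · exact h x hx y hy hlt
    · exact fun h' => h y hy x hx hlt (hr _ _ h')

end SimpleGraph

namespace SimpleGraph

universe u
variable {V : Type u} {G : SimpleGraph V}

/-! ### Combs -/

/-- A comb in `A` with teeth at the vertices of `Y`: an induced path `p` in `A` and pairwise
anticomplete linked sets `X y ⊆ A ∪ {y}` containing `y` and touching the path. -/
structure IsComb (G : SimpleGraph V) (A : Set V) (Y : Finset V) (p : ℕ → V) (n : ℕ)
    (X : V → Set V) : Prop where
  path : G.IsInducedPath p n
  mem : ∀ i ≤ n, p i ∈ A
  self_mem : ∀ y ∈ Y, y ∈ X y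
  subset : ∀ y ∈ Y, X y ⊆ insert y A
  isLinked : ∀ y ∈ Y, G.IsLinked (X y)
  notMem : ∀ y ∈ Y, ∀ i ≤ n, p i ∉ X y
  touches : ∀ y ∈ Y, ∃ i ≤ n, G.Touches (p i) (X y)
  anticomplete : ∀ y ∈ Y, ∀ y' ∈ Y, y ≠ y' → G.Anticomplete (X y) (X y')

lemma IsComb.mono_finset {A : Set V} {Y Y' : Finset V} {p : ℕ → V} {n : ℕ} {X : V → Set V}
    (h : G.IsComb A Y p n X) (hY : Y' ⊆ Y) : G.IsComb A Y' p n X where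
  path := h.path
  mem := h.mem
  self_mem y hy := h.self_mem y (hY hy)
  subset y hy := h.subset y (hY hy)
  isLinked y hy := h.isLinked y (hY hy)
  notMem y hy := h.notMem y (hY hy)
  touches y hy := h.touches y (hY hy)
  anticomplete y hy y' hy' := h.anticomplete y (hY hy) y' (hY hy')

lemma IsComb.mono_set {A A' : Set V} {Y : Finset V} {p : ℕ → V} {n : ℕ} {X : V → Set V}
    (h : G.IsComb A Y p n X) (hA : A ⊆ A') : G.IsComb A' Y p n X where
  path := h.path
  mem i hi := hA (h.mem i hi)
  self_mem := h.self_mem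
  subset y hy := (h.subset y hy).trans (Set.insert_subset_insert hA)
  isLinked := h.isLinked
  notMem := h.notMem
  touches := h.touches
  anticomplete := h.anticomplete

/-- In a minimal linked set touched by `Y`, a vertex with many pairwise nonadjacent neighbors is
the center of a star with teeth in `Y`. -/
lemma exists_isComb_of_star {A : Set V} {Y L : Finset V} {c : V} (hA : G.IsLinked A)
    (hYA : ∀ y ∈ Y, y ∉ A) (hYs : ∀ y ∈ Y, ∀ y' ∈ Y, ¬ G.Adj y y')
    (hYt : ∀ y ∈ Y, G.Touches y A)
    (hmin : ∀ A' ⊂ A, G.IsLinked A' → ∃ y ∈ Y, ¬ G.Touches y A') (hc : c ∈ A)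
    (hLA : ∀ l ∈ L, l ∈ A) (hLc : ∀ l ∈ L, G.Adj c l)
    (hLs : ∀ l ∈ L, ∀ l' ∈ L, ¬ G.Adj l l') :
    ∃ Y' ⊆ Y, Y'.card = L.card ∧ ∃ X, G.IsComb A Y' (fun _ => c) 0 X := by
  classical
  -- `K l` is the part of `A` still joined to `c` once `l` is deleted, so `A \ K l` is the branch
  -- hanging behind `l`. By minimality of `A` some `y l` does not touch `K l`; it touches `A`, hence
  -- this branch.
  have hK : ∀ l ∈ L, ∃ K, G.IsComponentIn (A \ {l}) K ∧ c ∈ K := fun l hl =>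
    exists_isComponentIn ⟨hc, (hLc l hl).ne⟩
  choose! K hK hcK using hK
  have hlK : ∀ l ∈ L, l ∉ K l := fun l hl h => ((hK l hl).subset h).2 rfl
  have hKA : ∀ l ∈ L, K l ⊂ A := fun l hl =>
    ⟨fun x hx => ((hK l hl).subset hx).1, fun h => hlK l hl (h (hLA l hl))⟩
  have hy : ∀ l ∈ L, ∃ y ∈ Y, ¬ G.Touches y (K l) := fun l hl =>
    hmin _ (hKA l hl) (hK l hl).isLinked
  choose! y hyY hyK using hy
  have hlinked : ∀ l ∈ L, G.IsLinked (A \ K l) := by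
    intro l hl
    have key : ∀ x ∈ A \ K l, G.LinkedIn (A \ K l) x l := by
      intro x hx
      by_cases hxl : x = l
      · exact hxl ▸ LinkedIn.refl _
      obtain ⟨D, hD, hxD⟩ := exists_isComponentIn (G := G) (U := A \ {l}) ⟨hx.1, hxl⟩
      have hne : D ≠ K l := fun h => hx.2 (h ▸ hxD)
      obtain ⟨w, rfl, -, hw⟩ := hD.exists_adj hA ⟨l, rfl, hLA l hl⟩
      have hsub : insert w D ⊆ A \ K w := by
        rintro z (rfl | hz)
        · exact ⟨hLA _ hl, hlK _ hl⟩
        · exact ⟨(hD.subset hz).1,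
            Set.disjoint_left.1 (hD.anticomplete (hK w hl) hne).1 hz⟩
      exact ((hD.isLinked.insert_of_touches hw) x (Or.inr hxD) w (Or.inl rfl)).mono hsub
    exact fun x hx z hz => (key x hx).trans (key z hz).symm
  -- Distinct branches are disjoint: the branch behind `l` is connected, avoids `l'` and contains
  -- `l`, which stays adjacent to `c` when `l'` is deleted.
  have hsub : ∀ l ∈ L, ∀ l' ∈ L, l ≠ l' → A \ K l ⊆ K l' := by
    intro l hl l' hl' hne
    have h1 : l' ∈ K l := (hK l hl).closed c (hcK l hl) l' ⟨hLA l' hl', hne.symm⟩ (hLc l' hl')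
    have h2 : l ∈ K l' := (hK l' hl').closed c (hcK l' hl') l ⟨hLA l hl, hne⟩ (hLc l hl)
    refine (hK l' hl').subset_of_mem (hlinked l hl) ?_ h2 ⟨hLA l hl, hlK l hl⟩
    exact fun x hx => ⟨hx.1, fun h => hx.2 (h ▸ h1)⟩
  have hnt : ∀ l ∈ L, ∀ l' ∈ L, l ≠ l' → ¬ G.Touches (y l') (A \ K l) :=
    fun l hl l' hl' hne h => hyK l' hl' (h.mono (hsub l hl l' hl' hne))
  have hyt : ∀ l ∈ L, G.Touches (y l) (A \ K l) := by
    intro l hl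
    obtain ⟨x, hx, hxy⟩ := hYt _ (hyY l hl)
    exact ⟨x, ⟨hx, fun h => hyK l hl ⟨x, h, hxy⟩⟩, hxy⟩
  have hinj : Set.InjOn y L := by
    intro l hl l' hl' e
    by_contra hne
    exact hnt l hl l' hl' hne (e ▸ hyt l hl)
  have hL : ∀ z ∈ L.image y, ∃ l ∈ L, y l = z := fun z hz => by simpa using hz
  choose! g hgL hg using hL
  refine ⟨L.image y, ?_, Finset.card_image_of_injOn hinj, fun z => insert z (A \ K (g z)),
    IsInducedPath.singleton c, fun _ _ => hc, fun z _ => Or.inl rfl,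
    fun z _ => Set.insert_subset_insert Set.sdiff_subset, ?_, ?_, ?_, ?_⟩
  · intro z hz
    rw [← hg z hz]
    exact hyY _ (hgL z hz)
  · intro z hz
    refine (hlinked _ (hgL z hz)).insert_of_touches ?_
    have := hyt _ (hgL z hz)
    rwa [hg z hz] at this
  · rintro z hz i - (h | h)
    · refine hYA z ?_ (h ▸ hc)
      rw [← hg z hz]; exact hyY _ (hgL z hz)
    · exact h.2 (hcK _ (hgL z hz))
  · intro z hz
    exact ⟨0, le_rfl, g z, Or.inr ⟨hLA _ (hgL z hz), hlK _ (hgL z hz)⟩, hLc _ (hgL z hz)⟩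
  · intro z hz z' hz' hne
    have hl := hgL z hz
    have hl' := hgL z' hz'
    have hzY : z ∈ Y := hg z hz ▸ hyY _ hl
    have hzY' : z' ∈ Y := hg z' hz' ▸ hyY _ hl'
    have hll : g z ≠ g z' := fun e => hne (by rw [← hg z hz, ← hg z' hz', e])
    have hdis : ∀ x, x ∈ A \ K (g z) → x ∉ A \ K (g z') := fun x hx hx' =>
      hx'.2 (hsub _ hl _ hl' hll hx)
    have ht := hnt _ hl _ hl' hll
    have ht' := hnt _ hl' _ hl hll.symm
    rw [hg z' hz'] at ht
    rw [hg z hz] at ht'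
    constructor
    · rw [Set.disjoint_left]
      rintro x (rfl | hx) (rfl | hx')
      · exact hne rfl
      · exact hYA _ hzY hx'.1
      · exact hYA _ hzY' hx.1
      · exact hdis x hx hx'
    · rintro x (rfl | hx) x' (rfl | hx') hadj
      · exact hYs _ hzY _ hzY' hadj
      · exact ht' ⟨x', hx', hadj⟩
      · exact ht ⟨x, hx, hadj.symm⟩
      -- An edge between two branches can only join their roots, and these are nonadjacent members
      -- of `L`.
      · have h1 : x = g z := by
          by_contra h
          exact hx.2 ((hK _ hl).closed x' (hsub _ hl' _ hl hll.symm hx') x ⟨hx.1, h⟩ hadj.symm)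
        have h2 : x' = g z' := by
          by_contra h
          exact hx'.2 ((hK _ hl').closed x (hsub _ hl _ hl' hll hx) x' ⟨hx'.1, h⟩ hadj)
        exact hLs _ hl _ hl' (h1 ▸ h2 ▸ hadj)

/-- The number of vertices needed in `exists_weak_comb`. -/
def weakCombBound (d k : ℕ) : ℕ → ℕ
  | 0 => 0
  | h + 1 => d * k + (d * d * weakCombBound d k h + 1)

/-- In a linked graph of bounded degree touched by many vertices of `Y`, but all of whose induced
paths are touched by few of them, there is an induced path with many disjoint teeth, among which
no large number touch pairwise. -/
lemma exists_weak_comb [Finite V] {A : Set V} {Y : Finset V} (hYA : ∀ y ∈ Y, y ∉ A)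
    (hYs : ∀ y ∈ Y, ∀ y' ∈ Y, ¬ G.Adj y y') (d k : ℕ)
    (hdeg : ∀ c ∈ A, (G.neighborSet c ∩ A).ncard ≤ d)
    (hpath : ∀ p n, G.IsInducedPath p n → (∀ i ≤ n, p i ∈ A) →
      {y | y ∈ Y ∧ ∃ i ≤ n, G.Adj y (p i)}.ncard ≤ k) :
    ∀ (N h : ℕ) (C : Set V) (v : V) (Z : Finset V), C.ncard ≤ N → C ⊆ A → v ∈ A → v ∉ C →
      G.Touches v C → G.IsLinked C → Z ⊆ Y → (∀ z ∈ Z, G.Touches z C) →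
      weakCombBound d k h ≤ Z.card →
      ∃ Z' ⊆ Z, Z'.card = h ∧ ∃ (n : ℕ) (p : ℕ → V) (X : V → Set V), p 0 = v ∧
        (∀ i ≤ n, i ≠ 0 → p i ∈ C) ∧ G.IsInducedPath p n ∧
        (∀ z ∈ Z', z ∈ X z ∧ X z ⊆ insert z C ∧ G.IsLinked (X z) ∧ (∀ i ≤ n, p i ∉ X z) ∧
          ∃ i ≤ n, G.Touches (p i) (X z)) ∧
        (∀ z ∈ Z', ∀ z' ∈ Z', z ≠ z' → Disjoint (X z) (X z')) ∧
        ∀ Q ⊆ Z', (∀ z ∈ Q, ∀ z' ∈ Q, z ≠ z' → ¬ G.Anticomplete (X z) (X z')) →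
          Q.card ≤ d + k + 1 := by
  classical
  have := Fintype.ofFinite V
  -- Induction on the size of `C`: the path starts at `v`, steps to a neighbor `w` in `C`, and
  -- continues in a component `C₁` of what is left of `C` after deleting all neighbors of `v`.
  -- Vertices of `Z` that do not touch `C₁` are the source of teeth.
  intro N
  induction N with
  | zero =>
    intro h C v Z hCN _ _ _ hvt
    obtain ⟨x, hx, -⟩ := hvt
    have : C.ncard = 0 := by omega
    rw [Set.ncard_eq_zero (Set.toFinite _)] at this
    exact (this ▸ hx : x ∈ (∅ : Set V)).elim
  | succ N ih =>
  intro h C v Z hCN hCA hvA hvC hvt hC hZY hZt hZ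
  cases h with
  | zero =>
    exact ⟨∅, by simp, by simp, 0, fun _ => v, fun _ => ∅, rfl, by simp,
      IsInducedPath.singleton v, by simp, by simp, fun Q hQ _ => by
        rw [Finset.subset_empty.1 hQ]; simp⟩
  | succ h =>
  set M : Set V := G.neighborSet v ∩ C with hMdef
  have hM : M.ncard ≤ d :=
    (Set.ncard_le_ncard (Set.inter_subset_inter_right _ hCA) (Set.toFinite _)).trans (hdeg v hvA)
  have hMne : (M ∩ C).Nonempty := by
    obtain ⟨x, hx, hvx⟩ := hvt
    exact ⟨x, ⟨hvx, hx⟩, hx⟩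
  -- few vertices of `Z` touch `M`
  have hZ0 : (Z.filter fun z => G.Touches z M).card ≤ d * k := by
    have hsub : (Z.filter fun z => G.Touches z M) ⊆
        M.toFinset.biUnion fun w => Y.filter fun y => G.Adj y w := by
      intro z hz
      obtain ⟨hzZ, w, hw, hzw⟩ := Finset.mem_filter.1 hz
      simp only [Finset.mem_biUnion, Set.mem_toFinset, Finset.mem_filter]
      exact ⟨w, hw, hZY hzZ, hzw⟩
    refine (Finset.card_le_card hsub).trans ((Finset.card_biUnion_le_card_mul _ _ k ?_).trans ?_)
    · intro w hw
      rw [Set.mem_toFinset] at hw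
      have := hpath (fun _ => w) 0 (IsInducedPath.singleton w) fun _ _ => hCA hw.2
      rw [← Set.ncard_coe_finset]
      refine (Set.ncard_le_ncard ?_ (Set.toFinite _)).trans this
      intro y hy
      simp only [Finset.coe_filter, Set.mem_ofPred_eq] at hy
      exact ⟨hy.1, 0, le_rfl, hy.2⟩
    · rw [← Set.ncard_eq_toFinset_card']
      exact Nat.mul_le_mul_right k hM
  -- most vertices of `Z` see a common component of `C \ M`
  obtain ⟨w, hwM, C₁, hC₁, hwC₁, hfib⟩ : ∃ w ∈ M, ∃ C₁, G.IsComponentIn (C \ M) C₁ ∧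
      G.Touches w C₁ ∧ weakCombBound d k h ≤ (Z.filter fun z => G.Touches z C₁).card := by
    have hf : ∀ z ∈ Z.filter (fun z => ¬ G.Touches z M), ∃ e : (_ : V) × V, e.1 ∈ M ∧
        e.2 ∈ C \ M ∧ G.Adj e.1 e.2 ∧ ∃ D, G.IsComponentIn (C \ M) D ∧ e.2 ∈ D ∧
          G.Touches z D := by
      intro z hz
      obtain ⟨hzZ, hzM⟩ := Finset.mem_filter.1 hz
      obtain ⟨c, hc, hzc⟩ := hZt z hzZ
      have hcM : c ∉ M := fun hcM => hzM ⟨c, hcM, hzc⟩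
      obtain ⟨D, hD, hcD⟩ := exists_isComponentIn (G := G) (U := C \ M) ⟨hc, hcM⟩
      obtain ⟨w, hw, -, u, hu, hwu⟩ := hD.exists_adj hC hMne
      exact ⟨⟨w, u⟩, hw, hD.subset hu, hwu, D, hD, hu, c, hcD, hzc⟩
    have : Nonempty ((_ : V) × V) := ⟨⟨v, v⟩⟩
    choose! f hf1 hf2 hf3 hf4 using hf
    -- Every component of `C \ M` is reached by an edge with its first end in `M`, and such an edge
    -- determines the component. There are at most `d * d` of these edges, and more than `d * d *
    -- weakCombBound d k h` vertices of `Z` remain, so the pigeonhole principle selects one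
    -- component.
    have hcard : (M.toFinset.sigma fun w => (G.neighborSet w ∩ A).toFinset).card ≤ d * d := by
      rw [Finset.card_sigma]
      refine (Finset.sum_le_card_nsmul _ _ d fun w hw => ?_).trans ?_
      · rw [← Set.ncard_eq_toFinset_card']
        exact hdeg w (hCA (Set.mem_toFinset.1 hw).2)
      · rw [smul_eq_mul, ← Set.ncard_eq_toFinset_card']
        exact Nat.mul_le_mul_right d hM
    have hsum := Finset.card_filter_add_card_filter_not (s := Z) (fun z => G.Touches z M)
    simp only [weakCombBound] at hZ
    obtain ⟨e, -, he⟩ := Finset.exists_lt_card_fiber_of_mul_lt_card_of_maps_to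
      (s := Z.filter (fun z => ¬ G.Touches z M))
      (t := M.toFinset.sigma fun w => (G.neighborSet w ∩ A).toFinset) (f := f)
      (n := weakCombBound d k h) (by
        intro z hz
        simp only [Finset.mem_sigma, Set.mem_toFinset]
        exact ⟨hf1 z hz, hf3 z hz, hCA (hf2 z hz).1⟩)
      (lt_of_le_of_lt (Nat.mul_le_mul_right _ hcard) (by omega))
    obtain ⟨z₀, hz₀'⟩ := Finset.card_pos.1 (lt_of_le_of_lt (Nat.zero_le _) he)
    obtain ⟨hz₀, rfl⟩ := Finset.mem_filter.1 hz₀'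
    obtain ⟨D, hD, huD, -⟩ := hf4 z₀ hz₀
    refine ⟨_, hf1 z₀ hz₀, D, hD, ⟨_, huD, hf3 z₀ hz₀⟩, he.le.trans (Finset.card_le_card ?_)⟩
    intro z hz
    obtain ⟨hz, hzz⟩ := Finset.mem_filter.1 hz
    obtain ⟨D', hD', huD', hzD'⟩ := hf4 z hz
    rw [Finset.mem_filter]
    refine ⟨(Finset.mem_filter.1 hz).1, ?_⟩
    rw [hzz] at huD'
    rwa [hD.eq_of_mem hD' huD huD']
  have hC₁C : C₁ ⊆ C := fun x hx => (hC₁.subset hx).1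
  have hC₁M : ∀ x ∈ C₁, ¬ G.Adj v x := fun x hx hvx => (hC₁.subset hx).2 ⟨hvx, hC₁C hx⟩
  have hwC : w ∈ C := hwM.2
  have hwC₁' : w ∉ C₁ := fun hw => (hC₁.subset hw).2 hwM
  have hlt : C₁.ncard ≤ N := by
    have : C₁.ncard < C.ncard :=
      Set.ncard_lt_ncard ⟨hC₁C, fun hsub => hwC₁' (hsub hwC)⟩ (Set.toFinite _)
    omega
  -- prepending `v` to the path
  have hcons : ∀ (p' : ℕ → V) (n : ℕ), p' 0 = w → (∀ i ≤ n, i ≠ 0 → p' i ∈ C₁) →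
      G.IsInducedPath p' n → ∃ p : ℕ → V, p 0 = v ∧ (∀ i, p (i + 1) = p' i) ∧
        G.IsInducedPath p (n + 1) := by
    intro p' n h0 hC' hp'
    have := (IsInducedPath.singleton (G := G) v).append hp' (fun i _ j hj e => by
        by_cases hj0 : j = 0
        · subst hj0; exact hvC (by rw [e, h0]; exact hwC)
        · exact hvC (e ▸ hC₁C (hC' j hj hj0))) (fun i hi j hj => by
        by_cases hj0 : j = 0
        · subst hj0
          simp only [h0, and_true]
          exact ⟨fun _ => by omega, fun _ => hwM.1⟩
        · simp only [hj0, and_false, iff_false]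
          exact hC₁M _ (hC' j hj hj0))
    refine ⟨_, ?_, fun i => ?_, by rwa [show 0 + 1 + n = n + 1 by omega] at this⟩
    · simp
    · simp
  -- If all of `Z` touches `C₁`, the same number of teeth can be sought there. Otherwise some `z₀`
  -- not touching `C₁` yields one tooth outside `C₁`, and the remaining `h` come from the recursive
  -- call.
  by_cases hall : ∀ z ∈ Z, G.Touches z C₁
  · obtain ⟨Z', hZ'Z, hZ'c, n, p', X, h0, hp'C, hp', hX, hdis, hQ⟩ :=
      ih (h + 1) C₁ w Z hlt (hC₁C.trans hCA) (hCA hwC) hwC₁' hwC₁ hC₁.isLinked hZY hall hZ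
    obtain ⟨p, hpv, hps, hp⟩ := hcons p' n h0 hp'C hp'
    refine ⟨Z', hZ'Z, hZ'c, n + 1, p, X, hpv, ?_, hp, ?_, hdis, hQ⟩
    · rintro (_ | i) hi hne
      · exact (hne rfl).elim
      · rw [hps]
        by_cases hi0 : i = 0
        · rw [hi0, h0]; exact hwC
        · exact hC₁C (hp'C i (by omega) hi0)
    · intro z hz
      obtain ⟨h1, h2, h3, h4, i, hi, hit⟩ := hX z hz
      refine ⟨h1, h2.trans (Set.insert_subset_insert hC₁C), h3, ?_, i + 1, by omega, by rwa [hps]⟩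
      rintro (_ | j) hj
      · rw [hpv]
        intro hv
        rcases h2 hv with e | hv
        · exact hYA z (hZY (hZ'Z hz)) (e ▸ hvA)
        · exact hvC (hC₁C hv)
      · rw [hps]; exact h4 j (by omega)
  · push Not at hall
    obtain ⟨z₀, hz₀Z, hz₀⟩ := hall
    have hz₀Y := hZY hz₀Z
    have hz₀A := hYA z₀ hz₀Y
    obtain ⟨Z', hZ'Z, hZ'c, n, p', X, h0, hp'C, hp', hX, hdis, hQ⟩ :=
      ih h C₁ w (Z.filter fun z => G.Touches z C₁) hlt (hC₁C.trans hCA) (hCA hwC) hwC₁' hwC₁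
        hC₁.isLinked ((Finset.filter_subset _ _).trans hZY)
        (fun z hz => (Finset.mem_filter.1 hz).2) hfib
    obtain ⟨p, hpv, hps, hp⟩ := hcons p' n h0 hp'C hp'
    have hz₀Z' : z₀ ∉ Z' := fun hz => hz₀ (Finset.mem_filter.1 (hZ'Z hz)).2
    have hZ'Z : Z' ⊆ Z := hZ'Z.trans (Finset.filter_subset _ _)
    -- the new tooth
    obtain ⟨S, m, e, hSC, hwS, hSl, hSt, hSe, hSY⟩ : ∃ (S : Set V) (m : ℕ) (e : V),
        S ⊆ C \ C₁ ∧ w ∉ S ∧ G.IsLinked (insert z₀ S) ∧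
        (G.Touches v (insert z₀ S) ∨ G.Touches w (insert z₀ S)) ∧
        (∀ s ∈ S, G.Touches s C₁ → s = e) ∧ {y | y ∈ Y ∧ G.Touches y S}.ncard ≤ k := by
      obtain ⟨c, hcC, hz₀c⟩ := hZt z₀ hz₀Z
      have hcC₁ : c ∉ C₁ := fun hc => hz₀ ⟨c, hc, hz₀c⟩
      obtain ⟨W, hW, hWC, hcW, hWM⟩ : ∃ W, G.IsLinked W ∧ W ⊆ C \ C₁ ∧ c ∈ W ∧
          (M ∩ W).Nonempty := by
        by_cases hcM : c ∈ M
        · exact ⟨{c}, IsLinked.singleton c, by simpa using ⟨hcC, hcC₁⟩, rfl, c, hcM, rfl⟩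
        · obtain ⟨D, hD, hcD⟩ := exists_isComponentIn (G := G) (U := C \ M) ⟨hcC, hcM⟩
          obtain ⟨x, hxM, hxC, hxD⟩ := hD.exists_adj hC hMne
          refine ⟨insert x D, hD.isLinked.insert_of_touches hxD, ?_, Or.inr hcD,
            x, hxM, Or.inl rfl⟩
          have hne : D ≠ C₁ := fun e => hcC₁ (e ▸ hcD)
          rintro z (rfl | hz)
          · exact ⟨hxC, fun hz => (hC₁.subset hz).2 hxM⟩
          · exact ⟨(hD.subset hz).1, Set.disjoint_left.1 (hD.anticomplete hC₁ hne).1 hz⟩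
      -- A shortest path to `M` meets `M` only in its last vertex. A vertex of `C` outside `C₁` with
      -- a neighbor in `C₁` must lie in `M`, so only this last vertex can touch `C₁`.
      obtain ⟨m, q, hq, hqW, hqc, hqM⟩ := hW.exists_path_between (S := {c}) (T := M)
        ⟨c, rfl, hcW⟩ hWM
      have hq0 : q 0 = c := (hqc 0 (by omega)).2 rfl
      have hqm : q m ∈ M := (hqM m le_rfl).2 rfl
      have hqY := hpath q m hq fun i hi => hCA (hWC (hqW i hi)).1
      have hlink : ∀ m' ≤ m + 1, G.IsLinked (insert z₀ {x | ∃ i < m', q i = x}) := by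
        intro m' hm'
        rcases Nat.eq_zero_or_pos m' with rfl | hpos
        · simpa using IsLinked.singleton z₀
        · refine IsLinked.insert_of_touches ?_ ⟨c, ⟨0, hpos, hq0⟩, hz₀c⟩
          have := IsLinked.segment hq 0 (m' - 1) (by omega)
          convert this using 3 with x
          refine exists_congr fun i => ?_
          have : i < m' ↔ (0 ≤ i ∧ i ≤ m' - 1) := by omega
          rw [this, and_assoc]
      have hend : ∀ i ≤ m, G.Touches (q i) C₁ → q i = q m := by
        intro i hi ⟨x, hx, hix⟩
        have hi' := hWC (hqW i hi)
        have : q i ∈ M := by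
          by_contra hcon
          exact hi'.2 (hC₁.closed x hx _ ⟨hi'.1, hcon⟩ hix.symm)
        rw [(hqM i hi).1 this]
      have hYb : ∀ m' ≤ m + 1,
          {y | y ∈ Y ∧ G.Touches y {x | ∃ i < m', q i = x}}.ncard ≤ k := by
        intro m' hm'
        refine (Set.ncard_le_ncard ?_ (Set.toFinite _)).trans hqY
        rintro y ⟨hy, x, ⟨i, hi, rfl⟩, hyx⟩
        exact ⟨hy, i, by omega, hyx⟩
      -- If the path ends in `w`, that vertex belongs to the comb's path and is dropped from the
      -- tooth, which then touches `w`; otherwise the tooth touches `v`.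
      by_cases hqw : q m = w
      · refine ⟨{x | ∃ i < m, q i = x}, m, q m, ?_, ?_, hlink m (by omega), ?_, ?_,
          hYb m (by omega)⟩
        · rintro _ ⟨i, hi, rfl⟩
          exact hWC (hqW i (by omega))
        · rintro ⟨i, hi, e⟩
          have := hq.1 i (by omega) m le_rfl (e.trans hqw.symm)
          omega
        · right
          rcases Nat.eq_zero_or_pos m with rfl | hpos
          · exact ⟨z₀, Or.inl rfl, by rw [← hqw, hq0]; exact hz₀c.symm⟩
          · refine ⟨q (m - 1), Or.inr ⟨m - 1, by omega, rfl⟩, ?_⟩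
            rw [← hqw, hq.2 _ le_rfl _ (by omega)]
            omega
        · rintro _ ⟨i, hi, rfl⟩ ht
          exact hend i (by omega) ht
      · refine ⟨{x | ∃ i < m + 1, q i = x}, m, q m, ?_, ?_, hlink _ le_rfl, ?_, ?_,
          hYb _ le_rfl⟩
        · rintro _ ⟨i, hi, rfl⟩
          exact hWC (hqW i (by omega))
        · rintro ⟨i, hi, e⟩
          refine hqw ?_
          rw [← (hqM i (by omega)).1 (e ▸ hwM), e]
        · exact Or.inl ⟨q m, Or.inr ⟨m, by omega, rfl⟩, hqm.1⟩
        · rintro _ ⟨i, hi, rfl⟩ ht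
          exact hend i (by omega) ht
    have hXz : ∀ z ∈ Z', Function.update X z₀ (insert z₀ S) z = X z := fun z hz =>
      Function.update_of_ne (ne_of_mem_of_not_mem hz hz₀Z') _ _
    have hX0 : Function.update X z₀ (insert z₀ S) z₀ = insert z₀ S := Function.update_self ..
    have hdisj0 : ∀ z ∈ Z', Disjoint (insert z₀ S) (X z) := by
      intro z hz
      rw [Set.disjoint_left]
      have hzY := hZY (hZ'Z hz)
      rintro x (rfl | hx) hxz <;> rcases (hX z hz).2.1 hxz with rfl | hx'
      · exact hz₀Z' hz
      · exact hz₀A (hCA (hC₁C hx'))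
      · exact hYA _ hzY (hCA (hSC hx).1)
      · exact (hSC hx).2 hx'
    -- The new tooth can touch a tooth from the recursive call in two ways: through `e`, at most `d`
    -- times since those teeth are disjoint, or because the vertex `z` itself is adjacent to `S`, at
    -- most `k` times since `S` lies on one induced path. Counting from the tooth added last,
    -- pairwise touching teeth number at most `d + k + 1`.
    have hfew : (Z'.filter fun z => ¬ G.Anticomplete (insert z₀ S) (X z)).card ≤ d + k := by
      have hsub : (Z'.filter fun z => ¬ G.Anticomplete (insert z₀ S) (X z)) ⊆
          (Z'.filter fun z => e ∈ A ∧ ∃ x ∈ X z, x ∈ C₁ ∧ G.Adj e x) ∪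
            Y.filter fun z => G.Touches z S := by
        intro z hz
        obtain ⟨hzZ', hna⟩ := Finset.mem_filter.1 hz
        have hzY := hZY (hZ'Z hzZ')
        have : ∃ a ∈ insert z₀ S, ∃ b ∈ X z, G.Adj a b := by
          by_contra hcon
          push Not at hcon
          exact hna ⟨hdisj0 z hzZ', hcon⟩
        obtain ⟨a, ha, b, hb, hab⟩ := this
        rw [Finset.mem_union, Finset.mem_filter, Finset.mem_filter]
        rcases ha with rfl | ha <;> rcases (hX z hzZ').2.1 hb with rfl | hb'
        · exact (hYs _ hz₀Y _ hzY hab).elim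
        · exact (hz₀ ⟨b, hb', hab⟩).elim
        · exact Or.inr ⟨hzY, a, ha, hab.symm⟩
        · have hae := hSe a ha ⟨b, hb', hab⟩
          subst hae
          exact Or.inl ⟨hzZ', hCA (hSC ha).1, b, hb, hb', hab⟩
      refine (Finset.card_le_card hsub).trans ((Finset.card_union_le _ _).trans
        (add_le_add ?_ ?_))
      · by_cases heA : e ∈ A
        · have hch : ∀ z ∈ Z'.filter (fun z => e ∈ A ∧ ∃ x ∈ X z, x ∈ C₁ ∧ G.Adj e x),
              ∃ x ∈ X z, x ∈ C₁ ∧ G.Adj e x := fun z hz => (Finset.mem_filter.1 hz).2.2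
          choose! x hxX hxC hex using hch
          refine le_trans (Finset.card_le_card_of_injOn (t := (G.neighborSet e ∩ A).toFinset) x
            (fun z hz => ?_) ?_) ?_
          · simp only [Finset.mem_coe] at hz
            simp only [Set.coe_toFinset]
            exact ⟨hex z hz, hCA (hC₁C (hxC z hz))⟩
          · intro z hz z' hz' hxx
            by_contra hne
            exact Set.disjoint_left.1 (hdis z (Finset.mem_filter.1 hz).1 z'
              (Finset.mem_filter.1 hz').1 hne) (hxX z hz) (hxx ▸ hxX z' hz')
          · rw [← Set.ncard_eq_toFinset_card']
            exact hdeg e heA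
        · simp [heA]
      · rw [← Set.ncard_coe_finset]
        simpa using hSY
    refine ⟨insert z₀ Z', Finset.insert_subset hz₀Z hZ'Z, by
      rw [Finset.card_insert_of_notMem hz₀Z', hZ'c], n + 1, p,
      Function.update X z₀ (insert z₀ S), hpv, ?_, hp, ?_, ?_, ?_⟩
    · rintro (_ | i) hi hne
      · exact (hne rfl).elim
      · rw [hps]
        by_cases hi0 : i = 0
        · rw [hi0, h0]; exact hwC
        · exact hC₁C (hp'C i (by omega) hi0)
    · intro z hz
      rcases Finset.mem_insert.1 hz with rfl | hz
      · rw [hX0]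
        refine ⟨Or.inl rfl, Set.insert_subset_insert fun x hx => (hSC hx).1, hSl, ?_, ?_⟩
        · rintro (_ | j) hj
          · rw [hpv]
            rintro (rfl | hv)
            · exact hz₀A hvA
            · exact hvC (hSC hv).1
          · rw [hps]
            by_cases hj0 : j = 0
            · rw [hj0, h0]
              rintro (rfl | hv)
              · exact hz₀A (hCA hwC)
              · exact hwS hv
            · have := hp'C j (by omega) hj0
              rintro (rfl | hv)
              · exact hz₀A (hCA (hC₁C this))
              · exact (hSC hv).2 this
        · rcases hSt with ht | ht
          · exact ⟨0, by omega, by rwa [hpv]⟩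
          · exact ⟨1, by omega, by rwa [hps, h0]⟩
      · rw [hXz z hz]
        obtain ⟨h1, h2, h3, h4, i, hi, hit⟩ := hX z hz
        refine ⟨h1, h2.trans (Set.insert_subset_insert hC₁C), h3, ?_, i + 1, by omega,
          by rwa [hps]⟩
        rintro (_ | j) hj
        · rw [hpv]
          intro hv
          rcases h2 hv with e | hv
          · exact hYA z (hZY (hZ'Z hz)) (e ▸ hvA)
          · exact hvC (hC₁C hv)
        · rw [hps]; exact h4 j (by omega)
    · intro z hz z' hz' hne
      rcases Finset.mem_insert.1 hz with rfl | h1 <;> rcases Finset.mem_insert.1 hz' with rfl | h2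
      · exact (hne rfl).elim
      · rw [hX0, hXz _ h2]; exact hdisj0 _ h2
      · rw [hX0, hXz _ h1]; exact (hdisj0 _ h1).symm
      · rw [hXz _ h1, hXz _ h2]; exact hdis z h1 z' h2 hne
    · intro Q hQsub hQt
      have hQ' : ∀ Q' ⊆ Q, Q' ⊆ Z' → ∀ z ∈ Q', ∀ z' ∈ Q', z ≠ z' →
          ¬ G.Anticomplete (X z) (X z') := by
        intro Q' hQ' hQ'Z z hz z' hz' hne
        have := hQt z (hQ' hz) z' (hQ' hz') hne
        rwa [hXz _ (hQ'Z hz), hXz _ (hQ'Z hz')] at this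
      by_cases hzQ : z₀ ∈ Q
      · have hsub : Q.erase z₀ ⊆ Z'.filter fun z => ¬ G.Anticomplete (insert z₀ S) (X z) := by
          intro z hz
          obtain ⟨hne, hz⟩ := Finset.mem_erase.1 hz
          have hzZ' := (Finset.mem_insert.1 (hQsub hz)).resolve_left hne
          have := hQt z₀ hzQ z hz hne.symm
          rw [hX0, hXz z hzZ'] at this
          exact Finset.mem_filter.2 ⟨hzZ', this⟩
        have := Finset.card_le_card hsub
        rw [Finset.card_erase_of_mem hzQ] at this
        omega
      · have hQZ : Q ⊆ Z' := fun z hz =>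
          (Finset.mem_insert.1 (hQsub hz)).resolve_left fun e => hzQ (e ▸ hz)
        exact hQ Q hQZ (hQ' Q subset_rfl hQZ)

/-- A linked set with at least two vertices has a vertex whose deletion leaves it linked. -/
lemma IsLinked.exists_delete [Finite V] {A : Set V} (hA : G.IsLinked A) {a b : V} (ha : a ∈ A)
    (hb : b ∈ A) (hab : a ≠ b) :
    ∃ (v : V) (B : Set V), A = insert v B ∧ v ∉ B ∧ G.IsLinked B ∧ G.Touches v B := by
  -- A maximal nonempty proper linked subset misses only one vertex, because adding a vertex that
  -- touches it keeps it linked.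
  obtain ⟨B, hB⟩ := (Set.toFinite {B : Set V | B.Nonempty ∧ B ⊂ A ∧ G.IsLinked B}).exists_maximal
    ⟨{a}, ⟨a, rfl⟩, ⟨by simpa using ha, fun h => hab (h hb).symm⟩, IsLinked.singleton a⟩
  obtain ⟨⟨⟨x, hx⟩, hBA, hBl⟩, hmax⟩ := hB
  obtain ⟨y, hyA, hyB⟩ := Set.exists_of_ssubset hBA
  have : ∃ v ∈ A, v ∉ B ∧ G.Touches v B := by
    by_contra hcon
    push Not at hcon
    refine hyB ((hA x (hBA.1 hx) y hyA).mem_of_closed hx fun u hu v hv huv => ?_)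
    by_contra hvB
    exact hcon v hv hvB ⟨u, hu, huv.symm⟩
  obtain ⟨v, hvA, hvB, hvt⟩ := this
  refine ⟨v, B, ?_, hvB, hBl, hvt⟩
  by_contra hne
  have hsub : insert v B ⊆ A := Set.insert_subset hvA hBA.1
  exact hvB (hmax ⟨⟨v, Or.inl rfl⟩, hsub.ssubset_of_ne (Ne.symm hne),
    hBl.insert_of_touches hvt⟩ (Set.subset_insert v B) (Or.inl rfl))

/-- A linked set touched by many pairwise nonadjacent vertices contains a comb with many teeth. -/
theorem exists_isComb (t k : ℕ) : ∃ N : ℕ, ∀ {V : Type u} [Finite V] {G : SimpleGraph V}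
    (A : Set V) (Y : Finset V), G.CliqueFree t → G.IsLinked A → (∀ y ∈ Y, y ∉ A) →
    (∀ y ∈ Y, ∀ y' ∈ Y, ¬ G.Adj y y') → (∀ y ∈ Y, G.Touches y A) → N ≤ Y.card →
    ∃ Y' ⊆ Y, Y'.card = k ∧ ∃ p n X, G.IsComb A Y' p n X := by
  classical
  -- Degree `d` forces a clique of size `t` or `k` pairwise nonadjacent neighbors. Among `K` teeth
  -- either `d + k + 2` touch pairwise, one more than `exists_weak_comb` allows, or `k` are pairwise
  -- anticomplete.
  obtain ⟨d, hd⟩ := exists_ramsey_bound_symm.{u} t k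
  obtain ⟨K, hK⟩ := exists_ramsey_bound_symm.{u} (d + k + 2) k
  refine ⟨weakCombBound d k K + k + 1, ?_⟩
  intro V _ G A Y hcf hA hYA hYs hYt hY
  have := Fintype.ofFinite V
  obtain ⟨A', ⟨hA'A, hA', hA't⟩, hmin⟩ :=
    (Set.toFinite {A' : Set V | A' ⊆ A ∧ G.IsLinked A' ∧ ∀ y ∈ Y, G.Touches y A'}).exists_minimal
      ⟨A, subset_rfl, hA, hYt⟩
  suffices ∃ Y' ⊆ Y, Y'.card = k ∧ ∃ p n X, G.IsComb A' Y' p n X by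
    obtain ⟨Y', h1, h2, p, n, X, h3⟩ := this
    exact ⟨Y', h1, h2, p, n, X, h3.mono_set hA'A⟩
  have hYA' : ∀ y ∈ Y, y ∉ A' := fun y hy h => hYA y hy (hA'A h)
  have hmin' : ∀ B ⊂ A', G.IsLinked B → ∃ y ∈ Y, ¬ G.Touches y B := by
    intro B hB hBl
    by_contra hcon
    push Not at hcon
    exact hB.2 (hmin ⟨hB.1.trans hA'A, hBl, hcon⟩ hB.1)
  -- An induced path touched by `k` vertices of `Y` is already a comb, with one-vertex teeth.
  -- Otherwise a vertex of degree `d` gives a star, and bounded degree leads to `exists_weak_comb`.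
  by_cases hpath : ∃ p n, G.IsInducedPath p n ∧ (∀ i ≤ n, p i ∈ A') ∧
      k ≤ {y | y ∈ Y ∧ ∃ i ≤ n, G.Adj y (p i)}.ncard
  · obtain ⟨p, n, hp, hpA, hk⟩ := hpath
    have : {y | y ∈ Y ∧ ∃ i ≤ n, G.Adj y (p i)} = Y.filter fun y => ∃ i ≤ n, G.Adj y (p i) := by
      ext; simp
    rw [this, Set.ncard_coe_finset] at hk
    obtain ⟨Y', hY', hc⟩ := Finset.exists_subset_card_eq hk
    have hY'm : ∀ y ∈ Y', y ∈ Y ∧ ∃ i ≤ n, G.Adj y (p i) := fun y hy => by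
      simpa using hY' hy
    refine ⟨Y', fun y hy => (hY'm y hy).1, hc, p, n, fun y => {y}, hp, hpA, fun _ _ => rfl,
      fun y _ => by simp, fun y _ => IsLinked.singleton y, ?_, ?_, ?_⟩
    · intro y hy i hi e
      exact hYA' y (hY'm y hy).1 ((Set.mem_singleton_iff.1 e) ▸ hpA i hi)
    · intro y hy
      obtain ⟨i, hi, h⟩ := (hY'm y hy).2
      exact ⟨i, hi, y, rfl, h.symm⟩
    · intro y hy y' hy' hne
      refine ⟨by simpa using hne, ?_⟩
      rintro _ rfl _ rfl
      exact hYs _ (hY'm _ hy).1 _ (hY'm _ hy').1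
  push Not at hpath
  by_cases hdeg : ∃ c ∈ A', d ≤ (G.neighborSet c ∩ A').ncard
  · obtain ⟨c, hc, hcd⟩ := hdeg
    rw [Set.ncard_eq_toFinset_card'] at hcd
    rcases hd G.Adj (fun _ _ h => h.symm) _ hcd with ⟨s, hs, hsc, h⟩ | ⟨s, hs, hsc, h⟩
    · exact (hcf s ⟨fun x hx y hy hne => h x hx y hy hne, hsc⟩).elim
    · have hs' : ∀ l ∈ s, G.Adj c l ∧ l ∈ A' := fun l hl => by simpa using hs hl
      obtain ⟨Y', h1, h2, X, h3⟩ := exists_isComb_of_star hA' hYA' hYs hA't hmin' hc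
        (fun l hl => (hs' l hl).2) (fun l hl => (hs' l hl).1) (fun l hl l' hl' hadj =>
          h l hl l' hl' hadj.ne hadj)
      exact ⟨Y', h1, h2.trans hsc, _, _, X, h3⟩
  push Not at hdeg
  have hYne : Y.Nonempty := Finset.card_pos.1 (by omega)
  obtain ⟨y₀, hy₀⟩ := hYne
  obtain ⟨a, haA, -⟩ := hA't y₀ hy₀
  have hfew : ∀ a ∈ A', (Y.filter fun y => G.Adj y a).card < k := by
    intro a ha
    have := hpath (fun _ => a) 0 (IsInducedPath.singleton a) fun _ _ => ha
    rw [← Set.ncard_coe_finset]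
    refine lt_of_le_of_lt (Set.ncard_le_ncard ?_ (Set.toFinite _)) this
    intro y hy
    simp only [Finset.coe_filter, Set.mem_ofPred_eq] at hy
    exact ⟨hy.1, 0, le_rfl, hy.2⟩
  -- If `A'` were a single vertex, all of `Y` would be adjacent to it, but fewer than `k` vertices
  -- are.
  obtain ⟨b, hbA, hab⟩ : ∃ b ∈ A', a ≠ b := by
    by_contra hcon
    push Not at hcon
    have : Y.filter (fun y => G.Adj y a) = Y := by
      refine Finset.filter_true_of_mem fun y hy => ?_
      obtain ⟨b, hb, hyb⟩ := hA't y hy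
      rwa [hcon b hb]
    have h := hfew a haA
    rw [this] at h
    omega
  obtain ⟨v, C, hAC, hvC, hC, hvt⟩ := hA'.exists_delete haA hbA hab
  have hvA : v ∈ A' := hAC ▸ Or.inl rfl
  have hCA : C ⊆ A' := hAC ▸ Set.subset_insert v C
  have hZ := Finset.card_filter_add_card_filter_not (s := Y) (fun y => G.Adj y v)
  have hv := hfew v hvA
  obtain ⟨Z', hZ'Z, hZ'c, n, p, X, h0, hpC, hp, hX, -, hQ⟩ := exists_weak_comb hYA' hYs d k
    (fun c hc => (hdeg c hc).le) (fun p n hp hpA => (hpath p n hp hpA).le) C.ncard K C v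
    (Y.filter fun y => ¬ G.Adj y v) le_rfl hCA hvA hvC hvt hC (Finset.filter_subset _ _)
    (by
      intro z hz
      obtain ⟨hz, hzv⟩ := Finset.mem_filter.1 hz
      obtain ⟨x, hx, hzx⟩ := hA't z hz
      rw [hAC] at hx
      rcases hx with rfl | hx
      · exact (hzv hzx).elim
      · exact ⟨x, hx, hzx⟩) (by omega)
  rcases hK (fun z z' => ¬ G.Anticomplete (X z) (X z')) (fun z z' h h' => h h'.symm) Z' hZ'c.ge
    with ⟨s, hs, hsc, h⟩ | ⟨s, hs, hsc, h⟩
  · have := hQ s hs h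
    omega
  · refine ⟨s, hs.trans (hZ'Z.trans (Finset.filter_subset _ _)), hsc, p, n, X, hp, ?_,
      fun z hz => (hX z (hs hz)).1,
      fun z hz => (hX z (hs hz)).2.1.trans (Set.insert_subset_insert hCA),
      fun z hz => (hX z (hs hz)).2.2.1, fun z hz => (hX z (hs hz)).2.2.2.1,
      fun z hz => (hX z (hs hz)).2.2.2.2, fun z hz z' hz' hne => not_not.1 (h z hz z' hz' hne)⟩
    intro i hi
    by_cases hi0 : i = 0
    · rw [hi0, h0]; exact hvA
    · exact hCA (hpC i hi hi0)

end SimpleGraph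

namespace SimpleGraph

universe u
variable {V : Type u} {G : SimpleGraph V}

/-! ### Ladders -/

/-- Segments are half-open so that they may be empty, as happens between legs sharing an attachment.
-/
lemma IsLinked.segment_lt {p : ℕ → V} {n : ℕ} (hp : G.IsInducedPath p n) (a b : ℕ)
    (hb : b ≤ n + 1) : G.IsLinked {v | ∃ i, a ≤ i ∧ i < b ∧ p i = v} := by
  rcases Nat.eq_zero_or_pos b with rfl | hpos
  · simpa using IsLinked.empty
  · have := IsLinked.segment hp a (b - 1) (by omega)
    convert this using 5 with v i
    have : i < b ↔ i ≤ b - 1 := by omega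
    rw [this]

/-- An induced path `p` and vertices `w i`, `i ∈ J`, outside it, such that `p (f i)` and `p (l i)`
are the first and the last neighbor of `w i` on the path. -/
structure IsRail (G : SimpleGraph V) (J : Finset ℕ) (w : ℕ → V) (p : ℕ → V) (n : ℕ)
    (f l : ℕ → ℕ) : Prop where
  path : G.IsInducedPath p n
  le : ∀ i ∈ J, f i ≤ l i
  le_length : ∀ i ∈ J, l i ≤ n
  adj_first : ∀ i ∈ J, G.Adj (w i) (p (f i))
  adj_last : ∀ i ∈ J, G.Adj (w i) (p (l i))
  mem : ∀ i ∈ J, ∀ a ≤ n, G.Adj (w i) (p a) → f i ≤ a ∧ a ≤ l i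

/-- Two anticomplete induced paths `p` and `q` (the rails) and pairwise anticomplete induced paths
joining them (the legs), indexed by `J`. -/
structure Ladder (G : SimpleGraph V) (J : Finset ℕ) where
  leg : ℕ → ℕ → V
  len : ℕ → ℕ
  p : ℕ → V
  n : ℕ
  f : ℕ → ℕ
  l : ℕ → ℕ
  q : ℕ → V
  m : ℕ
  f' : ℕ → ℕ
  l' : ℕ → ℕ
  rail_p : G.IsRail J (fun i => leg i 0) p n f l
  rail_q : G.IsRail J (fun i => leg i (len i)) q m f' l'
  path_leg : ∀ i ∈ J, G.IsInducedPath (leg i) (len i)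
  leg_leg : ∀ i ∈ J, ∀ j ∈ J, i ≠ j → ∀ s ≤ len i, ∀ s' ≤ len j,
    leg i s ≠ leg j s' ∧ ¬ G.Adj (leg i s) (leg j s')
  p_q : ∀ a ≤ n, ∀ b ≤ m, p a ≠ q b ∧ ¬ G.Adj (p a) (q b)
  leg_p : ∀ i ∈ J, ∀ s ≤ len i, ∀ a ≤ n, leg i s ≠ p a ∧ (G.Adj (leg i s) (p a) → s = 0)
  leg_q : ∀ i ∈ J, ∀ s ≤ len i, ∀ b ≤ m, leg i s ≠ q b ∧ (G.Adj (leg i s) (q b) → s = len i)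

/-- The legs are attached to the rail in the order of their indices. -/
def RailOrdered (J : Finset ℕ) (f l : ℕ → ℕ) : Prop :=
  ∀ i ∈ J, ∀ j ∈ J, i < j → l i ≤ f j ∧ (l i = f j → f i = l i ∧ f j = l j)

lemma IsRail.congr {J : Finset ℕ} {w w' : ℕ → V} {p : ℕ → V} {n : ℕ} {f l : ℕ → ℕ}
    (h : G.IsRail J w p n f l) (hw : ∀ i ∈ J, w' i = w i) : G.IsRail J w' p n f l where
  path := h.path
  le := h.le
  le_length := h.le_length
  adj_first i hi := by rw [hw i hi]; exact h.adj_first i hi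
  adj_last i hi := by rw [hw i hi]; exact h.adj_last i hi
  mem i hi := by rw [hw i hi]; exact h.mem i hi

lemma IsRail.mono {J J' : Finset ℕ} {w : ℕ → V} {p : ℕ → V} {n : ℕ} {f l : ℕ → ℕ}
    (h : G.IsRail J w p n f l) (hJ : J' ⊆ J) : G.IsRail J' w p n f l where
  path := h.path
  le i hi := h.le i (hJ hi)
  le_length i hi := h.le_length i (hJ hi)
  adj_first i hi := h.adj_first i (hJ hi)
  adj_last i hi := h.adj_last i (hJ hi)
  mem i hi := h.mem i (hJ hi)

lemma IsRail.reverse {J : Finset ℕ} {w : ℕ → V} {p : ℕ → V} {n : ℕ} {f l : ℕ → ℕ}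
    (h : G.IsRail J w p n f l) :
    G.IsRail J w (fun a => p (n - a)) n (fun i => n - l i) (fun i => n - f i) where
  path := h.path.reverse
  le i hi := by have := h.le i hi; omega
  le_length i hi := by omega
  adj_first i hi := by
    have h1 := h.le i hi
    have h2 := h.le_length i hi
    rw [show n - (n - l i) = l i by omega]
    exact h.adj_last i hi
  adj_last i hi := by
    have h1 := h.le i hi
    have h2 := h.le_length i hi
    rw [show n - (n - f i) = f i by omega]
    exact h.adj_first i hi
  mem i hi a ha hadj := by
    have := h.mem i hi (n - a) (by omega) hadj
    omega

namespace Ladder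

variable {J : Finset ℕ} (L : G.Ladder J)

/-- Exchange the two rails. -/
def swap : G.Ladder J where
  leg i s := L.leg i (L.len i - s)
  len := L.len
  p := L.q
  n := L.m
  f := L.f'
  l := L.l'
  q := L.p
  m := L.n
  f' := L.f
  l' := L.l
  rail_p := L.rail_q.congr fun _ _ => rfl
  rail_q := L.rail_p.congr fun i _ => by simp
  path_leg i hi := (L.path_leg i hi).reverse
  leg_leg i hi j hj hij s hs s' hs' := L.leg_leg i hi j hj hij _ (by omega) _ (by omega)
  p_q a ha b hb := ⟨(L.p_q b hb a ha).1.symm, fun h => (L.p_q b hb a ha).2 h.symm⟩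
  leg_p i hi s hs a ha := ⟨(L.leg_q i hi _ (by omega) a ha).1, fun h => by
    have := (L.leg_q i hi _ (by omega) a ha).2 h
    omega⟩
  leg_q i hi s hs a ha := ⟨(L.leg_p i hi _ (by omega) a ha).1, fun h => by
    have := (L.leg_p i hi _ (by omega) a ha).2 h
    omega⟩

/-- Forget some of the legs. -/
def restrict {J' : Finset ℕ} (hJ : J' ⊆ J) : G.Ladder J' where
  leg := L.leg
  len := L.len
  p := L.p
  n := L.n
  f := L.f
  l := L.l
  q := L.q
  m := L.m
  f' := L.f'
  l' := L.l'
  rail_p := L.rail_p.mono hJ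
  rail_q := L.rail_q.mono hJ
  path_leg i hi := L.path_leg i (hJ hi)
  leg_leg i hi j hj := L.leg_leg i (hJ hi) j (hJ hj)
  p_q := L.p_q
  leg_p i hi := L.leg_p i (hJ hi)
  leg_q i hi := L.leg_q i (hJ hi)

/-- Traverse the first rail in the opposite direction. -/
def reverse : G.Ladder J where
  leg := L.leg
  len := L.len
  p a := L.p (L.n - a)
  n := L.n
  f i := L.n - L.l i
  l i := L.n - L.f i
  q := L.q
  m := L.m
  f' := L.f'
  l' := L.l'
  rail_p := L.rail_p.reverse
  rail_q := L.rail_q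
  path_leg := L.path_leg
  leg_leg := L.leg_leg
  p_q a ha := L.p_q _ (by omega)
  leg_p i hi s hs a ha := L.leg_p i hi s hs _ (by omega)
  leg_q := L.leg_q

/-- Both rails are ordered. -/
def Ordered : Prop := RailOrdered J L.f L.l ∧ RailOrdered J L.f' L.l'

/-- A leg together with a segment of each rail. -/
def body (i x₁ x₂ y₁ y₂ : ℕ) : Set V :=
  {v | ∃ a, x₁ ≤ a ∧ a < x₂ ∧ L.p a = v} ∪
    ({v | ∃ s ≤ L.len i, L.leg i s = v} ∪ {v | ∃ b, y₁ ≤ b ∧ b < y₂ ∧ L.q b = v})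

variable {L} {i j g x₁ x₂ y₁ y₂ z₁ z₂ w₁ w₂ : ℕ}

lemma p_mem_body {a : ℕ} (h₁ : x₁ ≤ a) (h₂ : a < x₂) : L.p a ∈ L.body i x₁ x₂ y₁ y₂ :=
  Or.inl ⟨a, h₁, h₂, rfl⟩

lemma leg_mem_body {s : ℕ} (hs : s ≤ L.len i) : L.leg i s ∈ L.body i x₁ x₂ y₁ y₂ :=
  Or.inr (Or.inl ⟨s, hs, rfl⟩)

lemma q_mem_body {b : ℕ} (h₁ : y₁ ≤ b) (h₂ : b < y₂) : L.q b ∈ L.body i x₁ x₂ y₁ y₂ :=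
  Or.inr (Or.inr ⟨b, h₁, h₂, rfl⟩)

/-- An attachment to a rail segment is demanded only if that segment is nonempty. -/
lemma isLinked_body (hi : i ∈ J) (hx₂ : x₂ ≤ L.n + 1) (hy₂ : y₂ ≤ L.m + 1)
    (hx : x₁ < x₂ → ∃ a, x₁ ≤ a ∧ a < x₂ ∧ G.Adj (L.leg i 0) (L.p a))
    (hy : y₁ < y₂ → ∃ b, y₁ ≤ b ∧ b < y₂ ∧ G.Adj (L.leg i (L.len i)) (L.q b)) :
    G.IsLinked (L.body i x₁ x₂ y₁ y₂) := by
  have hl : G.IsLinked {v | ∃ s ≤ L.len i, L.leg i s = v} := by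
    have := IsLinked.segment (L.path_leg i hi) 0 (L.len i) le_rfl
    convert this using 4
    simp
  have h2 : G.IsLinked ({v | ∃ s ≤ L.len i, L.leg i s = v} ∪
      {v | ∃ b, y₁ ≤ b ∧ b < y₂ ∧ L.q b = v}) := by
    by_cases h : y₁ < y₂
    · obtain ⟨b, h1, h2, hb⟩ := hy h
      exact hl.union_of_adj (IsLinked.segment_lt L.rail_q.path _ _ hy₂) ⟨_, le_rfl, rfl⟩
        ⟨b, h1, h2, rfl⟩ hb
    · have : {v | ∃ b, y₁ ≤ b ∧ b < y₂ ∧ L.q b = v} = ∅ := by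
        ext v
        simp only [Set.mem_ofPred_eq, Set.mem_empty_iff_false, iff_false]
        rintro ⟨b, h1, h2, -⟩
        omega
      rwa [this, Set.union_empty]
  by_cases h : x₁ < x₂
  · obtain ⟨b, h1, h3, hb⟩ := hx h
    exact (IsLinked.segment_lt L.rail_p.path _ _ hx₂).union_of_adj h2 ⟨b, h1, h3, rfl⟩
      (Or.inl ⟨0, by omega, rfl⟩) hb.symm
  · have : {v | ∃ b, x₁ ≤ b ∧ b < x₂ ∧ L.p b = v} = ∅ := by
      ext v
      simp only [Set.mem_ofPred_eq, Set.mem_empty_iff_false, iff_false]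
      rintro ⟨b, h1, h2, -⟩
      omega
    rw [body, this, Set.empty_union]
    exact h2

/-- Vertices common to the bodies of two legs. -/
lemma body_eq_cases (hi : i ∈ J) (hj : j ∈ J) (hij : i ≠ j) (hx₂ : x₂ ≤ L.n + 1)
    (hy₂ : y₂ ≤ L.m + 1) (hz₂ : z₂ ≤ L.n + 1) (hw₂ : w₂ ≤ L.m + 1) {v : V}
    (hu : v ∈ L.body i x₁ x₂ y₁ y₂) (hv : v ∈ L.body j z₁ z₂ w₁ w₂) :
    (∃ a, (x₁ ≤ a ∧ a < x₂) ∧ z₁ ≤ a ∧ a < z₂) ∨ ∃ b, (y₁ ≤ b ∧ b < y₂) ∧ w₁ ≤ b ∧ b < w₂ := by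
  rcases hu with ⟨a, h1, h2, rfl⟩ | ⟨s, hs, rfl⟩ | ⟨b, h1, h2, rfl⟩
  · rcases hv with ⟨a', h3, h4, e⟩ | ⟨s', hs', e⟩ | ⟨b', h3, h4, e⟩
    · obtain rfl := L.rail_p.path.1 _ (by omega) _ (by omega) e
      exact Or.inl ⟨a', ⟨h1, h2⟩, h3, h4⟩
    · exact ((L.leg_p j hj s' hs' a (by omega)).1 e).elim
    · exact ((L.p_q a (by omega) b' (by omega)).1 e.symm).elim
  · rcases hv with ⟨a', h3, h4, e⟩ | ⟨s', hs', e⟩ | ⟨b', h3, h4, e⟩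
    · exact ((L.leg_p i hi s hs a' (by omega)).1 e.symm).elim
    · exact ((L.leg_leg i hi j hj hij s hs s' hs').1 e.symm).elim
    · exact ((L.leg_q i hi s hs b' (by omega)).1 e.symm).elim
  · rcases hv with ⟨a', h3, h4, e⟩ | ⟨s', hs', e⟩ | ⟨b', h3, h4, e⟩
    · exact ((L.p_q a' (by omega) b (by omega)).1 e).elim
    · exact ((L.leg_q j hj s' hs' b (by omega)).1 e).elim
    · obtain rfl := L.rail_q.path.1 _ (by omega) _ (by omega) e
      exact Or.inr ⟨b', ⟨h1, h2⟩, h3, h4⟩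

/-- Edges between the bodies of two legs. -/
lemma body_adj_cases (hi : i ∈ J) (hj : j ∈ J) (hij : i ≠ j) (hx₂ : x₂ ≤ L.n + 1)
    (hy₂ : y₂ ≤ L.m + 1) (hz₂ : z₂ ≤ L.n + 1) (hw₂ : w₂ ≤ L.m + 1) {u v : V}
    (hu : u ∈ L.body i x₁ x₂ y₁ y₂) (hv : v ∈ L.body j z₁ z₂ w₁ w₂) (huv : G.Adj u v) :
    (∃ a a', x₁ ≤ a ∧ a < x₂ ∧ z₁ ≤ a' ∧ a' < z₂ ∧ (a + 1 = a' ∨ a' + 1 = a) ∧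
        u = L.p a ∧ v = L.p a') ∨
    (∃ b b', y₁ ≤ b ∧ b < y₂ ∧ w₁ ≤ b' ∧ b' < w₂ ∧ (b + 1 = b' ∨ b' + 1 = b) ∧
        u = L.q b ∧ v = L.q b') ∨
    (∃ a, z₁ ≤ a ∧ a < z₂ ∧ L.f i ≤ a ∧ a ≤ L.l i ∧ u = L.leg i 0 ∧ v = L.p a) ∨
    (∃ b, w₁ ≤ b ∧ b < w₂ ∧ L.f' i ≤ b ∧ b ≤ L.l' i ∧ u = L.leg i (L.len i) ∧ v = L.q b) ∨
    (∃ a, x₁ ≤ a ∧ a < x₂ ∧ L.f j ≤ a ∧ a ≤ L.l j ∧ u = L.p a ∧ v = L.leg j 0) ∨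
    (∃ b, y₁ ≤ b ∧ b < y₂ ∧ L.f' j ≤ b ∧ b ≤ L.l' j ∧ u = L.q b ∧ v = L.leg j (L.len j)) := by
  rcases hu with ⟨a, h1, h2, rfl⟩ | ⟨s, hs, rfl⟩ | ⟨b, h1, h2, rfl⟩
  · rcases hv with ⟨a', h3, h4, rfl⟩ | ⟨s', hs', rfl⟩ | ⟨b', h3, h4, rfl⟩
    · rw [L.rail_p.path.2 _ (by omega) _ (by omega)] at huv
      exact Or.inl ⟨a, a', h1, h2, h3, h4, huv, rfl, rfl⟩
    · obtain rfl := (L.leg_p j hj s' hs' a (by omega)).2 huv.symm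
      have := L.rail_p.mem j hj a (by omega) huv.symm
      exact Or.inr (Or.inr (Or.inr (Or.inr (Or.inl ⟨a, h1, h2, this.1, this.2, rfl, rfl⟩))))
    · exact ((L.p_q a (by omega) b' (by omega)).2 huv).elim
  · rcases hv with ⟨a', h3, h4, rfl⟩ | ⟨s', hs', rfl⟩ | ⟨b', h3, h4, rfl⟩
    · obtain rfl := (L.leg_p i hi s hs a' (by omega)).2 huv
      have := L.rail_p.mem i hi a' (by omega) huv
      exact Or.inr (Or.inr (Or.inl ⟨a', h3, h4, this.1, this.2, rfl, rfl⟩))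
    · exact ((L.leg_leg i hi j hj hij s hs s' hs').2 huv).elim
    · obtain rfl := (L.leg_q i hi s hs b' (by omega)).2 huv
      have := L.rail_q.mem i hi b' (by omega) huv
      exact Or.inr (Or.inr (Or.inr (Or.inl ⟨b', h3, h4, this.1, this.2, rfl, rfl⟩)))
  · rcases hv with ⟨a', h3, h4, rfl⟩ | ⟨s', hs', rfl⟩ | ⟨b', h3, h4, rfl⟩
    · exact ((L.p_q a' (by omega) b (by omega)).2 huv.symm).elim
    · obtain rfl := (L.leg_q j hj s' hs' b (by omega)).2 huv.symm
      have := L.rail_q.mem j hj b (by omega) huv.symm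
      exact Or.inr (Or.inr (Or.inr (Or.inr (Or.inr ⟨b, h1, h2, this.1, this.2, rfl, rfl⟩))))
    · rw [L.rail_q.path.2 _ (by omega) _ (by omega)] at huv
      exact Or.inr (Or.inl ⟨b, b', h1, h2, h3, h4, huv, rfl, rfl⟩)

/-- Reduces anticompleteness to inequalities between indices, with the segments of `i` to the left
of those of `j`. -/
lemma body_anticomplete (hi : i ∈ J) (hj : j ∈ J) (hij : i ≠ j) (hx₂ : x₂ ≤ L.n + 1)
    (hy₂ : y₂ ≤ L.m + 1) (hz₂ : z₂ ≤ L.n + 1) (hw₂ : w₂ ≤ L.m + 1)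
    (hp : ∀ a a', x₁ ≤ a → a < x₂ → z₁ ≤ a' → a' < z₂ → a + 2 ≤ a')
    (hq : ∀ a a', y₁ ≤ a → a < y₂ → w₁ ≤ a' → a' < w₂ → a + 2 ≤ a')
    (hip : ∀ a, z₁ ≤ a → a < z₂ → a ≤ L.l i → a < L.f i)
    (hiq : ∀ a, w₁ ≤ a → a < w₂ → a ≤ L.l' i → a < L.f' i)
    (hjp : ∀ a, x₁ ≤ a → a < x₂ → L.f j ≤ a → L.l j < a)
    (hjq : ∀ a, y₁ ≤ a → a < y₂ → L.f' j ≤ a → L.l' j < a) :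
    G.Anticomplete (L.body i x₁ x₂ y₁ y₂) (L.body j z₁ z₂ w₁ w₂) := by
  constructor
  · rw [Set.disjoint_left]
    intro v hu hv
    rcases body_eq_cases hi hj hij hx₂ hy₂ hz₂ hw₂ hu hv with ⟨a, h, h'⟩ | ⟨a, h, h'⟩
    · have := hp a a h.1 h.2 h'.1 h'.2
      omega
    · have := hq a a h.1 h.2 h'.1 h'.2
      omega
  · intro u hu v hv huv
    rcases body_adj_cases hi hj hij hx₂ hy₂ hz₂ hw₂ hu hv huv with
      ⟨a, a', h1, h2, h3, h4, h5, -⟩ | ⟨a, a', h1, h2, h3, h4, h5, -⟩ | ⟨a, h1, h2, h3, h4, -⟩ |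
      ⟨a, h1, h2, h3, h4, -⟩ | ⟨a, h1, h2, h3, h4, -⟩ | ⟨a, h1, h2, h3, h4, -⟩
    · have := hp a a' h1 h2 h3 h4; omega
    · have := hq a a' h1 h2 h3 h4; omega
    · have := hip a h1 h2 h4; omega
    · have := hiq a h1 h2 h4; omega
    · have := hjp a h1 h2 h3; omega
    · have := hjq a h1 h2 h3; omega

/-- A leg between two others cannot have single attachments on both rails in a theta-free graph. -/
lemma not_single_single (hord : L.Ordered) (hG : IsEmpty G.Theta) (hi : i ∈ J) (hg : g ∈ J)
    (hj : j ∈ J) (hig : i < g) (hgj : g < j) (hp : L.f g = L.l g) (hq : L.f' g = L.l' g) :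
    False := by
  have o1 := hord.1 i hi g hg hig
  have o2 := hord.1 g hg j hj hgj
  have o3 := hord.2 i hi g hg hig
  have o4 := hord.2 g hg j hj hgj
  have o5 := hord.1 i hi j hj (hig.trans hgj)
  have o6 := hord.2 i hi j hj (hig.trans hgj)
  have b1 := L.rail_p.le_length i hi
  have b2 := L.rail_p.le_length g hg
  have b3 := L.rail_p.le_length j hj
  have b4 := L.rail_q.le_length i hi
  have b5 := L.rail_q.le_length g hg
  have b6 := L.rail_q.le_length j hj
  have c1 := L.rail_p.le i hi
  have c2 := L.rail_p.le j hj
  have c3 := L.rail_q.le i hi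
  have c4 := L.rail_q.le j hj
  have hpq := L.p_q (L.f g) (by omega) (L.f' g) (by omega)
  -- The theta joins the attachments of `g` on the two rails. Its three parts are leg `i` with the
  -- rails up to `g`, the bare leg `g`, and leg `j` with the rails after `g`. When a neighboring leg
  -- shares the attachment, the rail segment is empty and the end of that leg touches instead.
  refine (not_isEmpty_iff.2 (nonempty_theta hpq.1 hpq.2
    ![L.body i (L.l i) (L.f g) (L.l' i) (L.f' g), L.body g 0 0 0 0,
      L.body j (L.l g + 1) (L.f j + 1) (L.l' g + 1) (L.f' j + 1)] ?_ ?_ ?_ ?_)) hG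
  · intro k
    fin_cases k
    · exact isLinked_body hi (by omega) (by omega)
        (fun h => ⟨_, le_rfl, h, L.rail_p.adj_last i hi⟩)
        (fun h => ⟨_, le_rfl, h, L.rail_q.adj_last i hi⟩)
    · exact isLinked_body hg (by omega) (by omega) (by omega) (by omega)
    · exact isLinked_body hj (by omega) (by omega)
        (fun h => ⟨L.f j, by omega, by omega, L.rail_p.adj_first j hj⟩)
        (fun h => ⟨L.f' j, by omega, by omega, L.rail_q.adj_first j hj⟩)
  · intro k
    fin_cases k
    · by_cases h : L.l i < L.f g
      · refine ⟨L.p (L.f g - 1), p_mem_body (by omega) (by omega), ?_⟩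
        rw [L.rail_p.path.2 _ (by omega) _ (by omega)]
        omega
      · refine ⟨L.leg i 0, leg_mem_body (by omega), ?_⟩
        rw [show L.f g = L.l i by omega]
        exact (L.rail_p.adj_last i hi).symm
    · exact ⟨L.leg g 0, leg_mem_body (by omega), (L.rail_p.adj_first g hg).symm⟩
    · by_cases h : L.l g < L.f j
      · refine ⟨L.p (L.f g + 1), p_mem_body (by omega) (by omega), ?_⟩
        rw [L.rail_p.path.2 _ (by omega) _ (by omega)]
        omega
      · refine ⟨L.leg j 0, leg_mem_body (by omega), ?_⟩
        rw [show L.f g = L.f j by omega]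
        exact (L.rail_p.adj_first j hj).symm
  · intro k
    fin_cases k
    · by_cases h : L.l' i < L.f' g
      · refine ⟨L.q (L.f' g - 1), q_mem_body (by omega) (by omega), ?_⟩
        rw [L.rail_q.path.2 _ (by omega) _ (by omega)]
        omega
      · refine ⟨L.leg i (L.len i), leg_mem_body le_rfl, ?_⟩
        rw [show L.f' g = L.l' i by omega]
        exact (L.rail_q.adj_last i hi).symm
    · exact ⟨L.leg g (L.len g), leg_mem_body le_rfl, (L.rail_q.adj_first g hg).symm⟩
    · by_cases h : L.l' g < L.f' j
      · refine ⟨L.q (L.f' g + 1), q_mem_body (by omega) (by omega), ?_⟩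
        rw [L.rail_q.path.2 _ (by omega) _ (by omega)]
        omega
      · refine ⟨L.leg j (L.len j), leg_mem_body le_rfl, ?_⟩
        rw [show L.f' g = L.f' j by omega]
        exact (L.rail_q.adj_first j hj).symm
  · have h01 : G.Anticomplete (L.body i (L.l i) (L.f g) (L.l' i) (L.f' g)) (L.body g 0 0 0 0) := by
      apply body_anticomplete hi hg <;> intros <;> omega
    have h02 : G.Anticomplete (L.body i (L.l i) (L.f g) (L.l' i) (L.f' g))
        (L.body j (L.l g + 1) (L.f j + 1) (L.l' g + 1) (L.f' j + 1)) := by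
      apply body_anticomplete hi hj <;> intros <;> omega
    have h12 : G.Anticomplete (L.body g 0 0 0 0)
        (L.body j (L.l g + 1) (L.f j + 1) (L.l' g + 1) (L.f' j + 1)) := by
      apply body_anticomplete hg hj <;> intros <;> omega
    intro k k' hk
    fin_cases k <;> fin_cases k' <;> first | exact h01 | exact h02 | exact h12 | simp at hk

/-- A leg of positive length between two others cannot have two adjacent attachments on each rail
in a prism-free graph. -/
lemma not_pair_pair (hord : L.Ordered) (hG : IsEmpty G.Prism) (hi : i ∈ J) (hg : g ∈ J)
    (hj : j ∈ J) (hig : i < g) (hgj : g < j) (hp : L.l g = L.f g + 1) (hq : L.l' g = L.f' g + 1)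
    (hlen : L.len g ≠ 0) : False := by
  have o1 := hord.1 i hi g hg hig
  have o2 := hord.1 g hg j hj hgj
  have o3 := hord.2 i hi g hg hig
  have o4 := hord.2 g hg j hj hgj
  have b1 := L.rail_p.le_length i hi
  have b2 := L.rail_p.le_length g hg
  have b3 := L.rail_p.le_length j hj
  have b4 := L.rail_q.le_length i hi
  have b5 := L.rail_q.le_length g hg
  have b6 := L.rail_q.le_length j hj
  have c1 := L.rail_p.le i hi
  have c2 := L.rail_p.le j hj
  have c3 := L.rail_q.le i hi
  have c4 := L.rail_q.le j hj
  have a1 : G.Adj (L.p (L.f g)) (L.p (L.l g)) := by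
    rw [L.rail_p.path.2 _ (by omega) _ (by omega)]; omega
  have a2 : G.Adj (L.q (L.f' g)) (L.q (L.l' g)) := by
    rw [L.rail_q.path.2 _ (by omega) _ (by omega)]; omega
  have a3 := L.rail_p.adj_first g hg
  have a4 := L.rail_p.adj_last g hg
  have a5 := L.rail_q.adj_first g hg
  have a6 := L.rail_q.adj_last g hg
  -- The two attachments of `g` on each rail split the rails between `X₀` and `X₂`; with the ends of
  -- leg `g` they form the triangles of a prism. Since `g` has two attachments, ordering forbids `i`
  -- and `j` from sharing them.
  set X₀ := L.body i (L.l i) (L.f g + 1) (L.l' i) (L.f' g + 1) with hX₀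
  set X₁ := L.body g 0 0 0 0 with hX₁
  set X₂ := L.body j (L.l g) (L.f j + 1) (L.l' g) (L.f' j + 1) with hX₂
  have d01 : Disjoint X₀ X₁ := by
    rw [Set.disjoint_left]
    intro v hu hv
    rcases body_eq_cases hi hg (by omega) (by omega) (by omega) (by omega) (by omega) hu hv with
      ⟨a, h⟩ | ⟨a, h⟩ <;> omega
  have d02 : Disjoint X₀ X₂ := by
    rw [Set.disjoint_left]
    intro v hu hv
    rcases body_eq_cases hi hj (by omega) (by omega) (by omega) (by omega) (by omega) hu hv with
      ⟨a, h⟩ | ⟨a, h⟩ <;> omega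
  have d12 : Disjoint X₁ X₂ := by
    rw [Set.disjoint_left]
    intro v hu hv
    rcases body_eq_cases hg hj (by omega) (by omega) (by omega) (by omega) (by omega) hu hv with
      ⟨a, h⟩ | ⟨a, h⟩ <;> omega
  have e01 : ∀ u ∈ X₀, ∀ v ∈ X₁, G.Adj u v → (u = L.p (L.f g) ∧ v = L.leg g 0) ∨
      (u = L.q (L.f' g) ∧ v = L.leg g (L.len g)) := by
    intro u hu v hv huv
    rcases body_adj_cases hi hg (by omega) (by omega) (by omega) (by omega) (by omega) hu hv huv
      with ⟨a, a', h1, h2, h3, h4, h5, -⟩ | ⟨a, a', h1, h2, h3, h4, h5, -⟩ |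
      ⟨a, h1, h2, h3, h4, -⟩ | ⟨a, h1, h2, h3, h4, -⟩ | ⟨a, h1, h2, h3, h4, rfl, rfl⟩ |
      ⟨a, h1, h2, h3, h4, rfl, rfl⟩
    · omega
    · omega
    · omega
    · omega
    · obtain rfl : a = L.f g := by omega
      exact Or.inl ⟨rfl, rfl⟩
    · obtain rfl : a = L.f' g := by omega
      exact Or.inr ⟨rfl, rfl⟩
  have e12 : ∀ u ∈ X₁, ∀ v ∈ X₂, G.Adj u v → (u = L.leg g 0 ∧ v = L.p (L.l g)) ∨
      (u = L.leg g (L.len g) ∧ v = L.q (L.l' g)) := by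
    intro u hu v hv huv
    rcases body_adj_cases hg hj (by omega) (by omega) (by omega) (by omega) (by omega) hu hv huv
      with ⟨a, a', h1, h2, h3, h4, h5, -⟩ | ⟨a, a', h1, h2, h3, h4, h5, -⟩ |
      ⟨a, h1, h2, h3, h4, rfl, rfl⟩ | ⟨a, h1, h2, h3, h4, rfl, rfl⟩ | ⟨a, h1, h2, h3, h4, -⟩ |
      ⟨a, h1, h2, h3, h4, -⟩
    · omega
    · omega
    · obtain rfl : a = L.l g := by omega
      exact Or.inl ⟨rfl, rfl⟩
    · obtain rfl : a = L.l' g := by omega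
      exact Or.inr ⟨rfl, rfl⟩
    · omega
    · omega
  have e02 : ∀ u ∈ X₀, ∀ v ∈ X₂, G.Adj u v → (u = L.p (L.f g) ∧ v = L.p (L.l g)) ∨
      (u = L.q (L.f' g) ∧ v = L.q (L.l' g)) := by
    intro u hu v hv huv
    rcases body_adj_cases hi hj (by omega) (by omega) (by omega) (by omega) (by omega) hu hv huv
      with ⟨a, a', h1, h2, h3, h4, h5, rfl, rfl⟩ | ⟨a, a', h1, h2, h3, h4, h5, rfl, rfl⟩ |
      ⟨a, h1, h2, h3, h4, -⟩ | ⟨a, h1, h2, h3, h4, -⟩ | ⟨a, h1, h2, h3, h4, -⟩ |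
      ⟨a, h1, h2, h3, h4, -⟩
    · obtain rfl : a = L.f g := by omega
      obtain rfl : a' = L.l g := by omega
      exact Or.inl ⟨rfl, rfl⟩
    · obtain rfl : a = L.f' g := by omega
      obtain rfl : a' = L.l' g := by omega
      exact Or.inr ⟨rfl, rfl⟩
    all_goals omega
  refine (not_isEmpty_iff.2 (nonempty_prism ![L.p (L.f g), L.leg g 0, L.p (L.l g)]
    ![L.q (L.f' g), L.leg g (L.len g), L.q (L.l' g)] ![X₀, X₁, X₂] ?_ ?_ ?_ ?_ ?_ ?_ ?_ ?_)) hG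
  · intro k
    fin_cases k
    · exact isLinked_body hi (by omega) (by omega)
        (fun h => ⟨_, le_rfl, h, L.rail_p.adj_last i hi⟩)
        (fun h => ⟨_, le_rfl, h, L.rail_q.adj_last i hi⟩)
    · exact isLinked_body hg (by omega) (by omega) (by omega) (by omega)
    · exact isLinked_body hj (by omega) (by omega)
        (fun h => ⟨L.f j, by omega, by omega, L.rail_p.adj_first j hj⟩)
        (fun h => ⟨L.f' j, by omega, by omega, L.rail_q.adj_first j hj⟩)
  · intro k
    fin_cases k
    · exact p_mem_body (by omega) (by omega)
    · exact leg_mem_body (by omega)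
    · exact p_mem_body (by omega) (by omega)
  · intro k
    fin_cases k
    · exact q_mem_body (by omega) (by omega)
    · exact leg_mem_body le_rfl
    · exact q_mem_body (by omega) (by omega)
  · intro k
    fin_cases k
    · exact (L.p_q _ (by omega) _ (by omega)).1
    · intro e
      have := (L.path_leg g hg).1 _ (by omega) _ le_rfl e
      omega
    · exact (L.p_q _ (by omega) _ (by omega)).1
  · intro k k' hk
    fin_cases k <;> fin_cases k' <;> first | exact d01 | exact d02 | exact d12 | simp at hk
  · intro k k' hk
    fin_cases k <;> fin_cases k' <;> first | exact a1 | exact a3.symm | exact a4 | simp at hk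
  · intro k k' hk
    fin_cases k <;> fin_cases k' <;> first | exact a2 | exact a5.symm | exact a6 | simp at hk
  · intro k k' hk
    fin_cases k <;> fin_cases k' <;> first | exact e01 | exact e02 | exact e12 | simp at hk

end Ladder

end SimpleGraph

/-! ### Holes, wheels and generalized pyramids inside a ladder -/

namespace SimpleGraph

universe u
variable {V : Type u} {G : SimpleGraph V}

/-- Variant of `isHole_of_paths` with both paths numbered from the same side, as rails are. -/
lemma isHole_of_parallel_paths {p q : ℕ → V} {n m : ℕ} (hp : G.IsInducedPath p n)
    (hq : G.IsInducedPath q m) (hlen : 2 ≤ n + m)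
    (hne : ∀ i ≤ n, ∀ j ≤ m, p i ≠ q j)
    (hadj : ∀ i ≤ n, ∀ j ≤ m, (G.Adj (p i) (q j) ↔ (i = 0 ∧ j = 0) ∨ (i = n ∧ j = m))) :
    G.IsHole ({v | ∃ i ≤ n, p i = v} ∪ {v | ∃ i ≤ m, q i = v}) := by
  have := isHole_of_paths hp hq.reverse hlen (fun i hi j hj => hne i hi _ (by omega))
    (fun i hi j hj => by
      rw [hadj i hi _ (by omega)]
      omega)
  convert this using 2
  ext v
  constructor
  · rintro ⟨i, hi, rfl⟩
    exact ⟨m - i, by omega, by rw [show m - (m - i) = i by omega]⟩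
  · rintro ⟨i, hi, rfl⟩
    exact ⟨m - i, by omega, rfl⟩

/-- A vertex with three pairwise nonadjacent neighbors in a hole is a hub. -/
lemma mem_hubs_of_three_nonadj [Finite V] {H : Set V} (hH : G.IsHole H) {x a b c : V} (ha : a ∈ H) (hb : b ∈ H) (hc : c ∈ H)
    (hxa : G.Adj x a) (hxb : G.Adj x b) (hxc : G.Adj x c) (hab : a ≠ b) (hac : a ≠ c) (hbc : b ≠ c)
    (nab : ¬ G.Adj a b) (nac : ¬ G.Adj a c) (nbc : ¬ G.Adj b c) : x ∈ G.hubs := by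
  have hsub : {a, b, c} ⊆ G.neighborSet x ∩ H := by
    rintro y (rfl | rfl | rfl)
    · exact ⟨hxa, ha⟩
    · exact ⟨hxb, hb⟩
    · exact ⟨hxc, hc⟩
  have h3 : ({a, b, c} : Set V).ncard = 3 := Set.ncard_eq_three.2 ⟨a, b, c, hab, hac, hbc, rfl⟩
  have hle : 3 ≤ (G.neighborSet x ∩ H).ncard := h3 ▸ Set.ncard_le_ncard hsub (Set.toFinite _)
  -- Twin wheels and short pyramids both have exactly three neighbors of the center, two of them
  -- adjacent; with exactly three neighbors here, these would be `a`, `b`, `c`.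
  have hno : (G.neighborSet x ∩ H).ncard = 3 →
      ∀ u ∈ G.neighborSet x ∩ H, ∀ v ∈ G.neighborSet x ∩ H, ¬ G.Adj u v := by
    intro h
    have heq := Set.eq_of_subset_of_ncard_le hsub (by omega) (Set.toFinite _)
    rw [← heq]
    rintro u (rfl | rfl | rfl) v (rfl | rfl | rfl) <;> simp_all [G.adj_comm]
  refine ⟨H, ⟨hH, hle⟩, ?_, ?_⟩
  · rintro ⟨-, f, hf⟩
    have h : (G.neighborSet x ∩ H).ncard = 3 := by
      rw [← hf, ← Set.image_univ, Set.ncard_image_of_injective _ f.injective, Set.ncard_univ]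
      simp
    refine hno h (f 0) (hf ▸ ⟨0, rfl⟩) (f 1) (hf ▸ ⟨1, rfl⟩) ?_
    rw [f.map_adj_iff, pathGraph_adj]
    simp
  · rintro ⟨-, u, v, w, huv, huw, hvw, heq, hadj, -⟩
    refine hno ?_ u (heq ▸ by simp) v (heq ▸ by simp) hadj
    rw [heq]
    exact Set.ncard_eq_three.2 ⟨u, v, w, huv, huw, hvw, rfl⟩

namespace Ladder

variable {J : Finset ℕ} {L : G.Ladder J} {i j g : ℕ}

/-- The path formed by two legs and the segment of the first rail between them. -/
lemma exists_cross (hord : RailOrdered J L.f L.l) (hi : i ∈ J) (hj : j ∈ J) (hij : i < j) :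
    ∃ α : ℕ → V, G.IsInducedPath α (L.len i + 1 + (L.f j - L.l i) + 1 + L.len j) ∧
      (∀ s ≤ L.len i, α (L.len i - s) = L.leg i s) ∧
      (∀ a, L.l i ≤ a → a ≤ L.f j → α (L.len i + 1 + (a - L.l i)) = L.p a) ∧
      ∀ s ≤ L.len j, α (L.len i + 1 + (L.f j - L.l i) + 1 + s) = L.leg j s := by
  obtain ⟨o1, o2⟩ := hord i hi j hj hij
  have b1 := L.rail_p.le_length i hi
  have b2 := L.rail_p.le_length j hj
  have c1 := L.rail_p.le i hi
  have c2 := L.rail_p.le j hj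
  have h1 := (L.path_leg i hi).reverse.append (L.rail_p.path.segment (L.l i) (L.f j - L.l i)
    (by omega)) (fun s hs a ha => (L.leg_p i hi _ (by omega) _ (by omega)).1) (by
      intro s hs a ha
      constructor
      · intro h
        have e := (L.leg_p i hi _ (by omega) _ (by omega)).2 h
        rw [e] at h
        have := L.rail_p.mem i hi _ (by omega) h
        omega
      · rintro ⟨rfl, rfl⟩
        simpa using L.rail_p.adj_last i hi)
  have h2 := h1.append (L.path_leg j hj) (by
      intro u hu s hs
      by_cases h : u ≤ L.len i <;> simp only [h, if_true, if_false]
      · exact (L.leg_leg i hi j hj hij.ne _ (by omega) s hs).1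
      · exact (L.leg_p j hj s hs _ (by omega)).1.symm) (by
      intro u hu s hs
      by_cases h : u ≤ L.len i <;> simp only [h, if_true, if_false]
      · refine iff_of_false (L.leg_leg i hi j hj hij.ne _ (by omega) s hs).2 ?_
        omega
      · constructor
        · intro h'
          obtain rfl := (L.leg_p j hj s hs _ (by omega)).2 h'.symm
          have := L.rail_p.mem j hj _ (by omega) h'.symm
          omega
        · rintro ⟨rfl, rfl⟩
          rw [show L.l i + (L.len i + 1 + (L.f j - L.l i) - (L.len i + 1)) = L.f j by omega]
          exact (L.rail_p.adj_first j hj).symm)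
  refine ⟨_, h2, ?_, ?_, ?_⟩
  · intro s hs
    have e1 : L.len i - s ≤ L.len i + 1 + (L.f j - L.l i) := by omega
    have e2 : L.len i - s ≤ L.len i := by omega
    simp only [e1, e2, if_true]
    congr 1; omega
  · intro a h h'
    have e1 : L.len i + 1 + (a - L.l i) ≤ L.len i + 1 + (L.f j - L.l i) := by omega
    have e2 : ¬ (L.len i + 1 + (a - L.l i) ≤ L.len i) := by omega
    simp only [e1, e2, if_true, if_false]
    congr 1; omega
  · intro s hs
    have e1 : ¬ (L.len i + 1 + (L.f j - L.l i) + 1 + s ≤ L.len i + 1 + (L.f j - L.l i)) := by omega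
    simp only [e1, if_false]
    congr 1; omega

/-- The vertices of the path in `exists_cross`. -/
lemma cross_cases {α : ℕ → V} (hij : L.l i ≤ L.f j)
    (h1 : ∀ s ≤ L.len i, α (L.len i - s) = L.leg i s)
    (h2 : ∀ a, L.l i ≤ a → a ≤ L.f j → α (L.len i + 1 + (a - L.l i)) = L.p a)
    (h3 : ∀ s ≤ L.len j, α (L.len i + 1 + (L.f j - L.l i) + 1 + s) = L.leg j s) {u : ℕ}
    (hu : u ≤ L.len i + 1 + (L.f j - L.l i) + 1 + L.len j) :
    (∃ s ≤ L.len i, u = L.len i - s ∧ α u = L.leg i s) ∨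
    (∃ a, L.l i ≤ a ∧ a ≤ L.f j ∧ u = L.len i + 1 + (a - L.l i) ∧ α u = L.p a) ∨
    ∃ s ≤ L.len j, u = L.len i + 1 + (L.f j - L.l i) + 1 + s ∧ α u = L.leg j s := by
  rcases Nat.lt_or_ge u (L.len i + 1) with h | h
  · refine Or.inl ⟨L.len i - u, by omega, by omega, ?_⟩
    rw [← h1 _ (by omega)]
    congr 1; omega
  rcases Nat.lt_or_ge u (L.len i + 1 + (L.f j - L.l i) + 1) with h' | h'
  · refine Or.inr (Or.inl ⟨u - (L.len i + 1) + L.l i, by omega, by omega, by omega, ?_⟩)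
    rw [← h2 _ (by omega) (by omega)]
    congr 1; omega
  · refine Or.inr (Or.inr ⟨u - (L.len i + 1 + (L.f j - L.l i) + 1), by omega, by omega, ?_⟩)
    rw [← h3 _ (by omega)]
    congr 1; omega

/-- The crossing path and the segment of `q` between the same two legs meet only through edges at
their ends, so together they form a hole. -/
lemma cross_q {α : ℕ → V} (hord : L.Ordered) (hi : i ∈ J) (hj : j ∈ J) (hij : i < j)
    (h1 : ∀ s ≤ L.len i, α (L.len i - s) = L.leg i s)
    (h2 : ∀ a, L.l i ≤ a → a ≤ L.f j → α (L.len i + 1 + (a - L.l i)) = L.p a)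
    (h3 : ∀ s ≤ L.len j, α (L.len i + 1 + (L.f j - L.l i) + 1 + s) = L.leg j s) {u b : ℕ}
    (hu : u ≤ L.len i + 1 + (L.f j - L.l i) + 1 + L.len j) (hb : b ≤ L.f' j - L.l' i) :
    α u ≠ L.q (L.l' i + b) ∧ (G.Adj (α u) (L.q (L.l' i + b)) ↔ (u = 0 ∧ b = 0) ∨
      (u = L.len i + 1 + (L.f j - L.l i) + 1 + L.len j ∧ b = L.f' j - L.l' i)) := by
  obtain ⟨o1, o2⟩ := hord.1 i hi j hj hij
  obtain ⟨o3, o4⟩ := hord.2 i hi j hj hij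
  have b1 := L.rail_p.le_length j hj
  have b2 := L.rail_q.le_length j hj
  have c1 := L.rail_p.le j hj
  have c2 := L.rail_q.le j hj
  have c3 := L.rail_q.le i hi
  rcases cross_cases o1 h1 h2 h3 hu with ⟨s, hs, hus, e⟩ | ⟨a, ha, ha', hua, e⟩ | ⟨s, hs, hus, e⟩
  · rw [e]
    refine ⟨(L.leg_q i hi s hs _ (by omega)).1, fun h => ?_, fun h => ?_⟩
    · obtain rfl := (L.leg_q i hi s hs _ (by omega)).2 h
      have := L.rail_q.mem i hi _ (by omega) h
      omega
    · obtain ⟨rfl, rfl⟩ : s = L.len i ∧ b = 0 := by omega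
      exact L.rail_q.adj_last i hi
  · rw [e]
    refine ⟨(L.p_q a (by omega) _ (by omega)).1, iff_of_false (L.p_q a (by omega) _ (by omega)).2 ?_⟩
    omega
  · rw [e]
    refine ⟨(L.leg_q j hj s hs _ (by omega)).1, fun h => ?_, fun h => ?_⟩
    · obtain rfl := (L.leg_q j hj s hs _ (by omega)).2 h
      have := L.rail_q.mem j hj _ (by omega) h
      omega
    · obtain ⟨rfl, rfl⟩ : s = L.len j ∧ b = L.f' j - L.l' i := by omega
      rw [show L.l' i + (L.f' j - L.l' i) = L.f' j by omega]
      exact L.rail_q.adj_first j hj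

lemma isHole_cross {α : ℕ → V} (hord : L.Ordered) (hi : i ∈ J) (hj : j ∈ J) (hij : i < j)
    (h0 : G.IsInducedPath α (L.len i + 1 + (L.f j - L.l i) + 1 + L.len j))
    (h1 : ∀ s ≤ L.len i, α (L.len i - s) = L.leg i s)
    (h2 : ∀ a, L.l i ≤ a → a ≤ L.f j → α (L.len i + 1 + (a - L.l i)) = L.p a)
    (h3 : ∀ s ≤ L.len j, α (L.len i + 1 + (L.f j - L.l i) + 1 + s) = L.leg j s) :
    G.IsHole ({v | ∃ u ≤ L.len i + 1 + (L.f j - L.l i) + 1 + L.len j, α u = v} ∪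
      {v | ∃ b ≤ L.f' j - L.l' i, L.q (L.l' i + b) = v}) := by
  have b2 := L.rail_q.le_length j hj
  have c2 := L.rail_q.le j hj
  obtain ⟨o3, o4⟩ := hord.2 i hi j hj hij
  exact isHole_of_parallel_paths h0 (L.rail_q.path.segment (L.l' i) (L.f' j - L.l' i) (by omega))
    (by omega) (fun u hu b hb => (cross_q hord hi hj hij h1 h2 h3 hu hb).1)
    fun u hu b hb => (cross_q hord hi hj hij h1 h2 h3 hu hb).2

variable (L) in
/-- Two legs together with the segments of the rails between them. -/
def hole (i j : ℕ) : Set V :=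
  L.body i (L.l i) (L.f j + 1) (L.l' i) (L.f' j + 1) ∪ L.body j 0 0 0 0

lemma isHole_hole (hord : L.Ordered) (hi : i ∈ J) (hj : j ∈ J) (hij : i < j) :
    G.IsHole (L.hole i j) := by
  obtain ⟨o1, o2⟩ := hord.1 i hi j hj hij
  obtain ⟨o3, o4⟩ := hord.2 i hi j hj hij
  obtain ⟨α, h0, h1, h2, h3⟩ := exists_cross hord.1 hi hj hij
  convert isHole_cross hord hi hj hij h0 h1 h2 h3 using 1
  ext v
  constructor
  · rintro ((⟨a, h, h', rfl⟩ | ⟨s, hs, rfl⟩ | ⟨b, h, h', rfl⟩) |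
      (⟨a, h, h', rfl⟩ | ⟨s, hs, rfl⟩ | ⟨b, h, h', rfl⟩))
    · exact Or.inl ⟨_, by omega, h2 a h (by omega)⟩
    · exact Or.inl ⟨_, by omega, h1 s hs⟩
    · exact Or.inr ⟨b - L.l' i, by omega, by congr 1; omega⟩
    · omega
    · exact Or.inl ⟨_, by omega, h3 s hs⟩
    · omega
  · rintro (⟨u, hu, rfl⟩ | ⟨b, hb, rfl⟩)
    · rcases cross_cases o1 h1 h2 h3 hu with ⟨s, hs, -, e⟩ | ⟨a, ha, ha', -, e⟩ | ⟨s, hs, -, e⟩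
      · exact Or.inl (e ▸ leg_mem_body hs)
      · exact Or.inl (e ▸ p_mem_body ha (by omega))
      · exact Or.inr (e ▸ leg_mem_body hs)
    · exact Or.inl (q_mem_body (by omega) (by omega))

/-- A leg consisting of a single vertex that is not a hub, between two other legs, does not have
two nonadjacent neighbors in the first rail. -/
lemma not_wide_of_len_eq_zero [Finite V]
    (hord : L.Ordered) (hi : i ∈ J) (hg : g ∈ J) (hj : j ∈ J) (hig : i < g) (hgj : g < j)
    (hlen : L.len g = 0) (hhub : L.leg g 0 ∉ G.hubs) : L.l g ≤ L.f g + 1 := by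
  have o1 := hord.1 i hi g hg hig
  have o2 := hord.1 g hg j hj hgj
  have o3 := hord.2 i hi g hg hig
  have o4 := hord.2 g hg j hj hgj
  have b2 := L.rail_p.le_length g hg
  have b5 := L.rail_q.le_length g hg
  have c1 := L.rail_p.le g hg
  have c3 := L.rail_q.le g hg
  by_contra hcon
  have hq := L.rail_q.adj_first g hg
  simp only [hlen] at hq
  -- The single vertex of leg `g` sees the two extreme attachments on `p` and one on `q`, all on the
  -- hole through legs `i` and `j`.
  refine hhub (mem_hubs_of_three_nonadj (isHole_hole hord hi hj (hig.trans hgj))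
    (a := L.p (L.f g)) (b := L.p (L.l g)) (c := L.q (L.f' g))
    (Or.inl (p_mem_body (by omega) (by omega))) (Or.inl (p_mem_body (by omega) (by omega)))
    (Or.inl (q_mem_body (by omega) (by omega))) (L.rail_p.adj_first g hg)
    (L.rail_p.adj_last g hg) hq (fun e => ?_) (L.p_q _ (by omega) _ (by omega)).1
    (L.p_q _ (by omega) _ (by omega)).1 ?_ (L.p_q _ (by omega) _ (by omega)).2
    (L.p_q _ (by omega) _ (by omega)).2)
  · have := L.rail_p.path.1 _ (by omega) _ (by omega) e
    omega
  · rw [L.rail_p.path.2 _ (by omega) _ (by omega)]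
    omega

/-- A leg consisting of a single vertex, between two other legs, does not have exactly two
neighbors in each rail. -/
lemma not_pair_pair_of_len_eq_zero (hG : ∀ (H : Set V) (x : V), ¬ G.IsEvenWheel H x)
    (hord : L.Ordered) (hi : i ∈ J) (hg : g ∈ J) (hj : j ∈ J) (hig : i < g) (hgj : g < j)
    (hlen : L.len g = 0) (hp : L.l g = L.f g + 1) (hq : L.l' g = L.f' g + 1) : False := by
  have o1 := hord.1 i hi g hg hig
  have o2 := hord.1 g hg j hj hgj
  have o3 := hord.2 i hi g hg hig
  have o4 := hord.2 g hg j hj hgj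
  have b2 := L.rail_p.le_length g hg
  have b5 := L.rail_q.le_length g hg
  have b3 := L.rail_p.le_length j hj
  have b6 := L.rail_q.le_length j hj
  have c1 := L.rail_p.le j hj
  have c3 := L.rail_q.le j hj
  have hH := isHole_hole hord hi hj (hig.trans hgj)
  have a1 := L.rail_p.adj_first g hg
  have a2 := L.rail_p.adj_last g hg
  have a3 := L.rail_q.adj_first g hg
  have a4 := L.rail_q.adj_last g hg
  simp only [hlen] at a3 a4
  have heq : G.neighborSet (L.leg g 0) ∩ L.hole i j =
      {L.p (L.f g), L.p (L.l g)} ∪ {L.q (L.f' g), L.q (L.l' g)} := by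
    ext v
    constructor
    · rintro ⟨hv, ((⟨a, h, h', rfl⟩ | ⟨s, hs, rfl⟩ | ⟨b, h, h', rfl⟩) |
        (⟨a, h, h', rfl⟩ | ⟨s, hs, rfl⟩ | ⟨b, h, h', rfl⟩))⟩
      · have := L.rail_p.mem g hg a (by omega) hv
        obtain rfl | rfl : a = L.f g ∨ a = L.l g := by omega
        · simp
        · simp
      · exact ((L.leg_leg g hg i hi (by omega) 0 (by omega) s hs).2 hv).elim
      · have := L.rail_q.mem g hg b (by omega) (by rw [hlen]; exact hv)
        obtain rfl | rfl : b = L.f' g ∨ b = L.l' g := by omega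
        · simp
        · simp
      · omega
      · exact ((L.leg_leg g hg j hj (by omega) 0 (by omega) s hs).2 hv).elim
      · omega
    · rintro ((rfl | rfl) | (rfl | rfl))
      · exact ⟨a1, Or.inl (p_mem_body (by omega) (by omega))⟩
      · exact ⟨a2, Or.inl (p_mem_body (by omega) (by omega))⟩
      · exact ⟨a3, Or.inl (q_mem_body (by omega) (by omega))⟩
      · exact ⟨a4, Or.inl (q_mem_body (by omega) (by omega))⟩
  -- Exactly four neighbors on this hole: an even wheel.
  have h4 : (G.neighborSet (L.leg g 0) ∩ L.hole i j).ncard = 4 := by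
    rw [heq, Set.ncard_union_eq, Set.ncard_pair, Set.ncard_pair]
    · intro e
      have := L.rail_q.path.1 _ (by omega) _ (by omega) e
      omega
    · intro e
      have := L.rail_p.path.1 _ (by omega) _ (by omega) e
      omega
    · rw [Set.disjoint_left]
      rintro v (rfl | rfl) (e | e)
      · exact (L.p_q _ (by omega) _ (by omega)).1 e
      · exact (L.p_q _ (by omega) _ (by omega)).1 e
      · exact (L.p_q _ (by omega) _ (by omega)).1 e
      · exact (L.p_q _ (by omega) _ (by omega)).1 e
  exact hG (L.hole i j) (L.leg g 0) ⟨⟨hH, by omega⟩, by rw [h4]; decide⟩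

/-- Many legs with one attachment on the first rail and two on the second form a generalized
pyramid. -/
lemma nonempty_generalizedPyramid (hord : L.Ordered) (hi : i ∈ J) (hj : j ∈ J) {t : ℕ}
    {I : Finset ℕ} (hIJ : I ⊆ J) (hI : I.card = t) (hij : i < j)
    (hiI : ∀ g ∈ I, i < g) (hIj : ∀ g ∈ I, g < j) (hp : ∀ g ∈ I, L.l g = L.f g)
    (hq : ∀ g ∈ I, L.l' g = L.f' g + 1) : Nonempty (G.GeneralizedPyramid t) := by
  obtain ⟨α, h0, h1, h2, h3⟩ := exists_cross hord.1 hi hj hij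
  have hcq := @cross_q _ _ _ _ _ _ _ hord hi hj hij h1 h2 h3
  have hcases := @cross_cases _ _ _ L i j α (hord.1 i hi j hj hij).1 h1 h2 h3
  have hH := isHole_cross hord hi hj hij h0 h1 h2 h3
  obtain ⟨oj1, oj2⟩ := hord.2 i hi j hj hij
  obtain ⟨ok1, ok2⟩ := hord.1 i hi j hj hij
  set N := L.len i + 1 + (L.f j - L.l i) + 1 + L.len j with hN
  set M := L.f' j - L.l' i with hM
  have hbm := L.rail_q.le_length j hj
  have hbn := L.rail_p.le_length j hj
  have hcj := L.rail_q.le j hj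
  have hcj' := L.rail_p.le j hj
  have hβ := L.rail_q.path.segment (L.l' i) M (by omega)
  set e := I.orderEmbOfFin hI with he
  have heI : ∀ k, e k ∈ I := fun k => I.orderEmbOfFin_mem hI k
  have heJ : ∀ k, e k ∈ J := fun k => hIJ (heI k)
  have hlt : ∀ k k', k < k' → e k < e k' := fun k k' h => e.strictMono h
  have hR : ∀ k, G.IsInducedPath (fun s => L.leg (e k) (L.len (e k) - s)) (L.len (e k)) :=
    fun k => (L.path_leg _ (heJ k)).reverse
  have o1 : ∀ k, L.l' i < L.f' (e k) := fun k => by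
    have := hord.2 i hi _ (heJ k) (hiI _ (heI k))
    have := hq _ (heI k)
    omega
  have o2 : ∀ k, L.l' (e k) < L.f' j := fun k => by
    have := hord.2 _ (heJ k) j hj (hIj _ (heI k))
    have := hq _ (heI k)
    omega
  have o3 : ∀ k k', k < k' → L.l' (e k) < L.f' (e k') := fun k k' h => by
    have := hord.2 _ (heJ k) _ (heJ k') (hlt k k' h)
    have := hq _ (heI k)
    omega
  have o4 : ∀ k, L.l i ≤ L.f (e k) := fun k => (hord.1 i hi _ (heJ k) (hiI _ (heI k))).1
  have o5 : ∀ k, L.f (e k) ≤ L.f j := fun k => by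
    have := (hord.1 _ (heJ k) j hj (hIj _ (heI k))).1
    have := hp _ (heI k)
    omega
  have o6 : ∀ k k', k ≤ k' → L.f (e k) ≤ L.f (e k') := fun k k' h => by
    rcases h.eq_or_lt with rfl | h
    · exact le_rfl
    · have := (hord.1 _ (heJ k) _ (heJ k') (hlt k k' h)).1
      have := hp _ (heI k)
      omega
  -- The bottom path is the segment of `q`, where the legs have two attachments; the top path
  -- crosses from leg `i` along `p` to leg `j`. Legs are reversed to start at `q`. In `z`, the
  -- offset `L.len i + 1` counts the vertices of leg `i` preceding the rail.
  refine ⟨{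
    lenP := M
    lenQ := N
    lenR := fun k => L.len (e k)
    P := hβ.embedding
    Q := h0.embedding
    R := fun k => (hR k).embedding
    disjoint_P_Q := ?_
    disjoint_R_P := ?_
    disjoint_R_Q := ?_
    isHole := ?_
    adj_first := ?_
    adj_last := ?_
    x := fun k => ⟨L.f' (e k) - L.l' i, by have := o1 k; have := o2 k; have := hq _ (heI k); omega⟩
    y := fun k => ⟨L.f' (e k) - L.l' i + 1, by
      have := o1 k; have := o2 k; have := hq _ (heI k); omega⟩
    z := fun k => ⟨L.len i + 1 + (L.f (e k) - L.l i), by have := o4 k; have := o5 k; omega⟩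
    adj_R_P := ?_
    adj_R_Q := ?_
    anticomplete_R := ?_
    x_pos := ?_
    y_eq := ?_
    y_lt := ?_
    y_lt_x := ?_
    z_mono := ?_ }⟩
  · rw [Set.disjoint_left]
    rintro _ ⟨b, rfl⟩ ⟨u, hu⟩
    exact (hcq (u := u) (b := b) (by omega) (by omega)).1 hu
  · intro k
    rw [Set.disjoint_left]
    rintro _ ⟨s, rfl⟩ ⟨b, hb⟩
    exact (L.leg_q _ (heJ k) _ (by omega) _ (by omega)).1 hb.symm
  · intro k
    rw [Set.disjoint_left]
    rintro _ ⟨s, rfl⟩ ⟨u, hu⟩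
    simp only [IsInducedPath.embedding_apply] at hu
    rcases hcases (u := u) (by omega) with ⟨s', hs', -, h⟩ | ⟨a, ha, ha', -, h⟩ | ⟨s', hs', -, h⟩
    · exact (L.leg_leg i hi _ (heJ k) (hiI _ (heI k)).ne s' hs' _ (by omega)).1 (h.symm.trans hu)
    · exact (L.leg_p _ (heJ k) _ (by omega) a (by omega)).1 (hu.symm.trans h)
    · exact (L.leg_leg _ (heJ k) j hj (hIj _ (heI k)).ne _ (by omega) s' hs').1 (hu.symm.trans h)
  · rw [IsInducedPath.range_embedding, IsInducedPath.range_embedding, Set.union_comm]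
    exact hH
  · exact ((hcq (u := 0) (b := 0) (by omega) (by omega)).2.2 (Or.inl ⟨rfl, rfl⟩)).symm
  · exact ((hcq (u := N) (b := M) (by omega) (by omega)).2.2 (Or.inr ⟨rfl, rfl⟩)).symm
  · intro k s b
    have hk := hq _ (heI k)
    have ho := o1 k
    have ho' := o2 k
    simp only [IsInducedPath.embedding_apply, Fin.ext_iff, Fin.val_zero]
    constructor
    · intro h
      have hs := (L.leg_q _ (heJ k) _ (by omega) _ (by omega)).2 h
      rw [hs] at h
      have := L.rail_q.mem _ (heJ k) _ (by omega) h
      have := L.rail_q.le_length _ (heJ k)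
      have := s.2
      omega
    · rintro ⟨hs, hb⟩
      rw [hs, Nat.sub_zero]
      rcases hb with hb | hb
      · rw [hb, show L.l' i + (L.f' (e k) - L.l' i) = L.f' (e k) by omega]
        exact L.rail_q.adj_first _ (heJ k)
      · rw [hb, show L.l' i + (L.f' (e k) - L.l' i + 1) = L.l' (e k) by omega]
        exact L.rail_q.adj_last _ (heJ k)
  · intro k s u
    have ho := o4 k
    have ho' := o5 k
    have hk := hp _ (heI k)
    simp only [IsInducedPath.embedding_apply, Fin.ext_iff, Fin.val_last]
    constructor
    · intro h
      rcases hcases (u := u) (by omega) with ⟨s', hs', hu, e'⟩ | ⟨a, ha, ha', hu, e'⟩ |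
        ⟨s', hs', hu, e'⟩
      · rw [e'] at h
        exact ((L.leg_leg i hi _ (heJ k) (hiI _ (heI k)).ne s' hs' _ (by omega)).2 h.symm).elim
      · rw [e'] at h
        have hs := (L.leg_p _ (heJ k) _ (by omega) _ (by omega)).2 h
        rw [hs] at h
        have := L.rail_p.mem _ (heJ k) _ (by omega) h
        have := s.2
        omega
      · rw [e'] at h
        exact ((L.leg_leg _ (heJ k) j hj (hIj _ (heI k)).ne _ (by omega) s' hs').2 h).elim
    · rintro ⟨hs, hu⟩
      rw [hs, hu, h2 _ ho ho', Nat.sub_self]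
      exact L.rail_p.adj_first _ (heJ k)
  · intro k k' hkk
    refine ⟨?_, ?_⟩
    · rw [Set.disjoint_left]
      rintro _ ⟨s, rfl⟩ ⟨s', h⟩
      exact (L.leg_leg _ (heJ k) _ (heJ k') (hlt k k' hkk).ne _ (by omega) _ (by omega)).1 h.symm
    · rintro _ ⟨s, rfl⟩ _ ⟨s', rfl⟩
      exact (L.leg_leg _ (heJ k) _ (heJ k') (hlt k k' hkk).ne _ (by omega) _ (by omega)).2
  · intro k
    have := o1 k
    rw [Fin.lt_def]
    simp only [Fin.val_zero]
    omega
  · intro k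
    rfl
  · intro k
    have := o1 k
    have := o2 k
    have := hq _ (heI k)
    rw [Fin.lt_def]
    simp only [Fin.val_last]
    omega
  · intro k k' hkk
    have := o3 k k' hkk
    have := o1 k
    have := hq _ (heI k)
    rw [Fin.lt_def]
    simp only
    omega
  · intro k k' hkk
    have := o6 k k' hkk
    rw [Fin.le_def]
    simp only
    omega

end Ladder

end SimpleGraph

/-! ### Rerouting rails until every inner leg is narrow -/

namespace SimpleGraph

universe u
variable {V : Type u} {G : SimpleGraph V}

/-- The stretch strictly between `f` and `l` is replaced by `w`. The new path is induced because `f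
+ 2 ≤ l` keeps `p f` and `p l` nonadjacent and `w` has no neighbor outside the stretch from `f` to
`l`. -/
lemma IsInducedPath.exists_reroute {p : ℕ → V} {n f l : ℕ} {w : V} (hp : G.IsInducedPath p n)
    (hfl : f + 2 ≤ l) (hl : l ≤ n) (hf : G.Adj w (p f)) (hwl : G.Adj w (p l))
    (hw : ∀ a ≤ n, G.Adj w (p a) → f ≤ a ∧ a ≤ l) (hne : ∀ a ≤ n, w ≠ p a) :
    ∃ p' : ℕ → V, G.IsInducedPath p' (f + 2 + (n - l)) ∧ (∀ a ≤ f, p' a = p a) ∧ p' (f + 1) = w ∧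
      ∀ a, l ≤ a → a ≤ n → p' (f + 2 + (a - l)) = p a := by
  have h0 : G.IsInducedPath p f := (hp.segment 0 f (by omega)).congr fun i _ => by simp
  have h1 := h0.append (IsInducedPath.singleton (G := G) w)
    (fun i hi j hj => (hne i (by omega)).symm) (fun i hi j hj => by
      constructor
      · intro h
        have := hw i (by omega) h.symm
        omega
      · rintro ⟨rfl, -⟩
        exact hf.symm)
  have h2 := h1.append (hp.segment l (n - l) (by omega)) (by
      intro i hi j hj
      by_cases h : i ≤ f <;> simp only [h, if_true, if_false]
      · intro e
        have := hp.1 _ (by omega) _ (by omega) e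
        omega
      · exact hne _ (by omega)) (by
      intro i hi j hj
      by_cases h : i ≤ f <;> simp only [h, if_true, if_false]
      · rw [hp.2 _ (by omega) _ (by omega)]
        omega
      · constructor
        · intro h
          have := hw _ (by omega) h
          omega
        · rintro ⟨-, rfl⟩
          exact hwl)
  refine ⟨_, by rwa [show f + 1 + 0 + 1 + (n - l) = f + 2 + (n - l) by omega] at h2, ?_, ?_, ?_⟩
  · intro a ha
    have : a ≤ f + 1 + 0 := by omega
    simp only [ha, this, if_true]
  · have : ¬ (f + 1 ≤ f) := by omega
    simp [this]
  · intro a h h'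
    have : ¬ (f + 2 + (a - l) ≤ f + 1 + 0) := by omega
    simp only [this, if_false]
    congr 1; omega

namespace Ladder

variable {J : Finset ℕ} {g : ℕ}

/-- If the first vertex of a leg has nonadjacent neighbors on the first rail, then the rail can be
rerouted through this vertex. -/
lemma exists_reroute (L : G.Ladder J) (hord : RailOrdered J L.f L.l) (hg : g ∈ J)
    (hwide : L.f g + 2 ≤ L.l g) (hlen : L.len g ≠ 0) :
    ∃ L' : G.Ladder J, RailOrdered J L'.f L'.l ∧ L'.f' = L.f' ∧ L'.l' = L.l' ∧
      (L'.len g = L.len g - 1 ∧ (∀ s, L'.leg g s = L.leg g (s + 1)) ∧ L'.l g = L'.f g) ∧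
      ∀ i ∈ J, i ≠ g → L'.len i = L.len i ∧ (∀ s, L'.leg i s = L.leg i s) ∧
        (L.l i ≤ L.f i + 1 → L'.l i ≤ L'.f i + 1) := by
  have hlg := L.rail_p.le_length g hg
  obtain ⟨p', hp', hp1, hp2, hp3⟩ := L.rail_p.path.exists_reroute hwide hlg
    (L.rail_p.adj_first g hg) (L.rail_p.adj_last g hg) (L.rail_p.mem g hg)
    (fun a ha => (L.leg_p g hg 0 (by omega) a ha).1)
  obtain ⟨leg, hleg, hleg'⟩ : ∃ leg : ℕ → ℕ → V, leg g = (fun s => L.leg g (s + 1)) ∧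
      ∀ i, i ≠ g → leg i = L.leg i :=
    ⟨Function.update L.leg g _, Function.update_self .., fun i hi => Function.update_of_ne hi _ _⟩
  obtain ⟨len, hlen1, hlen2⟩ : ∃ len : ℕ → ℕ, len g = L.len g - 1 ∧
      ∀ i, i ≠ g → len i = L.len i :=
    ⟨Function.update L.len g _, Function.update_self .., fun i hi => Function.update_of_ne hi _ _⟩
  -- `F` translates positions on the old rail: unchanged before `g`, shifted after it. Leg `g` now
  -- attaches exactly at position `L.f g + 1`, its former first vertex.
  obtain ⟨F, hF1, hF2, hF3⟩ : ∃ F : (ℕ → ℕ) → ℕ → ℕ, (∀ h, F h g = L.f g + 1) ∧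
      (∀ h i, i < g → F h i = h i) ∧ ∀ h i, g < i → F h i = L.f g + 2 + (h i - L.l g) := by
    refine ⟨fun h i => if i < g then h i else if i = g then L.f g + 1 else
      L.f g + 2 + (h i - L.l g), ?_, ?_, ?_⟩
    · simp
    · intro h i hi
      simp [hi]
    · intro h i hi
      have h1 : ¬ i < g := by omega
      have h2 : i ≠ g := by omega
      simp [h1, h2]
  have hcases : ∀ a ≤ L.f g + 2 + (L.n - L.l g), (a ≤ L.f g ∧ p' a = L.p a) ∨
      (a = L.f g + 1 ∧ p' a = L.leg g 0) ∨
      ∃ a', L.l g ≤ a' ∧ a' ≤ L.n ∧ a = L.f g + 2 + (a' - L.l g) ∧ p' a = L.p a' := by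
    intro a ha
    rcases Nat.lt_or_ge a (L.f g + 1) with h | h
    · exact Or.inl ⟨by omega, hp1 a (by omega)⟩
    rcases h.eq_or_lt with h | h
    · exact Or.inr (Or.inl ⟨h.symm, h ▸ hp2⟩)
    · refine Or.inr (Or.inr ⟨a - (L.f g + 2) + L.l g, by omega, by omega, by omega, ?_⟩)
      rw [← hp3 _ (by omega) (by omega)]
      congr 1; omega
  -- Strict, since an attachment shared with `g` would make `g` attach at a single vertex. No other
  -- leg loses an attachment to the rerouting.
  have hbefore : ∀ i ∈ J, i < g → L.l i < L.f g := fun i hi hig => by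
    have := hord i hi g hg hig
    omega
  have hafter : ∀ i ∈ J, g < i → L.l g < L.f i := fun i hi hig => by
    have := hord g hg i hi hig
    omega
  have hle := L.rail_p.le
  refine ⟨{
    leg := leg
    len := len
    p := p'
    n := L.f g + 2 + (L.n - L.l g)
    f := F L.f
    l := F L.l
    q := L.q
    m := L.m
    f' := L.f'
    l' := L.l'
    rail_p := ⟨hp', ?_, ?_, ?_, ?_, ?_⟩
    rail_q := L.rail_q.congr ?_
    path_leg := ?_
    leg_leg := ?_
    p_q := ?_
    leg_p := ?_
    leg_q := ?_ }, ?_, rfl, rfl, ⟨hlen1, fun s => congrFun hleg s, ?_⟩,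
    fun i hi hig => ⟨hlen2 i hig, fun s => congrFun (hleg' i hig) s, ?_⟩⟩
  · intro i hi
    have := hle i hi
    rcases lt_trichotomy i g with h | rfl | h
    · rw [hF2 _ i h, hF2 _ i h]; exact this
    · rw [hF1, hF1]
    · rw [hF3 _ i h, hF3 _ i h]; omega
  · intro i hi
    have := L.rail_p.le_length i hi
    rcases lt_trichotomy i g with h | rfl | h
    · have := hbefore i hi h
      rw [hF2 _ i h]; omega
    · rw [hF1]; omega
    · rw [hF3 _ i h]; omega
  · intro i hi
    have := hle i hi
    have := L.rail_p.le_length i hi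
    rcases lt_trichotomy i g with h | rfl | h
    · have := hbefore i hi h
      rw [hF2 _ i h, hp1 _ (by omega), hleg' i h.ne]
      exact L.rail_p.adj_first i hi
    · rw [hF1, hp2, hleg]
      exact ((L.path_leg i hi).2 _ (by omega) _ (by omega)).2 (Or.inr rfl)
    · have := hafter i hi h
      rw [hF3 _ i h, hp3 _ (by omega) (by omega), hleg' i h.ne']
      exact L.rail_p.adj_first i hi
  · intro i hi
    have := hle i hi
    have := L.rail_p.le_length i hi
    rcases lt_trichotomy i g with h | rfl | h
    · have := hbefore i hi h
      rw [hF2 _ i h, hp1 _ (by omega), hleg' i h.ne]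
      exact L.rail_p.adj_last i hi
    · rw [hF1, hp2, hleg]
      exact ((L.path_leg i hi).2 _ (by omega) _ (by omega)).2 (Or.inr rfl)
    · have := hafter i hi h
      rw [hF3 _ i h, hp3 _ (by omega) (by omega), hleg' i h.ne']
      exact L.rail_p.adj_last i hi
  · intro i hi a ha hadj
    by_cases hig : i = g
    · subst hig
      rw [hF1, hF1]
      rw [hleg] at hadj
      rcases hcases a ha with ⟨h, e⟩ | ⟨h, e⟩ | ⟨a', h1, h2, h3, e⟩
      · rw [e] at hadj
        have := (L.leg_p i hi _ (by omega) _ (by omega)).2 hadj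
        omega
      · omega
      · rw [e] at hadj
        have := (L.leg_p i hi _ (by omega) _ (by omega)).2 hadj
        omega
    · rw [hleg' i hig] at hadj
      rcases hcases a ha with ⟨h, e⟩ | ⟨h, e⟩ | ⟨a', h1, h2, h3, e⟩
      · rw [e] at hadj
        have := L.rail_p.mem i hi a (by omega) hadj
        rcases lt_or_gt_of_ne hig with h | h
        · rw [hF2 _ i h, hF2 _ i h]; exact this
        · have := hafter i hi h
          omega
      · rw [e] at hadj
        exact ((L.leg_leg i hi g hg hig 0 (by omega) 0 (by omega)).2 hadj).elim
      · rw [e] at hadj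
        have := L.rail_p.mem i hi a' (by omega) hadj
        rcases lt_or_gt_of_ne hig with h | h
        · have := hbefore i hi h
          omega
        · have := hafter i hi h
          rw [hF3 _ i h, hF3 _ i h]; omega
  · intro i hi
    by_cases hig : i = g
    · subst hig
      simp only [hleg, hlen1]
      congr 1; omega
    · rw [hleg' i hig, hlen2 i hig]
  · intro i hi
    by_cases hig : i = g
    · subst hig
      rw [hleg, hlen1]
      refine ((L.path_leg i hi).segment 1 (L.len i - 1) (by omega)).congr fun s hs => ?_
      rw [add_comm]
    · rw [hleg' i hig, hlen2 i hig]
      exact L.path_leg i hi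
  · intro i hi j hj hij s hs s' hs'
    by_cases hig : i = g
    · subst hig
      rw [hleg, hleg' j hij.symm]
      rw [hlen1] at hs
      rw [hlen2 j hij.symm] at hs'
      exact L.leg_leg i hi j hj hij _ (by omega) s' hs'
    · by_cases hjg : j = g
      · subst hjg
        rw [hleg, hleg' i hij]
        rw [hlen1] at hs'
        rw [hlen2 i hij] at hs
        exact L.leg_leg i hi j hj hij s hs _ (by omega)
      · rw [hleg' i hig, hleg' j hjg]
        rw [hlen2 i hig] at hs
        rw [hlen2 j hjg] at hs'
        exact L.leg_leg i hi j hj hij s hs s' hs'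
  · intro a ha b hb
    rcases hcases a ha with ⟨h, e⟩ | ⟨h, e⟩ | ⟨a', h1, h2, h3, e⟩
    · rw [e]; exact L.p_q a (by omega) b hb
    · rw [e]
      have := L.leg_q g hg 0 (by omega) b hb
      exact ⟨this.1, fun h => hlen (this.2 h).symm⟩
    · rw [e]; exact L.p_q a' (by omega) b hb
  · intro i hi s hs a ha
    by_cases hig : i = g
    · subst hig
      rw [hleg]
      rw [hlen1] at hs
      rcases hcases a ha with ⟨h, e⟩ | ⟨h, e⟩ | ⟨a', h1, h2, h3, e⟩
      · rw [e]
        have := L.leg_p i hi (s + 1) (by omega) a (by omega)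
        exact ⟨this.1, fun h => absurd (this.2 h) (by omega)⟩
      · rw [e]
        refine ⟨fun e => ?_, fun h => ?_⟩
        · have := (L.path_leg i hi).1 _ (by omega) _ (by omega) e
          omega
        · rw [(L.path_leg i hi).2 _ (by omega) _ (by omega)] at h
          omega
      · rw [e]
        have := L.leg_p i hi (s + 1) (by omega) a' (by omega)
        exact ⟨this.1, fun h => absurd (this.2 h) (by omega)⟩
    · rw [hleg' i hig]
      rw [hlen2 i hig] at hs
      rcases hcases a ha with ⟨h, e⟩ | ⟨h, e⟩ | ⟨a', h1, h2, h3, e⟩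
      · rw [e]; exact L.leg_p i hi s hs a (by omega)
      · rw [e]
        have := L.leg_leg i hi g hg hig s hs 0 (by omega)
        exact ⟨this.1, fun h => (this.2 h).elim⟩
      · rw [e]; exact L.leg_p i hi s hs a' (by omega)
  · intro i hi s hs b hb
    by_cases hig : i = g
    · subst hig
      rw [hleg]
      rw [hlen1] at hs
      have := L.leg_q i hi (s + 1) (by omega) b hb
      exact ⟨this.1, fun h => by have := this.2 h; omega⟩
    · rw [hleg' i hig, hlen2 i hig]
      rw [hlen2 i hig] at hs
      exact L.leg_q i hi s hs b hb
  · intro i hi j hj hij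
    have := hord i hi j hj hij
    have := hle i hi
    have := hle j hj
    simp only
    rcases lt_trichotomy i g with h | h | h
    · have := hbefore i hi h
      rcases lt_trichotomy j g with h' | h' | h'
      · rw [hF2 _ i h, hF2 _ i h, hF2 _ j h', hF2 _ j h']; omega
      · subst h'
        rw [hF2 _ i h, hF2 _ i h, hF1, hF1]; omega
      · rw [hF2 _ i h, hF2 _ i h, hF3 _ j h', hF3 _ j h']; omega
    · subst h
      rw [hF1, hF1, hF3 _ j hij, hF3 _ j hij]; omega
    · have h' : g < j := by omega
      have := hafter i hi h
      have := hafter j hj h'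
      rw [hF3 _ i h, hF3 _ i h, hF3 _ j h', hF3 _ j h']; omega
  · simp only [hF1]
  · intro h
    simp only
    have := hle i hi
    rcases lt_or_gt_of_ne hig with h' | h'
    · rw [hF2 _ i h', hF2 _ i h']; exact h
    · have := hafter i hi h'
      rw [hF3 _ i h', hF3 _ i h']; omega

lemma Ordered.swap {L : G.Ladder J} (h : L.Ordered) : L.swap.Ordered := ⟨h.2, h.1⟩

/-- Each leg contains a vertex that is not a hub, or has no two nonadjacent neighbors on either
rail. -/
def Admissible (L : G.Ladder J) : Prop :=
  ∀ i ∈ J, (∃ s ≤ L.len i, L.leg i s ∉ G.hubs) ∨ (L.l i ≤ L.f i + 1 ∧ L.l' i ≤ L.f' i + 1)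

lemma Admissible.swap {L : G.Ladder J} (h : L.Admissible) : L.swap.Admissible := by
  intro i hi
  rcases h i hi with ⟨s, hs, hsh⟩ | ⟨h1, h2⟩
  · refine Or.inl ⟨L.len i - s, Nat.sub_le _ _, ?_⟩
    change L.leg i (L.len i - (L.len i - s)) ∉ _
    rwa [show L.len i - (L.len i - s) = s by omega]
  · exact Or.inr ⟨h2, h1⟩

/-- One step of the reduction in `exists_narrow`. -/
lemma exists_shorter (L : G.Ladder J) (hord : L.Ordered) (hadm : L.Admissible) (hg : g ∈ J)
    (hwide : L.f g + 2 ≤ L.l g)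
    (hcase : (∃ s ≤ L.len g, s ≠ 0 ∧ L.leg g s ∉ G.hubs) ∨
      (L.len g ≠ 0 ∧ L.l' g ≤ L.f' g + 1)) :
    ∃ L' : G.Ladder J, L'.Ordered ∧ L'.Admissible ∧ ∑ i ∈ J, L'.len i < ∑ i ∈ J, L.len i := by
  have hlen : L.len g ≠ 0 := by
    rcases hcase with ⟨s, h1, h2, -⟩ | h
    · omega
    · exact h.1
  obtain ⟨L', h1, h2, h3, ⟨h4, h5, h6⟩, h7⟩ := L.exists_reroute hord.1 hg hwide hlen
  refine ⟨L', ⟨h1, by rw [h2, h3]; exact hord.2⟩, ?_, ?_⟩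
  · intro i hi
    by_cases hig : i = g
    · subst hig
      rcases hcase with ⟨s, hs, hs0, hsh⟩ | ⟨-, h⟩
      · refine Or.inl ⟨s - 1, by omega, ?_⟩
        rwa [h5, show s - 1 + 1 = s by omega]
      · refine Or.inr ⟨by omega, by rwa [h2, h3]⟩
    · obtain ⟨e1, e2, e3⟩ := h7 i hi hig
      rcases hadm i hi with ⟨s, hs, hsh⟩ | ⟨h, h'⟩
      · exact Or.inl ⟨s, by omega, by rwa [e2]⟩
      · exact Or.inr ⟨e3 h, by rwa [h2, h3]⟩
  · refine Finset.sum_lt_sum (fun i hi => ?_) ⟨g, hg, by omega⟩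
    by_cases hig : i = g
    · subst hig; omega
    · exact (h7 i hi hig).1.le

/-- A ladder all of whose inner legs are attached to each rail at one vertex or at two consecutive
vertices. -/
lemma exists_narrow [Finite V] (L : G.Ladder J) (hord : L.Ordered) (hadm : L.Admissible) :
    ∃ L' : G.Ladder J, L'.Ordered ∧ ∀ i ∈ J, ∀ g ∈ J, ∀ j ∈ J, i < g → g < j →
      L'.l g ≤ L'.f g + 1 ∧ L'.l' g ≤ L'.f' g + 1 := by
  -- Each rerouting removes a vertex from a leg and lengthens none, so the total leg length
  -- decreases.
  obtain ⟨N, hN⟩ : ∃ N, ∑ i ∈ J, L.len i = N := ⟨_, rfl⟩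
  induction N using Nat.strong_induction_on generalizing L with
  | _ N ih =>
  by_cases hno : ∀ i ∈ J, ∀ g ∈ J, ∀ j ∈ J, i < g → g < j →
      L.l g ≤ L.f g + 1 ∧ L.l' g ≤ L.f' g + 1
  · exact ⟨L, hord, hno⟩
  push Not at hno
  obtain ⟨i, hi, g, hg, j, hj, hig, hgj, hwide⟩ := hno
  have step : ∀ L₀ : G.Ladder J, L₀.Ordered → L₀.Admissible → ∑ i ∈ J, L₀.len i = N →
      L₀.f g + 2 ≤ L₀.l g → ∃ L' : G.Ladder J, L'.Ordered ∧ L'.Admissible ∧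
        ∑ i ∈ J, L'.len i < N := by
    intro L₀ hord hadm hN hwide
    subst hN
    -- Rerouting `p` consumes the first vertex of leg `g`. This is harmless if a non-hub remains in
    -- the leg, or if the leg is narrow on `q`, for it then becomes narrow on both rails. If the
    -- only known non-hub is the first vertex and the leg is also wide on `q`, the rail `q` is
    -- rerouted through the other end instead.
    rcases hadm g hg with ⟨s, hs, hsh⟩ | ⟨h, -⟩
    · by_cases hs0 : s = 0
      · subst hs0
        by_cases hlen : L₀.len g = 0
        · have := not_wide_of_len_eq_zero hord hi hg hj hig hgj hlen hsh
          omega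
        · by_cases hq : L₀.l' g ≤ L₀.f' g + 1
          · exact L₀.exists_shorter hord hadm hg hwide (Or.inr ⟨hlen, hq⟩)
          · refine L₀.swap.exists_shorter hord.swap hadm.swap hg
              (by change L₀.f' g + 2 ≤ L₀.l' g; omega) (Or.inl ⟨L₀.len g, le_rfl, hlen, ?_⟩)
            change L₀.leg g (L₀.len g - L₀.len g) ∉ _
            rwa [Nat.sub_self]
      · exact L₀.exists_shorter hord hadm hg hwide (Or.inl ⟨s, hs, hs0, hsh⟩)
    · omega
  have : ∃ L' : G.Ladder J, L'.Ordered ∧ L'.Admissible ∧ ∑ i ∈ J, L'.len i < N := by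
    by_cases hp : L.f g + 2 ≤ L.l g
    · exact step L hord hadm hN hp
    · have hq := hwide (by omega)
      exact step L.swap hord.swap hadm.swap hN (by change L.f' g + 2 ≤ L.l' g; omega)
  obtain ⟨L', h1, h2, h3⟩ := this
  exact ih _ h3 L' h1 h2 rfl

/-- Graphs in the class have no long ordered ladder each of whose legs contains a vertex that is
not a hub. -/
theorem card_lt_of_ordered [Finite V] {t : ℕ} (hG : G.InClassCtt t) (L : G.Ladder J)
    (hord : L.Ordered) (hadm : L.Admissible) : J.card < 2 * t + 2 := by
  by_contra hcard
  push Not at hcard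
  obtain ⟨L, hord, hnar⟩ := L.exists_narrow hord hadm
  have hne : J.Nonempty := Finset.card_pos.1 (by omega)
  set i := J.min' hne with hi
  set j := J.max' hne with hj
  have hiJ : i ∈ J := J.min'_mem hne
  have hjJ : j ∈ J := J.max'_mem hne
  -- The outermost legs serve to close up holes, thetas and prisms. Of the at least `2 * t` inner
  -- legs, each of one of two types, `t` have the same type.
  set I := (J.erase i).erase j with hI
  have hIJ : ∀ g ∈ I, g ∈ J ∧ i < g ∧ g < j := by
    intro g hg
    obtain ⟨hgj, hg⟩ := Finset.mem_erase.1 hg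
    obtain ⟨hgi, hg⟩ := Finset.mem_erase.1 hg
    exact ⟨hg, lt_of_le_of_ne (J.min'_le g hg) (Ne.symm hgi), lt_of_le_of_ne (J.le_max' g hg) hgj⟩
  have hIc : 2 * t ≤ I.card := by
    have h1 := Finset.pred_card_le_card_erase (s := J) (a := i)
    have h2 := Finset.pred_card_le_card_erase (s := J.erase i) (a := j)
    rw [hI]
    omega
  have htype : ∀ g ∈ I, (L.l g = L.f g ∧ L.l' g = L.f' g + 1) ∨
      (L.l' g = L.f' g ∧ L.l g = L.f g + 1) := by
    intro g hg
    obtain ⟨hgJ, hig, hgj⟩ := hIJ g hg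
    obtain ⟨h1, h2⟩ := hnar i hiJ g hgJ j hjJ hig hgj
    have h3 := L.rail_p.le g hgJ
    have h4 := L.rail_q.le g hgJ
    by_cases hp : L.l g = L.f g
    · by_cases hq : L.l' g = L.f' g
      · exact (not_single_single hord hG.theta_free hiJ hgJ hjJ hig hgj hp.symm hq.symm).elim
      · exact Or.inl ⟨hp, by omega⟩
    · by_cases hq : L.l' g = L.f' g
      · exact Or.inr ⟨hq, by omega⟩
      · by_cases hlen : L.len g = 0
        · exact (not_pair_pair_of_len_eq_zero hG.evenWheel_free hord hiJ hgJ hjJ hig hgj hlen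
            (by omega) (by omega)).elim
        · exact (not_pair_pair hord hG.prism_free hiJ hgJ hjJ hig hgj
            (by omega) (by omega) hlen).elim
  have hij : t ≠ 0 → i < j := by
    intro ht
    obtain ⟨g, hg⟩ := Finset.card_pos.1 (show 0 < I.card by omega)
    exact (hIJ g hg).2.1.trans (hIJ g hg).2.2
  have ht : t ≠ 0 := by
    rintro rfl
    have := hG.cliqueFree ∅
    simp at this
  have hsum := Finset.card_filter_add_card_filter_not (s := I) (fun g => L.l g = L.f g)
  have hfin : t ≤ (I.filter fun g => L.l g = L.f g).card ∨
      t ≤ (I.filter fun g => ¬ L.l g = L.f g).card := by omega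
  rcases hfin with h | h
  · obtain ⟨K, hK, hKc⟩ := Finset.exists_subset_card_eq h
    have hK' : ∀ g ∈ K, g ∈ I ∧ L.l g = L.f g := fun g hg => Finset.mem_filter.1 (hK hg)
    refine not_isEmpty_iff.2 (nonempty_generalizedPyramid hord hiJ hjJ
      (fun g hg => (hIJ g (hK' g hg).1).1) hKc (hij ht) (fun g hg => (hIJ g (hK' g hg).1).2.1)
      (fun g hg => (hIJ g (hK' g hg).1).2.2) (fun g hg => (hK' g hg).2) (fun g hg => ?_))
      hG.generalizedPyramid_free
    have := htype g (hK' g hg).1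
    have := (hK' g hg).2
    omega
  · obtain ⟨K, hK, hKc⟩ := Finset.exists_subset_card_eq h
    have hK' : ∀ g ∈ K, g ∈ I ∧ ¬ L.l g = L.f g := fun g hg => Finset.mem_filter.1 (hK hg)
    refine not_isEmpty_iff.2 (nonempty_generalizedPyramid (L := L.swap) hord.swap hiJ hjJ
      (fun g hg => (hIJ g (hK' g hg).1).1) hKc (hij ht) (fun g hg => (hIJ g (hK' g hg).1).2.1)
      (fun g hg => (hIJ g (hK' g hg).1).2.2) (fun g hg => ?_) (fun g hg => ?_))
      hG.generalizedPyramid_free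
    · have := htype g (hK' g hg).1
      have := (hK' g hg).2
      change L.l' g = L.f' g
      omega
    · have := htype g (hK' g hg).1
      have := (hK' g hg).2
      change L.l g = L.f g + 1
      omega

end Ladder

end SimpleGraph

/-! ### Sorting the legs along both rails -/

namespace SimpleGraph

universe u
variable {V : Type u} {G : SimpleGraph V}

/-- Any two legs are attached to the rail one after the other, in some order. -/
def RailComparable (J : Finset ℕ) (f l : ℕ → ℕ) : Prop :=
  ∀ i ∈ J, ∀ j ∈ J, i ≠ j → (l i ≤ f j ∧ (l i = f j → f i = l i ∧ f j = l j)) ∨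
    (l j ≤ f i ∧ (l j = f i → f j = l j ∧ f i = l i))

lemma RailComparable.mono {J J' : Finset ℕ} {f l : ℕ → ℕ} (h : RailComparable J f l)
    (hJ : J' ⊆ J) : RailComparable J' f l :=
  fun i hi j hj => h i (hJ hi) j (hJ hj)

lemma RailOrdered.mono {J J' : Finset ℕ} {f l : ℕ → ℕ} (h : RailOrdered J f l)
    (hJ : J' ⊆ J) : RailOrdered J' f l :=
  fun i hi j hj => h i (hJ hi) j (hJ hj)

namespace Ladder

variable {J : Finset ℕ}

/-- Each leg contains a vertex that is not a hub. -/
def NonHub (L : G.Ladder J) : Prop := ∀ i ∈ J, ∃ s ≤ L.len i, L.leg i s ∉ G.hubs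

lemma NonHub.swap {L : G.Ladder J} (h : L.NonHub) : L.swap.NonHub := by
  intro i hi
  obtain ⟨s, hs, hsh⟩ := h i hi
  refine ⟨L.len i - s, Nat.sub_le _ _, ?_⟩
  change L.leg i (L.len i - (L.len i - s)) ∉ _
  rwa [show L.len i - (L.len i - s) = s by omega]

/-- The ladder obtained by shrinking the first rail to a vertex adjacent to all legs. -/
def star (L : G.Ladder J) {a : ℕ} (ha : a ≤ L.n) (h : ∀ i ∈ J, G.Adj (L.leg i 0) (L.p a)) :
    G.Ladder J where
  leg := L.leg
  len := L.len
  p _ := L.p a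
  n := 0
  f _ := 0
  l _ := 0
  q := L.q
  m := L.m
  f' := L.f'
  l' := L.l'
  rail_p := ⟨IsInducedPath.singleton _, fun _ _ => le_rfl, fun _ _ => le_rfl, h, h,
    fun _ _ b hb _ => by omega⟩
  rail_q := L.rail_q
  path_leg := L.path_leg
  leg_leg := L.leg_leg
  p_q _ _ := L.p_q a ha
  leg_p i hi s hs _ _ := L.leg_p i hi s hs a ha
  leg_q := L.leg_q

/-- Two legs with neighbors in a rail on both sides of a common nonneighbor yield a theta. -/
lemma nonempty_theta_of_overlap (L : G.Ladder J) {i j a : ℕ} (hi : i ∈ J) (hj : j ∈ J)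
    (hij : i ≠ j) (hia : L.f i < a) (hai : a < L.l i) (hja : L.f j < a) (haj : a < L.l j) :
    Nonempty G.Theta := by
  have b1 := L.rail_p.le_length i hi
  have b2 := L.rail_p.le_length j hj
  have b3 := L.rail_q.le_length i hi
  have b4 := L.rail_q.le_length j hj
  have b5 := L.rail_q.le i hi
  have b6 := L.rail_q.le j hj
  set Q : Set V := {v | ∃ b, 0 ≤ b ∧ b < L.m + 1 ∧ L.q b = v} with hQ
  have hext : ∀ (X : Set V) (g : ℕ), g ∈ J → Q ⊆ X → G.IsLinked X →
      G.IsLinked (X ∪ {v | ∃ s, 1 ≤ s ∧ s < L.len g + 1 ∧ L.leg g s = v}) := by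
    intro X g hg hQX hX
    by_cases hlen : L.len g = 0
    · convert hX
      ext v
      constructor
      · rintro (h | ⟨s, h, h', -⟩)
        · exact h
        · omega
      · exact Or.inl
    · have := L.rail_q.le_length g hg
      have := L.rail_q.le g hg
      exact hX.union_of_adj (IsLinked.segment_lt (L.path_leg g hg) _ _ le_rfl)
        (hQX ⟨L.f' g, by omega, by omega, rfl⟩) ⟨L.len g, by omega, by omega, rfl⟩
        (L.rail_q.adj_first g hg).symm
  set W : ℕ → Set V := fun g => {v | ∃ s, 1 ≤ s ∧ s < L.len g + 1 ∧ L.leg g s = v} with hW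
  have htouch : ∀ g ∈ J, ∀ X, Q ⊆ X → W g ⊆ X → G.Touches (L.leg g 0) X := by
    intro g hg X hQX hWX
    have := L.rail_q.le_length g hg
    have := L.rail_q.le g hg
    by_cases hlen : L.len g = 0
    · have h := L.rail_q.adj_first g hg
      simp only [hlen] at h
      exact ⟨_, hQX ⟨L.f' g, by omega, by omega, rfl⟩, h⟩
    · refine ⟨_, hWX ⟨1, le_rfl, by omega, rfl⟩, ?_⟩
      rw [(L.path_leg g hg).2 _ (by omega) _ (by omega)]
      omega
  have hpX : ∀ b ≤ L.n, ∀ v ∈ Q ∪ W i ∪ W j, L.p b ≠ v ∧ ¬ G.Adj (L.p b) v := by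
    rintro b hb v ((⟨c, -, hc, rfl⟩ | ⟨s, hs, hs', rfl⟩) | ⟨s, hs, hs', rfl⟩)
    · exact L.p_q b hb c (by omega)
    · have := L.leg_p i hi s (by omega) b hb
      exact ⟨this.1.symm, fun h => by have := this.2 h.symm; omega⟩
    · have := L.leg_p j hj s (by omega) b hb
      exact ⟨this.1.symm, fun h => by have := this.2 h.symm; omega⟩
  set X₀ : Set V := {v | ∃ b, 0 ≤ b ∧ b < a ∧ L.p b = v} with hX₀
  set X₁ : Set V := {v | ∃ b, a + 1 ≤ b ∧ b < L.n + 1 ∧ L.p b = v} with hX₁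
  have h01 : G.Anticomplete X₀ X₁ := by
    constructor
    · rw [Set.disjoint_left]
      rintro _ ⟨b, -, hb, rfl⟩ ⟨c, hc, hc', e⟩
      have := L.rail_p.path.1 _ (by omega) _ (by omega) e
      omega
    · rintro _ ⟨b, -, hb, rfl⟩ _ ⟨c, hc, hc', rfl⟩
      rw [L.rail_p.path.2 _ (by omega) _ (by omega)]
      omega
  have h02 : G.Anticomplete X₀ (Q ∪ W i ∪ W j) := by
    constructor
    · rw [Set.disjoint_left]
      rintro _ ⟨b, -, hb, rfl⟩ hv
      exact (hpX b (by omega) _ hv).1 rfl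
    · rintro _ ⟨b, -, hb, rfl⟩ v hv
      exact (hpX b (by omega) _ hv).2
  have h12 : G.Anticomplete X₁ (Q ∪ W i ∪ W j) := by
    constructor
    · rw [Set.disjoint_left]
      rintro _ ⟨b, -, hb, rfl⟩ hv
      exact (hpX b (by omega) _ hv).1 rfl
    · rintro _ ⟨b, -, hb, rfl⟩ v hv
      exact (hpX b (by omega) _ hv).2
  have hll := L.leg_leg i hi j hj hij 0 (by omega) 0 (by omega)
  have hfst : ∀ g ∈ J, L.f g < a → G.Touches (L.leg g 0) X₀ := fun g hg h =>
    ⟨_, ⟨L.f g, by omega, h, rfl⟩, L.rail_p.adj_first g hg⟩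
  have hlst : ∀ g ∈ J, a < L.l g → G.Touches (L.leg g 0) X₁ := fun g hg h =>
    ⟨_, ⟨L.l g, h, by have := L.rail_p.le_length g hg; omega, rfl⟩, L.rail_p.adj_last g hg⟩
  -- The three routes between the first vertices of the two legs: the rail before `a`, the rail
  -- after `a`, and the remainders of both legs joined through `q`.
  refine nonempty_theta hll.1 hll.2 ![X₀, X₁, Q ∪ W i ∪ W j] ?_ ?_ ?_ ?_
  · intro k
    fin_cases k
    · exact IsLinked.segment_lt L.rail_p.path _ _ (by omega)
    · exact IsLinked.segment_lt L.rail_p.path _ _ (by omega)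
    · exact hext _ j hj Set.subset_union_left (hext _ i hi subset_rfl
        (IsLinked.segment_lt L.rail_q.path _ _ le_rfl))
  · intro k
    fin_cases k
    · exact hfst i hi hia
    · exact hlst i hi hai
    · exact htouch i hi _ (Set.subset_union_left.trans Set.subset_union_left)
        (Set.subset_union_right.trans Set.subset_union_left)
  · intro k
    fin_cases k
    · exact hfst j hj hja
    · exact hlst j hj haj
    · exact htouch j hj _ (Set.subset_union_left.trans Set.subset_union_left)
        Set.subset_union_right
  · intro k k' hk
    fin_cases k <;> fin_cases k' <;> first | exact h01 | exact h02 | exact h12 | simp at hk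

/-- A large ladder in a theta-free graph contains a ladder whose first rail is comparable. -/
lemma exists_comparable (k : ℕ) : ∃ N : ℕ, ∀ {V : Type u} {G : SimpleGraph V} {J : Finset ℕ}
    (L : G.Ladder J), IsEmpty G.Theta → L.NonHub → N ≤ J.card →
    ∃ J' : Finset ℕ, J'.card = k ∧ ∃ L' : G.Ladder J', L'.NonHub ∧
      RailComparable J' L'.f L'.l ∧
      (RailComparable J L.f' L.l' → RailComparable J' L'.f' L'.l') := by
  classical
  -- Ramsey is applied to intersection of the attachment intervals from `f i` to `l i`. Disjoint
  -- intervals are comparable at once; in the intersecting case one leg may have to be discarded,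
  -- whence `k + 1`.
  obtain ⟨N, hN⟩ := exists_ramsey_bound_symm.{0} (k + 1) k
  refine ⟨N, fun {V G J} L hθ hL hJ => ?_⟩
  rcases hN (fun i j => L.f i ≤ L.l j ∧ L.f j ≤ L.l i) (fun i j h => ⟨h.2, h.1⟩) J hJ with
    ⟨s, hs, hsc, h⟩ | ⟨s, hs, hsc, h⟩
  · obtain ⟨i₀, hi₀, hmax⟩ := s.exists_max_image L.f (Finset.card_pos.1 (by omega))
    have hmem : ∀ i ∈ s, L.f i ≤ L.f i₀ ∧ L.f i₀ ≤ L.l i := by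
      intro i hi
      refine ⟨hmax i hi, ?_⟩
      by_cases hii : i = i₀
      · subst hii; exact L.rail_p.le i (hs hi)
      · exact (h i hi i₀ hi₀ hii).2
    have hone : (s.filter fun i => ¬ G.Adj (L.leg i 0) (L.p (L.f i₀))).card ≤ 1 := by
      rw [Finset.card_le_one]
      intro i hi j hj
      obtain ⟨hi, hia⟩ := Finset.mem_filter.1 hi
      obtain ⟨hj, hja⟩ := Finset.mem_filter.1 hj
      by_contra hij
      have key : ∀ g ∈ s, ¬ G.Adj (L.leg g 0) (L.p (L.f i₀)) →
          L.f g < L.f i₀ ∧ L.f i₀ < L.l g := by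
        intro g hg hga
        obtain ⟨h1, h2⟩ := hmem g hg
        refine ⟨lt_of_le_of_ne h1 fun e => hga ?_, lt_of_le_of_ne h2 fun e => hga ?_⟩
        · rw [← e]; exact L.rail_p.adj_first g (hs hg)
        · rw [e]; exact L.rail_p.adj_last g (hs hg)
      exact not_isEmpty_iff.2 (L.nonempty_theta_of_overlap (hs hi) (hs hj) hij (key i hi hia).1
        (key i hi hia).2 (key j hj hja).1 (key j hj hja).2) hθ
    have hsum := Finset.card_filter_add_card_filter_not (s := s)
      (fun i => G.Adj (L.leg i 0) (L.p (L.f i₀)))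
    obtain ⟨J', hJ', hJ'c⟩ := Finset.exists_subset_card_eq
      (show k ≤ (s.filter fun i => G.Adj (L.leg i 0) (L.p (L.f i₀))).card by omega)
    have hJ's : J' ⊆ J := fun i hi => hs (Finset.mem_filter.1 (hJ' hi)).1
    have ha : L.f i₀ ≤ L.n := (L.rail_p.le _ (hs hi₀)).trans (L.rail_p.le_length _ (hs hi₀))
    refine ⟨J', hJ'c, (L.restrict hJ's).star ha fun i hi => (Finset.mem_filter.1 (hJ' hi)).2,
      fun i hi => hL i (hJ's hi), fun i _ j _ _ => Or.inl ⟨le_rfl, fun _ => ⟨rfl, rfl⟩⟩,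
      fun h => h.mono hJ's⟩
  · refine ⟨s, hsc, L.restrict hs, fun i hi => hL i (hs hi), ?_, fun h => h.mono hs⟩
    intro i hi j hj hij
    have := h i hi j hj hij
    change (L.l i ≤ L.f j ∧ (L.l i = L.f j → L.f i = L.l i ∧ L.f j = L.l j)) ∨
      (L.l j ≤ L.f i ∧ (L.l j = L.f i → L.f j = L.l j ∧ L.f i = L.l i))
    omega

/-- A large ladder with comparable first rail contains a ladder whose first rail is ordered. -/
lemma exists_ordered (k : ℕ) : ∃ N : ℕ, ∀ {V : Type u} {G : SimpleGraph V} {J : Finset ℕ}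
    (L : G.Ladder J), RailComparable J L.f L.l → L.NonHub → N ≤ J.card →
    ∃ J' : Finset ℕ, J'.card = k ∧ ∃ L' : G.Ladder J', L'.NonHub ∧
      RailOrdered J' L'.f L'.l ∧
      (RailComparable J L.f' L.l' → RailComparable J' L'.f' L'.l') ∧
      (RailOrdered J L.f' L.l' → RailOrdered J' L'.f' L'.l') := by
  obtain ⟨N, hN⟩ := exists_ramsey_bound.{0} k k
  refine ⟨N, fun {V G J} L hc hL hJ => ?_⟩
  -- Either the order along the rail agrees with the indices on a large subset, or it is opposite
  -- throughout one, and then the rail is reversed without affecting `q`.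
  rcases hN (fun i j => L.l i ≤ L.f j ∧ (L.l i = L.f j → L.f i = L.l i ∧ L.f j = L.l j)) J hJ with
    ⟨s, hs, hsc, h⟩ | ⟨s, hs, hsc, h⟩
  · exact ⟨s, hsc, L.restrict hs, fun i hi => hL i (hs hi), fun i hi j hj hij => h i hi j hj hij,
      fun h => h.mono hs, fun h => h.mono hs⟩
  · refine ⟨s, hsc, (L.restrict hs).reverse, fun i hi => hL i (hs hi), fun i hi j hj hij => ?_,
      fun h => h.mono hs, fun h => h.mono hs⟩
    have h1 := (hc i (hs hi) j (hs hj) hij.ne).resolve_left (h i hi j hj hij)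
    have h2 := L.rail_p.le_length i (hs hi)
    have h3 := L.rail_p.le_length j (hs hj)
    have h4 := L.rail_p.le i (hs hi)
    have h5 := L.rail_p.le j (hs hj)
    change L.n - L.f i ≤ L.n - L.l j ∧ (L.n - L.f i = L.n - L.l j →
      L.n - L.l i = L.n - L.f i ∧ L.n - L.l j = L.n - L.f j)
    omega

/-- Graphs in the class have no large ladders each of whose legs contains a vertex that is not a
hub. -/
theorem exists_card_lt (t : ℕ) : ∃ N : ℕ, ∀ {V : Type u} [Finite V] {G : SimpleGraph V}
    {J : Finset ℕ} (L : G.Ladder J), G.InClassCtt t → L.NonHub → J.card < N := by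
  obtain ⟨N₁, h₁⟩ := exists_ordered.{u} (2 * t + 2)
  obtain ⟨N₂, h₂⟩ := exists_ordered.{u} N₁
  obtain ⟨N₃, h₃⟩ := exists_comparable.{u} N₂
  obtain ⟨N₄, h₄⟩ := exists_comparable.{u} N₃
  refine ⟨N₄, fun {V _ G J} L hG hL => ?_⟩
  by_contra hcon
  -- Each lemma treats the first rail and preserves what is known about the second; swapping in
  -- between covers both.
  obtain ⟨J₁, hJ₁, L₁, hL₁, hc₁, -⟩ := h₄ L hG.theta_free hL (not_lt.1 hcon)
  obtain ⟨J₂, hJ₂, L₂, hL₂, hc₂, hc₂'⟩ := h₃ L₁.swap hG.theta_free hL₁.swap hJ₁.ge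
  obtain ⟨J₃, hJ₃, L₃, hL₃, ho₃, hc₃, -⟩ := h₂ L₂ hc₂ hL₂ hJ₂.ge
  obtain ⟨J₄, hJ₄, L₄, hL₄, ho₄, -, ho₄'⟩ := h₁ L₃.swap (hc₃ (hc₂' hc₁)) hL₃.swap hJ₃.ge
  have := card_lt_of_ordered hG L₄ ⟨ho₄, ho₄' ho₃⟩ fun i hi => Or.inl (hL₄ i hi)
  omega

end Ladder

/-! ### Ladders from two combs with the same teeth -/

lemma exists_isRail {J : Finset ℕ} {w p : ℕ → V} {n : ℕ} (hp : G.IsInducedPath p n)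
    (hw : ∀ i ∈ J, ∃ a ≤ n, G.Adj (w i) (p a)) : ∃ f l, G.IsRail J w p n f l := by
  classical
  have : ∀ i ∈ J, ∃ f l, f ≤ l ∧ l ≤ n ∧ G.Adj (w i) (p f) ∧ G.Adj (w i) (p l) ∧
      ∀ a ≤ n, G.Adj (w i) (p a) → f ≤ a ∧ a ≤ l := by
    intro i hi
    have hne : ((Finset.range (n + 1)).filter fun a => G.Adj (w i) (p a)).Nonempty := by
      obtain ⟨a, ha, h⟩ := hw i hi
      exact ⟨a, by simp [h]; omega⟩
    have h1 := Finset.min'_mem _ hne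
    have h2 := Finset.max'_mem _ hne
    refine ⟨_, _, Finset.min'_le _ _ h2, ?_, (Finset.mem_filter.1 h1).2, (Finset.mem_filter.1 h2).2,
      fun a ha hadj => ?_⟩
    · have := (Finset.mem_filter.1 h2).1
      rw [Finset.mem_range] at this
      omega
    · have : a ∈ (Finset.range (n + 1)).filter fun a => G.Adj (w i) (p a) := by
        simp [hadj]; omega
      exact ⟨Finset.min'_le _ _ this, Finset.le_max' _ _ this⟩
  choose! f l h1 h2 h3 h4 h5 using this
  exact ⟨f, l, hp, h1, h2, h3, h4, h5⟩

/-- Two combs with the same teeth in anticomplete sets form a ladder. -/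
lemma exists_ladder {A B : Set V} {Y : Finset V} {p q : ℕ → V} {n m : ℕ} {X X' : V → Set V}
    (hAB : G.Anticomplete A B) (hYA : ∀ y ∈ Y, y ∉ A) (hYB : ∀ y ∈ Y, y ∉ B)
    (hhub : ∀ y ∈ Y, y ∉ G.hubs) (hA : G.IsComb A Y p n X) (hB : G.IsComb B Y q m X') :
    ∃ (J : Finset ℕ) (L : G.Ladder J), J.card = Y.card ∧ L.NonHub := by
  classical
  have hAB' : ∀ v, v ∈ A → v ∉ B := fun _ h h' => Set.disjoint_left.1 hAB.1 h h'
  -- The leg at `y` is a shortest path in the union of its two teeth from a neighbor of `p` to a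
  -- neighbor of `q`, so only its first vertex sees `p` and only its last sees `q`.
  have hne : ∀ y ∈ Y, ∃ (k : ℕ) (r : ℕ → V), G.IsInducedPath r k ∧ (∀ i ≤ k, r i ∈ X y ∪ X' y) ∧
      (∀ i ≤ k, r i ∈ {v | ∃ a ≤ n, G.Adj (p a) v} ↔ i = 0) ∧
      (∀ i ≤ k, r i ∈ {v | ∃ b ≤ m, G.Adj (q b) v} ↔ i = k) := by
    intro y hy
    refine ((hA.isLinked y hy).union_of_mem (hB.isLinked y hy) (hA.self_mem y hy)
      (hB.self_mem y hy)).exists_path_between ?_ ?_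
    · obtain ⟨a, ha, x, hx, hax⟩ := hA.touches y hy
      exact ⟨x, ⟨a, ha, hax⟩, Or.inl hx⟩
    · obtain ⟨a, ha, x, hx, hax⟩ := hB.touches y hy
      exact ⟨x, ⟨a, ha, hax⟩, Or.inr hx⟩
  have : Nonempty V := ⟨p 0⟩
  choose! len leg h1 h2 h3 h4 using hne
  obtain ⟨e, he, hinj⟩ : ∃ e : ℕ → V, (∀ i ∈ Finset.range Y.card, e i ∈ Y) ∧
      ∀ i ∈ Finset.range Y.card, ∀ j ∈ Finset.range Y.card, e i = e j → i = j := by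
    refine ⟨fun i => if h : i < Y.card then (Y.equivFin.symm ⟨i, h⟩ : V) else p 0, ?_, ?_⟩
    · intro i hi
      rw [Finset.mem_range] at hi
      simp [hi]
    · intro i hi j hj h
      rw [Finset.mem_range] at hi hj
      simpa [hi, hj, Subtype.ext_iff] using h
  have hX : ∀ y ∈ Y, ∀ v ∈ X y ∪ X' y, v = y ∨ (v ∈ A ∧ v ∈ X y) ∨ (v ∈ B ∧ v ∈ X' y) := by
    rintro y hy v (hv | hv)
    · rcases hA.subset y hy hv with h | h
      · exact Or.inl h
      · exact Or.inr (Or.inl ⟨h, hv⟩)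
    · rcases hB.subset y hy hv with h | h
      · exact Or.inl h
      · exact Or.inr (Or.inr ⟨h, hv⟩)
  have hXX : ∀ y ∈ Y, ∀ y' ∈ Y, y ≠ y' → ∀ u ∈ X y ∪ X' y, ∀ v ∈ X y' ∪ X' y',
      u ≠ v ∧ ¬ G.Adj u v := by
    intro y hy y' hy' hne u hu v hv
    have c1 := hA.anticomplete y hy y' hy' hne
    have c2 := hB.anticomplete y hy y' hy' hne
    have f1 : ∀ u ∈ X y, ∀ v ∈ X y', u ≠ v ∧ ¬ G.Adj u v := fun u hu v hv =>
      ⟨fun e => Set.disjoint_left.1 c1.1 hu (e ▸ hv), c1.2 u hu v hv⟩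
    have f2 : ∀ u ∈ X' y, ∀ v ∈ X' y', u ≠ v ∧ ¬ G.Adj u v := fun u hu v hv =>
      ⟨fun e => Set.disjoint_left.1 c2.1 hu (e ▸ hv), c2.2 u hu v hv⟩
    have s1 := hA.self_mem y hy
    have s2 := hB.self_mem y hy
    have s3 := hA.self_mem y' hy'
    have s4 := hB.self_mem y' hy'
    rcases hX y hy u hu with rfl | ⟨hu, hu'⟩ | ⟨hu, hu'⟩ <;>
      rcases hX y' hy' v hv with rfl | ⟨hv, hv'⟩ | ⟨hv, hv'⟩
    · exact f1 _ s1 _ s3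
    · exact f1 _ s1 _ hv'
    · exact f2 _ s2 _ hv'
    · exact f1 _ hu' _ s3
    · exact f1 _ hu' _ hv'
    · exact ⟨fun e => hAB' _ hu (e ▸ hv), hAB.2 _ hu _ hv⟩
    · exact f2 _ hu' _ s4
    · exact ⟨fun e => hAB' _ hv (e ▸ hu), fun h => hAB.2 _ hv _ hu h.symm⟩
    · exact f2 _ hu' _ hv'
  have hpX : ∀ y ∈ Y, ∀ v ∈ X y ∪ X' y, ∀ a ≤ n, v ≠ p a := by
    rintro y hy v hv a ha rfl
    rcases hX y hy _ hv with h | ⟨-, h⟩ | ⟨h, -⟩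
    · exact hYA y hy (h ▸ hA.mem a ha)
    · exact hA.notMem y hy a ha h
    · exact hAB' _ (hA.mem a ha) h
  have hqX : ∀ y ∈ Y, ∀ v ∈ X y ∪ X' y, ∀ a ≤ m, v ≠ q a := by
    rintro y hy v hv a ha rfl
    rcases hX y hy _ hv with h | ⟨h, -⟩ | ⟨-, h⟩
    · exact hYB y hy (h ▸ hB.mem a ha)
    · exact hAB' _ h (hB.mem a ha)
    · exact hB.notMem y hy a ha h
  obtain ⟨f, l, hfl⟩ := exists_isRail (G := G) (J := Finset.range Y.card)
    (w := fun i => leg (e i) 0) hA.path (fun i hi => by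
      obtain ⟨a, ha, h⟩ := (h3 (e i) (he i hi) 0 (by omega)).2 rfl
      exact ⟨a, ha, h.symm⟩)
  obtain ⟨f', l', hfl'⟩ := exists_isRail (G := G) (J := Finset.range Y.card)
    (w := fun i => leg (e i) (len (e i))) hB.path (fun i hi => by
      obtain ⟨a, ha, h⟩ := (h4 (e i) (he i hi) _ le_rfl).2 rfl
      exact ⟨a, ha, h.symm⟩)
  refine ⟨Finset.range Y.card, {
    leg := fun i => leg (e i)
    len := fun i => len (e i)
    p := p
    n := n
    f := f
    l := l
    q := q
    m := m
    f' := f'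
    l' := l'
    rail_p := hfl
    rail_q := hfl'
    path_leg := fun i hi => h1 _ (he i hi)
    leg_leg := fun i hi j hj hij s hs s' hs' => hXX _ (he i hi) _ (he j hj)
      (fun h => hij (hinj i hi j hj h)) _ (h2 _ (he i hi) s hs) _ (h2 _ (he j hj) s' hs')
    p_q := fun a ha b hb => ⟨fun h => hAB' _ (hA.mem a ha) (h ▸ hB.mem b hb),
      hAB.2 _ (hA.mem a ha) _ (hB.mem b hb)⟩
    leg_p := fun i hi s hs a ha => ⟨hpX _ (he i hi) _ (h2 _ (he i hi) s hs) a ha,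
      fun h => (h3 _ (he i hi) s hs).1 ⟨a, ha, h.symm⟩⟩
    leg_q := fun i hi s hs a ha => ⟨hqX _ (he i hi) _ (h2 _ (he i hi) s hs) a ha,
      fun h => (h4 _ (he i hi) s hs).1 ⟨a, ha, h.symm⟩⟩ }, by simp, ?_⟩
  intro i hi
  change ∃ s ≤ len (e i), leg (e i) s ∉ G.hubs
  have hy := he i hi
  generalize e i = y at hy
  suffices ∃ s ≤ len y, leg y s = y by
    obtain ⟨s, hs, h⟩ := this
    exact ⟨s, hs, by rw [h]; exact hhub y hy⟩
  by_contra hcon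
  push Not at hcon
  -- A leg avoiding `y` starts in `A`, since a vertex of `B` is not adjacent to `p`, and can never
  -- cross into `B`; then its last vertex has no neighbor on `q`.
  have hstep : ∀ s ≤ len y, leg y s ∈ A := by
    intro s
    induction s with
    | zero =>
      intro hs
      rcases hX y hy _ (h2 y hy 0 hs) with h | ⟨h, -⟩ | ⟨h, -⟩
      · exact (hcon 0 hs h).elim
      · exact h
      · obtain ⟨a, ha, hadj⟩ := (h3 y hy 0 hs).2 rfl
        exact (hAB.2 _ (hA.mem a ha) _ h hadj).elim
    | succ s ih =>
      intro hs
      rcases hX y hy _ (h2 y hy (s + 1) hs) with h | ⟨h, -⟩ | ⟨h, -⟩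
      · exact (hcon _ hs h).elim
      · exact h
      · exact (hAB.2 _ (ih (by omega)) _ h
          (((h1 y hy).2 _ (by omega) _ hs).2 (Or.inl rfl))).elim
  obtain ⟨b, hb, hadj⟩ := (h4 y hy _ le_rfl).2 rfl
  exact hAB.2 _ (hstep _ le_rfl) _ (hB.mem b hb) hadj.symm

/-- In a graph in the class, only boundedly many pairwise nonadjacent vertices that are not hubs
can all have neighbors in each of two anticomplete connected sets. -/
theorem exists_card_lt_of_anticomplete (t : ℕ) : ∃ N : ℕ, ∀ {V : Type u} [Finite V]
    {G : SimpleGraph V} (A B : Set V) (Y : Finset V), G.InClassCtt t → G.IsLinked A →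
    G.IsLinked B → G.Anticomplete A B → (∀ y ∈ Y, y ∉ G.hubs) →
    (∀ y ∈ Y, ∀ y' ∈ Y, ¬ G.Adj y y') → (∀ y ∈ Y, G.Touches y A) → (∀ y ∈ Y, G.Touches y B) →
    Y.card < N := by
  obtain ⟨N₁, h₁⟩ := Ladder.exists_card_lt.{u} t
  obtain ⟨N₂, h₂⟩ := exists_isComb.{u} t N₁
  obtain ⟨N₃, h₃⟩ := exists_isComb.{u} t N₂
  refine ⟨N₃, fun {V _ G} A B Y hG hA hB hAB hhub hYs hYA hYB => ?_⟩
  by_contra hcon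
  have hYA' : ∀ y ∈ Y, y ∉ A := fun y hy h => by
    obtain ⟨x, hx, hyx⟩ := hYB y hy
    exact hAB.2 y h x hx hyx
  have hYB' : ∀ y ∈ Y, y ∉ B := fun y hy h => by
    obtain ⟨x, hx, hyx⟩ := hYA y hy
    exact hAB.2 x hx y h hyx.symm
  obtain ⟨Y₁, hY₁, hc₁, p, n, X, hX⟩ := h₃ A Y hG.cliqueFree hA hYA' hYs hYA (not_lt.1 hcon)
  obtain ⟨Y₂, hY₂, hc₂, q, m, X', hX'⟩ := h₂ B Y₁ hG.cliqueFree hB (fun y hy => hYB' y (hY₁ hy))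
    (fun y hy y' hy' => hYs y (hY₁ hy) y' (hY₁ hy')) (fun y hy => hYB y (hY₁ hy)) hc₁.ge
  obtain ⟨J, L, hJ, hL⟩ := exists_ladder hAB (fun y hy => hYA' y (hY₁ (hY₂ hy)))
    (fun y hy => hYB' y (hY₁ (hY₂ hy))) (fun y hy => hhub y (hY₁ (hY₂ hy)))
    (hX.mono_finset hY₂) hX'
  have := h₁ L hG hL
  omega

end SimpleGraph

namespace SimpleGraph

universe u w
variable {V : Type u} {G : SimpleGraph V}

/-! ### Minimal separators -/

lemma sameComponentOff_iff {X : Set V} {u v : V} :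
    G.SameComponentOff X u v ↔ u ∉ X ∧ v ∉ X ∧ G.LinkedIn Xᶜ u v := by
  constructor
  · rintro ⟨hu, hv, h⟩
    rw [reachable_iff_reflTransGen] at h
    exact ⟨hu, hv, h.lift Subtype.val fun a b hab => ⟨a.2, b.2, hab⟩⟩
  · rintro ⟨hu, hv, h⟩
    refine ⟨hu, hv, ?_⟩
    have key : ∀ w, G.LinkedIn Xᶜ u w → ∀ hw : w ∈ Xᶜ,
        (G.induce Xᶜ).Reachable ⟨u, hu⟩ ⟨w, hw⟩ := by
      intro w hw
      induction hw with
      | refl => exact fun _ => Reachable.refl _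
      | tail _ h ih =>
        intro hw
        exact (ih h.1).trans (Adj.reachable (G := G.induce Xᶜ) (u := ⟨_, h.1⟩) h.2.2)
    exact key v h hv

/-- The components of `u` and `v` are full: returning any `s ∈ S` to the graph reconnects `u` and
`v`, so `s` touches both. -/
lemma IsMinimalSeparator.exists_components {S : Set V} (h : G.IsMinimalSeparator S) :
    ∃ A B, G.IsComponentIn Sᶜ A ∧ G.IsComponentIn Sᶜ B ∧ A ≠ B ∧
      ∀ s ∈ S, G.Touches s A ∧ G.Touches s B := by
  obtain ⟨u, v, hu, hv, hsep, hmin⟩ := h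
  obtain ⟨A, hA, huA⟩ := exists_isComponentIn (G := G) (U := Sᶜ) hu
  obtain ⟨B, hB, hvB⟩ := exists_isComponentIn (G := G) (U := Sᶜ) hv
  have hne : A ≠ B := by
    rintro rfl
    exact hsep (sameComponentOff_iff.2 ⟨hu, hv, (hA.isLinked u huA v hvB).mono hA.subset⟩)
  have key : ∀ (C : Set V) (x y : V) (s : V), G.IsComponentIn Sᶜ C → x ∈ C → y ∉ C →
      G.LinkedIn (S \ {s})ᶜ x y → G.Touches s C := by
    intro C x y s hC hx hy hxy
    by_contra hs
    refine hy (hxy.mem_of_closed hx fun a ha b hb hab => ?_)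
    by_cases hbS : b ∈ S
    · have : b = s := by
        by_contra hbs
        exact hb ⟨hbS, hbs⟩
      exact (hs ⟨a, ha, this ▸ hab.symm⟩).elim
    · exact hC.closed a ha b hbS hab
  refine ⟨A, B, hA, hB, hne, fun s hs => ?_⟩
  have hlink := (sameComponentOff_iff.1 (hmin (S \ {s})
    ⟨Set.sdiff_subset, fun hsub => (hsub hs).2 rfl⟩)).2.2
  exact ⟨key A u v s hA huA (fun h => hne (hA.eq_of_mem hB h hvB)) hlink,
    key B v u s hB hvB (fun h => hne (hA.eq_of_mem hB huA h)) hlink.symm⟩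

/-! ### Holes as cyclic sequences -/

/-- The hole is rotated to give a chosen vertex index 0, so that cyclic adjacency becomes arithmetic
of natural numbers. -/
lemma IsHole.exists_cycle {H : Set V} (hH : G.IsHole H) {x : V} (hx : x ∈ H) :
    ∃ (n : ℕ) (c : ℕ → V), 4 ≤ n ∧ c 0 = x ∧ (∀ v, v ∈ H ↔ ∃ i < n, c i = v) ∧
      (∀ i < n, ∀ j < n, c i = c j → i = j) ∧
      ∀ i < n, ∀ j < n, (G.Adj (c i) (c j) ↔
        i + 1 = j ∨ j + 1 = i ∨ (i = 0 ∧ j + 1 = n) ∨ (j = 0 ∧ i + 1 = n)) := by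
  obtain ⟨n, hn, f, rfl⟩ := hH
  obtain ⟨i₀, rfl⟩ := hx
  have : NeZero n := ⟨by omega⟩
  have aux : ∀ a b : ℕ, a < n → b < n →
      ((n - b + a) % n = 1 ↔ (a = b + 1 ∨ (a = 0 ∧ b + 1 = n))) := by
    intro a b ha hb
    by_cases hab : b ≤ a
    · rw [show n - b + a = (a - b) + n by omega, Nat.add_mod_right, Nat.mod_eq_of_lt (by omega)]
      omega
    · rw [Nat.mod_eq_of_lt (by omega)]
      omega
  have hval : ∀ i < n, (Fin.ofNat n i).val = i := fun i hi => by
    simp [Fin.ofNat, Nat.mod_eq_of_lt hi]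
  have hof : ∀ i : Fin n, Fin.ofNat n i.val = i := fun i => Fin.ext (hval _ i.2)
  have hsub : ∀ a b : Fin n, (i₀ + a) - (i₀ + b) = a - b := fun a b => by
    exact add_sub_add_left_eq_sub a b i₀
  refine ⟨n, fun i => f (i₀ + Fin.ofNat n i), hn, ?_, ?_, ?_, ?_⟩
  · simp
  · intro v
    constructor
    · rintro ⟨i, rfl⟩
      refine ⟨(i - i₀).val, (i - i₀).2, ?_⟩
      simp only [hof]
      rw [add_sub_cancel]
    · rintro ⟨i, -, rfl⟩
      exact ⟨_, rfl⟩
  · intro i hi j hj h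
    have := add_left_cancel (f.injective h)
    rw [← hval i hi, ← hval j hj, this]
  · intro i hi j hj
    rw [f.map_adj_iff, cycleGraph_adj', hsub, hsub, Fin.sub_def, Fin.sub_def]
    simp only [hval i hi, hval j hj, aux i j hi hj, aux j i hj hi]
    omega

lemma IsHole.congr {G' : SimpleGraph V} {H : Set V} (hH : G.IsHole H)
    (h : ∀ a ∈ H, ∀ b ∈ H, G.Adj a b ↔ G'.Adj a b) : G'.IsHole H := by
  obtain ⟨n, hn, f, rfl⟩ := hH
  exact ⟨n, hn, ⟨f.toEmbedding, fun {a b} =>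
    (h _ ⟨a, rfl⟩ _ ⟨b, rfl⟩).symm.trans f.map_adj_iff⟩, rfl⟩

/-! ### Potential maximal cliques -/

section PotentialMaximalClique

variable {G' : SimpleGraph V} {Ω D : Set V}

/-- In a minimal chordal completion, the ends of every new edge have two nonadjacent common
neighbors. -/
lemma IsMinimalChordalCompletion.exists_nonadj_common_neighbors
    (hG' : G.IsMinimalChordalCompletion G') {u v : V} (huv : G'.Adj u v) (hG : ¬ G.Adj u v) :
    ∃ x y, x ≠ y ∧ ¬ G'.Adj x y ∧ G'.Adj x u ∧ G'.Adj x v ∧ G'.Adj y u ∧ G'.Adj y v := by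
  -- By minimality, deleting the new edge creates a hole. It contains `u` and `v`, as otherwise it
  -- would be a hole of `G'`; and in `G'` its only chord is `uv`.
  set K := G'.deleteEdges {s(u, v)} with hK
  have hKadj : ∀ a b, K.Adj a b ↔ G'.Adj a b ∧ ¬ ((a = u ∧ b = v) ∨ (a = v ∧ b = u)) := by
    intro a b
    rw [hK, deleteEdges_adj]
    simp
  have hnc : ¬ K.IsChordal := by
    intro hKc
    have hGK : G ≤ K := by
      intro a b hab
      rw [hKadj]
      refine ⟨hG'.prop.1 hab, ?_⟩
      rintro (⟨rfl, rfl⟩ | ⟨rfl, rfl⟩)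
      · exact hG hab
      · exact hG hab.symm
    have := hG'.le_of_le ⟨hGK, hKc⟩ (G'.deleteEdges_le _) huv
    rw [hKadj] at this
    exact this.2 (Or.inl ⟨rfl, rfl⟩)
  rw [IsChordal] at hnc
  push Not at hnc
  obtain ⟨H, hH⟩ := hnc
  have hchord := hG'.prop.2
  have hmem : u ∈ H ∧ v ∈ H := by
    by_contra hcon
    refine hchord H (hH.congr fun a ha b hb => ?_)
    rw [hKadj]
    refine ⟨fun h => h.1, fun h => ⟨h, ?_⟩⟩
    rintro (⟨rfl, rfl⟩ | ⟨rfl, rfl⟩)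
    · exact hcon ⟨ha, hb⟩
    · exact hcon ⟨hb, ha⟩
  obtain ⟨n, c, hn, hc0, hcH, hinj, hadj⟩ := hH.exists_cycle hmem.1
  obtain ⟨j, hj, hcj⟩ := (hcH v).1 hmem.2
  have hj0 : j ≠ 0 := by
    rintro rfl
    exact huv.ne (hc0.symm.trans hcj)
  have huvK : ¬ K.Adj (c 0) (c j) := by
    rw [hc0, hcj, hKadj]
    simp
  rw [hadj 0 (by omega) j hj] at huvK
  have hadj' : ∀ a < n, ∀ b < n, (G'.Adj (c a) (c b) ↔
      (a + 1 = b ∨ b + 1 = a ∨ (a = 0 ∧ b + 1 = n) ∨ (b = 0 ∧ a + 1 = n)) ∨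
      (a = 0 ∧ b = j) ∨ (a = j ∧ b = 0)) := by
    intro a ha b hb
    rw [← hadj a ha b hb, hKadj]
    have e1 : c a = u ↔ a = 0 := ⟨fun h => hinj a ha 0 (by omega) (h.trans hc0.symm),
      fun h => h ▸ hc0⟩
    have e2 : c b = u ↔ b = 0 := ⟨fun h => hinj b hb 0 (by omega) (h.trans hc0.symm),
      fun h => h ▸ hc0⟩
    have e3 : c a = v ↔ a = j := ⟨fun h => hinj a ha j hj (h.trans hcj.symm), fun h => h ▸ hcj⟩
    have e4 : c b = v ↔ b = j := ⟨fun h => hinj b hb j hj (h.trans hcj.symm), fun h => h ▸ hcj⟩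
    rw [e1, e2, e3, e4]
    have : G'.Adj (c 0) (c j) := by rw [hc0, hcj]; exact huv
    constructor
    · intro h
      by_cases h' : a = 0 ∧ b = j ∨ a = j ∧ b = 0
      · exact Or.inr h'
      · exact Or.inl ⟨h, h'⟩
    · rintro (h | ⟨rfl, rfl⟩ | ⟨rfl, rfl⟩)
      · exact h.1
      · exact this
      · exact this.symm
  -- The chord divides the cycle into two cycles, each a triangle by chordality of `G'`. So the
  -- cycle has length four and its other two vertices are the required `x` and `y`.
  have hj2 : j = 2 := by
    by_contra hne
    refine hchord _ (isHole_of_paths (G := G') (p := c) (q := fun _ => c j) (n := j - 1) (m := 0)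
      ⟨fun a ha b hb => hinj a (by omega) b (by omega), fun a ha b hb => ?_⟩
      (IsInducedPath.singleton _) (by omega) (fun a ha b hb e => ?_) (fun a ha b hb => ?_))
    · rw [hadj' a (by omega) b (by omega)]; omega
    · have := hinj a (by omega) j hj e
      omega
    · rw [hadj' a (by omega) j hj]; omega
  have hn4 : n = 4 := by
    by_contra hne
    refine hchord _ (isHole_of_paths (G := G') (p := fun i => c (j + i)) (q := fun _ => c 0)
      (n := n - 1 - j) (m := 0)
      ⟨fun a ha b hb e => ?_, fun a ha b hb => ?_⟩
      (IsInducedPath.singleton _) (by omega) (fun a ha b hb e => ?_) (fun a ha b hb => ?_))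
    · have := hinj _ (by omega) _ (by omega) e
      omega
    · rw [hadj' _ (by omega) _ (by omega)]; omega
    · have := hinj _ (by omega) _ (by omega) e
      omega
    · rw [hadj' _ (by omega) 0 (by omega)]; omega
  subst hn4 hj2
  refine ⟨c 1, c 3, fun e => ?_, ?_, ?_, ?_, ?_, ?_⟩
  · have := hinj 1 (by omega) 3 (by omega) e
    omega
  · rw [hadj' 1 (by omega) 3 (by omega)]; omega
  · rw [← hc0, hadj' 1 (by omega) 0 (by omega)]; omega
  · rw [← hcj, hadj' 1 (by omega) 2 (by omega)]; omega
  · rw [← hc0, hadj' 3 (by omega) 0 (by omega)]; omega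
  · rw [← hcj, hadj' 3 (by omega) 2 (by omega)]; omega

/-- In a minimal chordal completion, the components of the complement of a clique get no new
neighbors. -/
lemma IsMinimalChordalCompletion.mem_or_touches (hG' : G.IsMinimalChordalCompletion G')
    (hΩ : G'.IsClique Ω) (hD : G.IsComponentIn Ωᶜ D) {d x : V} (hd : d ∈ D) (hdx : G'.Adj d x) :
    x ∈ D ∨ (x ∈ Ω ∧ G.Touches x D) := by
  set S : Set V := {x | x ∈ D ∨ (x ∈ Ω ∧ G.Touches x D)} with hS
  -- `K` deletes from `G'` all edges leaving `D` other than those to its `G`-neighbors. It contains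
  -- `G`; if it is chordal, minimality gives `K = G'`.
  let K : SimpleGraph V :=
    { Adj := fun a b => G'.Adj a b ∧ (a ∈ D → b ∈ S) ∧ (b ∈ D → a ∈ S)
      symm := ⟨fun a b h => ⟨h.1.symm, h.2.2, h.2.1⟩⟩
      loopless := ⟨fun a h => G'.irrefl h.1⟩ }
  have hKadj : ∀ a b, K.Adj a b ↔ G'.Adj a b ∧ (a ∈ D → b ∈ S) ∧ (b ∈ D → a ∈ S) :=
    fun a b => Iff.rfl
  have hGS : ∀ a b, G.Adj a b → a ∈ D → b ∈ S := by
    intro a b hab ha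
    by_cases hb : b ∈ Ω
    · exact Or.inr ⟨hb, a, ha, hab.symm⟩
    · exact Or.inl (hD.closed a ha b hb hab)
  have hGK : G ≤ K := fun a b hab => ⟨hG'.prop.1 hab, hGS a b hab, hGS b a hab.symm⟩
  have hKc : K.IsChordal := by
    intro H hH
    by_cases hHD : ∃ d ∈ H, d ∈ D
    · by_cases hHS : H ⊆ S
      · refine hG'.prop.2 H (hH.congr fun a ha b hb => ?_)
        rw [hKadj]
        exact ⟨fun h => h.1, fun h => ⟨h, fun _ => hHS hb, fun _ => hHS ha⟩⟩
      obtain ⟨d, hdH, hdD⟩ := hHD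
      obtain ⟨x, hxH, hxS⟩ := Set.not_subset.1 hHS
      obtain ⟨n, c, hn, hc0, hcH, hinj, hadj⟩ := hH.exists_cycle hdH
      obtain ⟨j, hj, hcj⟩ := (hcH x).1 hxH
      have hjS : c j ∉ S := hcj ▸ hxS
      have hjD : c j ∉ D := fun h => hjS (Or.inl h)
      have h0D : c 0 ∈ D := hc0 ▸ hdD
      classical
      -- From a vertex of the hole in `D`, walk both ways around until `D` is first left, at `c s`
      -- and `c (n - r)`. Both lie in the clique `Ω` and are thus adjacent in `K`; the vertex `c j`
      -- outside `S` lies strictly between them on one side and `c 0` on the other, so this edge is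
      -- a chord.
      have hex1 : ∃ s, c s ∉ D := ⟨j, hjD⟩
      have hs := Nat.find_spec hex1
      have hs' : Nat.find hex1 ≤ j := Nat.find_min' hex1 hjD
      have hsm : ∀ k < Nat.find hex1, c k ∈ D := fun k hk => not_not.1 (Nat.find_min hex1 hk)
      set s := Nat.find hex1 with hsdef
      have hex2 : ∃ r, 1 ≤ r ∧ c (n - r) ∉ D :=
        ⟨n - j, by omega, by rwa [show n - (n - j) = j by omega]⟩
      have hr := Nat.find_spec hex2
      have hr' : Nat.find hex2 ≤ n - j :=
        Nat.find_min' hex2 ⟨by omega, by rwa [show n - (n - j) = j by omega]⟩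
      have hrm : ∀ k, 1 ≤ k → k < Nat.find hex2 → c (n - k) ∈ D := fun k hk hk' => by
        have := Nat.find_min hex2 hk'
        push Not at this
        exact this hk
      set r := Nat.find hex2 with hrdef
      have hs0 : s ≠ 0 := fun h => hs (h ▸ h0D)
      have hsS : c s ∈ S := by
        have : K.Adj (c (s - 1)) (c s) := by
          rw [hadj _ (by omega) _ (by omega)]; omega
        exact this.2.1 (hsm _ (by omega))
      have hrS : c (n - r) ∈ S := by
        by_cases h1 : r = 1
        · have : K.Adj (c 0) (c (n - r)) := by
            rw [hadj _ (by omega) _ (by omega)]; omega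
          exact this.2.1 h0D
        · have : K.Adj (c (n - (r - 1))) (c (n - r)) := by
            rw [hadj _ (by omega) _ (by omega)]; omega
          exact this.2.1 (hrm _ (by omega) (by omega))
      have hsj : s ≠ j := fun h => hjS (h ▸ hsS)
      have hrj : n - r ≠ j := fun h => hjS (h ▸ hrS)
      have hsΩ := (hsS.resolve_left hs).1
      have hrΩ := (hrS.resolve_left hr.2).1
      have hne : c s ≠ c (n - r) := fun e => by
        have := hinj s (by omega) (n - r) (by omega) e
        omega
      have : K.Adj (c s) (c (n - r)) :=
        ⟨hΩ hsΩ hrΩ hne, fun h => (hs h).elim, fun h => (hr.2 h).elim⟩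
      rw [hadj s (by omega) (n - r) (by omega)] at this
      omega
    · push Not at hHD
      refine hG'.prop.2 H (hH.congr fun a ha b hb => ?_)
      rw [hKadj]
      exact ⟨fun h => h.1, fun h => ⟨h, fun h' => (hHD a ha h').elim,
        fun h' => (hHD b hb h').elim⟩⟩
  exact (hG'.le_of_le ⟨hGK, hKc⟩ (fun a b h => h.1) hdx).2.1 hd

/-- Two nonadjacent vertices of a potential maximal clique have neighbors in a common component of
its complement. -/
lemma IsMinimalChordalCompletion.exists_component (hG' : G.IsMinimalChordalCompletion G')
    (hΩ : G'.IsClique Ω) {u v : V} (hu : u ∈ Ω) (hv : v ∈ Ω) (hne : u ≠ v) (huv : ¬ G.Adj u v) :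
    ∃ D, G.IsComponentIn Ωᶜ D ∧ G.Touches u D ∧ G.Touches v D := by
  obtain ⟨x, y, hxy, hnadj, hxu, hxv, hyu, hyv⟩ :=
    hG'.exists_nonadj_common_neighbors (hΩ hu hv hne) huv
  have key : ∀ z, z ∉ Ω → G'.Adj z u → G'.Adj z v →
      ∃ D, G.IsComponentIn Ωᶜ D ∧ G.Touches u D ∧ G.Touches v D := by
    intro z hz hzu hzv
    obtain ⟨D, hD, hzD⟩ := exists_isComponentIn (G := G) (U := Ωᶜ) hz
    refine ⟨D, hD, ?_, ?_⟩
    · exact ((hG'.mem_or_touches hΩ hD hzD hzu).resolve_left fun h => hD.subset h hu).2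
    · exact ((hG'.mem_or_touches hΩ hD hzD hzv).resolve_left fun h => hD.subset h hv).2
  by_cases hx : x ∈ Ω
  · by_cases hy : y ∈ Ω
    · exact (hnadj (hΩ hx hy hxy)).elim
    · exact key y hy hyu hyv
  · exact key x hx hxu hxv

lemma IsLinked.mono_graph (h : G.IsLinked D) (hG : G ≤ G') : G'.IsLinked D := by
  have key : ∀ a b, G.LinkedIn D a b → G'.LinkedIn D a b := by
    intro a b hab
    induction hab with
    | refl => exact Relation.ReflTransGen.refl
    | tail _ h ih => exact Relation.ReflTransGen.tail ih ⟨h.1, h.2.1, hG h.2.2⟩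
  exact fun a ha b hb => key a b (h a ha b hb)

/-- No component of the complement of a potential maximal clique touches all of it. -/
lemma IsMinimalChordalCompletion.exists_not_touches [Finite V]
    (hG' : G.IsMinimalChordalCompletion G') (hΩ : Maximal G'.IsClique Ω)
    (hD : G.IsComponentIn Ωᶜ D) : ∃ x ∈ Ω, ¬ G.Touches x D := by
  by_contra hcon
  push Not at hcon
  have hchord := hG'.prop.2
  -- The vertex `d` has the most `G'`-neighbors in `Ω`. It misses some `w`, since `Ω` is a maximal
  -- clique. Follow a path in `D` to the first vertex `p k` seeing `w`; by the choice of `d`, this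
  -- vertex misses some neighbor `u` of `d`.
  obtain ⟨d, hdD, hdmax⟩ := (Set.toFinite D).exists_maximalFor
    (fun d => (G'.neighborSet d ∩ Ω).ncard) D hD.nonempty
  have hdmax' : ∀ e ∈ D, (G'.neighborSet e ∩ Ω).ncard ≤ (G'.neighborSet d ∩ Ω).ncard := by
    intro e he
    rcases le_total (G'.neighborSet e ∩ Ω).ncard (G'.neighborSet d ∩ Ω).ncard with h | h
    · exact h
    · exact hdmax he h
  have hdΩ : d ∉ Ω := hD.subset hdD
  obtain ⟨w, hwΩ, hdw⟩ : ∃ w ∈ Ω, ¬ G'.Adj d w := by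
    by_contra hall
    push Not at hall
    have : G'.IsClique (insert d Ω) := hΩ.prop.insert fun b hb _ => hall b hb
    exact hdΩ (hΩ.le_of_ge this (Set.subset_insert d Ω) (Set.mem_insert d Ω))
  obtain ⟨x, hxD, hwx⟩ := hcon w hwΩ
  obtain ⟨k, p, hp, hpD, hpd, hpw⟩ := (hD.isLinked.mono_graph hG'.prop.1).exists_path_between
    (S := {d}) (T := {v | G'.Adj v w}) ⟨d, rfl, hdD⟩ ⟨x, (hG'.prop.1 hwx).symm, hxD⟩
  have hp0 : p 0 = d := (hpd 0 (by omega)).2 rfl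
  have hk0 : k ≠ 0 := by
    rintro rfl
    exact hdw (hp0 ▸ (hpw 0 le_rfl).2 rfl)
  have hkw : G'.Adj (p k) w := (hpw k le_rfl).2 rfl
  obtain ⟨u, hdu, huΩ, hku⟩ : ∃ u, G'.Adj d u ∧ u ∈ Ω ∧ ¬ G'.Adj (p k) u := by
    by_contra hall
    push Not at hall
    have hlt : (G'.neighborSet d ∩ Ω).ncard < (G'.neighborSet (p k) ∩ Ω).ncard :=
      Set.ncard_lt_ncard ⟨fun u hu => ⟨hall u hu.1 hu.2, hu.2⟩,
        fun hsub => hdw (hsub ⟨hkw, hwΩ⟩).1⟩ (Set.toFinite _)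
    have := hdmax' _ (hpD k le_rfl)
    omega
  have huw : u ≠ w := fun e => hdw (e ▸ hdu)
  classical
  obtain ⟨j, hjk, hju, hjmax⟩ : ∃ j < k, G'.Adj (p j) u ∧ ∀ i ≤ k, j < i → ¬ G'.Adj (p i) u := by
    have h1 := Nat.findGreatest_spec (P := fun i => G'.Adj (p i) u) (n := k) (Nat.zero_le k)
      (hp0 ▸ hdu)
    refine ⟨Nat.findGreatest (fun i => G'.Adj (p i) u) k, ?_, h1, fun i hi hji =>
      Nat.findGreatest_is_greatest hji hi⟩
    refine lt_of_le_of_ne (Nat.findGreatest_le k) fun e => hku ?_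
    rwa [e] at h1
  have hΩp : ∀ i ≤ k, p i ∉ Ω := fun i hi => hD.subset (hpD i hi)
  have hq : G'.IsInducedPath (fun i => if i = 0 then w else u) 1 := by
    have hwu : G'.Adj w u := hΩ.prop hwΩ huΩ huw.symm
    refine ⟨fun i hi j hj => ?_, fun i hi j hj => ?_⟩
    · interval_cases i <;> interval_cases j <;> simp [huw, huw.symm]
    · interval_cases i <;> interval_cases j <;> simp [hwu, hwu.symm]
  obtain ⟨m, rfl⟩ : ∃ m, k = j + m := ⟨k - j, by omega⟩
  -- From the last vertex `p j` seeing `u` to `p k`, and back through `w` and `u`: a hole of `G'`,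
  -- with at least four vertices because `j < k`.
  refine hchord _ (isHole_of_paths (hp.segment j m le_rfl) hq (by omega)
    (fun i (hi : i ≤ m) b (hb : b ≤ 1) e => ?_) (fun i (hi : i ≤ m) b (hb : b ≤ 1) => ?_))
  · refine hΩp (j + i) (by omega) ?_
    rw [e]
    by_cases hb0 : b = 0 <;> simp [hb0, hwΩ, huΩ]
  · by_cases hb0 : b = 0
    · subst hb0
      exact (hpw (j + i) (by omega)).trans (by omega)
    · obtain rfl : b = 1 := by omega
      constructor
      · intro (h : G'.Adj (p (j + i)) u)
        by_contra hi0
        exact hjmax (j + i) (by omega) (by omega) h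
      · intro h
        obtain rfl : i = 0 := by omega
        exact hju

/-- A component of the complement of a potential maximal clique has a neighborhood with a second
full component: a linked set, anticomplete to it, touched by all its neighbors. -/
lemma IsMinimalChordalCompletion.exists_opposite [Finite V]
    (hG' : G.IsMinimalChordalCompletion G') (hΩ : Maximal G'.IsClique Ω)
    (hD : G.IsComponentIn Ωᶜ D) : ∃ B, G.IsLinked B ∧ G.Anticomplete D B ∧
      ∀ y ∈ Ω, G.Touches y D → G.Touches y B := by
  obtain ⟨x, hxΩ, hxD⟩ := hG'.exists_not_touches hΩ hD
  set N : Set V := {y | y ∈ Ω ∧ G.Touches y D} with hN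
  have hxN : x ∈ Nᶜ := fun h => hxD h.2
  have hDN : G.IsComponentIn Nᶜ D := by
    refine ⟨hD.nonempty, fun a ha h => hD.subset ha h.1, hD.isLinked, fun a ha b hb hab => ?_⟩
    by_cases hbΩ : b ∈ Ω
    · exact (hb ⟨hbΩ, a, ha, hab.symm⟩).elim
    · exact hD.closed a ha b hbΩ hab
  -- The partner is the component containing `x` after deleting the neighbors `N` of `D` in `Ω`. A
  -- vertex of `N` not adjacent to `x` shares a component of `Ωᶜ` with it, and that component is
  -- absorbed into `B`.
  obtain ⟨B, hB, hxB⟩ := exists_isComponentIn (G := G) (U := Nᶜ) hxN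
  have hDB : D ≠ B := fun e => hD.subset (e ▸ hxB) hxΩ
  refine ⟨B, hB.isLinked, hDN.anticomplete hB hDB, fun y hy hyD => ?_⟩
  by_cases hyx : G.Adj y x
  · exact ⟨x, hxB, hyx⟩
  have hne : y ≠ x := fun e => hxD (e ▸ hyD)
  obtain ⟨D', hD', hyD', hxD'⟩ := hG'.exists_component hΩ.prop hy hxΩ hne hyx
  have hsub : insert x D' ⊆ B := by
    refine hB.subset_of_mem (hD'.isLinked.insert_of_touches hxD') ?_ hxB (Or.inl rfl)
    rintro z (rfl | hz)
    · exact hxN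
    · exact fun h => hD'.subset hz h.1
  exact hyD'.mono fun z hz => hsub (Or.inr hz)

end PotentialMaximalClique

/-! ### Stable sets in potential maximal cliques -/

/-- In a theta-free graph, a stable subset `Y` of a set `Ω` is bounded in size if any two vertices
of `Y` touch a common component of the complement of `Ω`, while every such component is touched by
fewer than `N` vertices of `Y`. -/
lemma card_le_of_components (hθ : IsEmpty G.Theta) {Ω : Set V} {Y : Finset V} {N : ℕ}
    (hYΩ : ∀ y ∈ Y, y ∈ Ω) (hYs : ∀ y ∈ Y, ∀ y' ∈ Y, ¬ G.Adj y y')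
    (hcov : ∀ y ∈ Y, ∀ y' ∈ Y, y ≠ y' →
      ∃ D, G.IsComponentIn Ωᶜ D ∧ G.Touches y D ∧ G.Touches y' D)
    (hN : ∀ D, G.IsComponentIn Ωᶜ D → {y | y ∈ Y ∧ G.Touches y D}.ncard < N) :
    Y.card ≤ 6 * N + 1 := by
  classical
  have hN' : ∀ D, G.IsComponentIn Ωᶜ D → (Y.filter fun y => G.Touches y D).card < N := by
    intro D hD
    have := hN D hD
    rw [← Set.ncard_coe_finset]
    simpa using this
  set bad : V → V → Finset V := fun y y' => Y.filter fun z =>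
    ∃ D, G.IsComponentIn Ωᶜ D ∧ G.Touches y D ∧ G.Touches y' D ∧ G.Touches z D with hbad
  have hbadm : ∀ y y' z D, z ∈ Y → G.IsComponentIn Ωᶜ D → G.Touches y D → G.Touches y' D →
      G.Touches z D → z ∈ bad y y' := fun y y' z D hz hD h1 h2 h3 =>
    Finset.mem_filter.2 ⟨hz, D, hD, h1, h2, h3⟩
  -- Three components touching both `y` and `y'` would form a theta, so at most two do, each touched
  -- by fewer than `N` vertices of `Y`.
  have hbadc : ∀ y ∈ Y, ∀ y' ∈ Y, y ≠ y' → (bad y y').card ≤ 2 * N := by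
    intro y hy y' hy' hne
    obtain ⟨D₁, hD₁, hyD₁, hyD₁'⟩ := hcov y hy y' hy' hne
    by_cases hall : ∀ z ∈ bad y y', G.Touches z D₁
    · have hsub : bad y y' ⊆ Y.filter fun y => G.Touches y D₁ := fun z hz =>
        Finset.mem_filter.2 ⟨(Finset.mem_filter.1 hz).1, hall z hz⟩
      have := Finset.card_le_card hsub
      have := hN' D₁ hD₁
      omega
    · push Not at hall
      obtain ⟨z, hz, hzD₁⟩ := hall
      obtain ⟨-, D₂, hD₂, hyD₂, hyD₂', hzD₂⟩ := Finset.mem_filter.1 hz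
      have h12 : D₁ ≠ D₂ := fun e => hzD₁ (e ▸ hzD₂)
      have hsub : bad y y' ⊆ (Y.filter fun y => G.Touches y D₁) ∪
          Y.filter fun y => G.Touches y D₂ := by
        intro x hx
        obtain ⟨hxY, D₃, hD₃, hyD₃, hyD₃', hxD₃⟩ := Finset.mem_filter.1 hx
        rw [Finset.mem_union, Finset.mem_filter, Finset.mem_filter]
        by_cases h13 : D₁ = D₃
        · exact Or.inl ⟨hxY, h13 ▸ hxD₃⟩
        by_cases h23 : D₂ = D₃
        · exact Or.inr ⟨hxY, h23 ▸ hxD₃⟩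
        have a12 := hD₁.anticomplete hD₂ h12
        have a13 := hD₁.anticomplete hD₃ h13
        have a23 := hD₂.anticomplete hD₃ h23
        refine (not_isEmpty_iff.2 (nonempty_theta hne (hYs y hy y' hy') ![D₁, D₂, D₃]
          ?_ ?_ ?_ ?_) hθ).elim
        · intro k
          fin_cases k <;> first | exact hD₁.isLinked | exact hD₂.isLinked | exact hD₃.isLinked
        · intro k
          fin_cases k <;> first | exact hyD₁ | exact hyD₂ | exact hyD₃
        · intro k
          fin_cases k <;> first | exact hyD₁' | exact hyD₂' | exact hyD₃'
        · intro k k' hk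
          fin_cases k <;> fin_cases k' <;> first | exact a12 | exact a13 | exact a23 | simp at hk
      have := (Finset.card_le_card hsub).trans (Finset.card_union_le _ _)
      have := hN' D₁ hD₁
      have := hN' D₂ hD₂
      omega
  by_contra hcard
  push Not at hcard
  obtain ⟨y₁, hy₁, y₂, hy₂, h12⟩ := Finset.one_lt_card.1 (show 1 < Y.card by omega)
  obtain ⟨D₁₂, hD₁₂, h12a, h12b⟩ := hcov y₁ hy₁ y₂ hy₂ h12
  have c12 := hbadc y₁ hy₁ y₂ hy₂ h12
  obtain ⟨y₃, hy₃, hy₃b⟩ := Finset.exists_mem_notMem_of_card_lt_card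
    (show (bad y₁ y₂).card < Y.card by omega)
  have h13 : y₁ ≠ y₃ := fun e => hy₃b (e ▸ hbadm _ _ _ _ hy₁ hD₁₂ h12a h12b h12a)
  have h23 : y₂ ≠ y₃ := fun e => hy₃b (e ▸ hbadm _ _ _ _ hy₂ hD₁₂ h12a h12b h12b)
  obtain ⟨D₁₃, hD₁₃, h13a, h13b⟩ := hcov y₁ hy₁ y₃ hy₃ h13
  obtain ⟨D₂₃, hD₂₃, h23a, h23b⟩ := hcov y₂ hy₂ y₃ hy₃ h23
  have c13 := hbadc y₁ hy₁ y₃ hy₃ h13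
  have c23 := hbadc y₂ hy₂ y₃ hy₃ h23
  have cu := Finset.card_union_le (bad y₁ y₂ ∪ bad y₁ y₃) (bad y₂ y₃)
  have cu' := Finset.card_union_le (bad y₁ y₂) (bad y₁ y₃)
  -- The three bad sets have at most `6 * N` vertices together, so there are `y₁, …, y₄` no three of
  -- which touch a common component.
  obtain ⟨y₄, hy₄, hy₄b⟩ := Finset.exists_mem_notMem_of_card_lt_card
    (show (bad y₁ y₂ ∪ bad y₁ y₃ ∪ bad y₂ y₃).card < Y.card by omega)
  simp only [Finset.mem_union, not_or] at hy₄b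
  obtain ⟨⟨b12, b13⟩, b23⟩ := hy₄b
  have h14 : y₁ ≠ y₄ := fun e => b12 (e ▸ hbadm _ _ _ _ hy₁ hD₁₂ h12a h12b h12a)
  have h24 : y₂ ≠ y₄ := fun e => b12 (e ▸ hbadm _ _ _ _ hy₂ hD₁₂ h12a h12b h12b)
  have h34 : y₃ ≠ y₄ := fun e => b13 (e ▸ hbadm _ _ _ _ hy₃ hD₁₃ h13a h13b h13b)
  obtain ⟨D₁₄, hD₁₄, h14a, h14b⟩ := hcov y₁ hy₁ y₄ hy₄ h14
  obtain ⟨D₂₄, hD₂₄, h24a, h24b⟩ := hcov y₂ hy₂ y₄ hy₄ h24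
  have n3_12 : ¬ G.Touches y₃ D₁₂ := fun h => hy₃b (hbadm _ _ _ _ hy₃ hD₁₂ h12a h12b h)
  have n4_12 : ¬ G.Touches y₄ D₁₂ := fun h => b12 (hbadm _ _ _ _ hy₄ hD₁₂ h12a h12b h)
  have n3_14 : ¬ G.Touches y₃ D₁₄ := fun h => b13 (hbadm _ _ _ _ hy₄ hD₁₄ h14a h h14b)
  have n3_24 : ¬ G.Touches y₃ D₂₄ := fun h => b23 (hbadm _ _ _ _ hy₄ hD₂₄ h24a h h24b)
  have n4_13 : ¬ G.Touches y₄ D₁₃ := fun h => b13 (hbadm _ _ _ _ hy₄ hD₁₃ h13a h13b h)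
  have n4_23 : ¬ G.Touches y₄ D₂₃ := fun h => b23 (hbadm _ _ _ _ hy₄ hD₂₃ h23a h23b h)
  have hdiff : ∀ (y : V) (D D' : Set V), G.IsComponentIn Ωᶜ D → G.IsComponentIn Ωᶜ D' →
      ¬ G.Touches y D → G.Touches y D' → G.Anticomplete D D' :=
    fun y D D' hD hD' h h' => hD.anticomplete hD' fun e => h (e ▸ h')
  have hins : ∀ (y : V) (D D' : Set V), y ∈ Ω → G.IsComponentIn Ωᶜ D → ¬ G.Touches y D →
      G.Anticomplete D D' → G.Anticomplete D (insert y D') := by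
    intro y D D' hy hD hyD hDD
    constructor
    · rw [Set.disjoint_left]
      rintro a ha (rfl | ha')
      · exact hD.subset ha hy
      · exact Set.disjoint_left.1 hDD.1 ha ha'
    · rintro a ha b (rfl | hb) hab
      · exact hyD ⟨a, ha, hab.symm⟩
      · exact hDD.2 a ha b hb hab
  have hun : ∀ (A B C : Set V), G.Anticomplete A B → G.Anticomplete A C →
      G.Anticomplete A (B ∪ C) := by
    intro A B C hB hC
    refine ⟨Set.disjoint_union_right.2 ⟨hB.1, hC.1⟩, ?_⟩
    rintro a ha b (hb | hb)
    · exact hB.2 a ha b hb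
    · exact hC.2 a ha b hb
  have hl : ∀ (y : V) (D D' : Set V), G.IsLinked D → G.IsLinked D' → G.Touches y D →
      G.Touches y D' → G.IsLinked (insert y D ∪ insert y D') := fun y D D' hD hD' h h' =>
    (hD.insert_of_touches h).union_of_mem (hD'.insert_of_touches h') (Set.mem_insert y D)
      (Set.mem_insert y D')
  have t12 : ∀ y ∈ Ω, ¬ G.Touches y D₁₂ → ∀ D D', G.IsComponentIn Ωᶜ D → G.IsComponentIn Ωᶜ D' →
      G.Touches y D → G.Touches y D' → G.Anticomplete D₁₂ (insert y D ∪ insert y D') := by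
    intro y hy hn D D' hD hD' h h'
    exact hun _ _ _ (hins y _ _ hy hD₁₂ hn (hdiff y _ _ hD₁₂ hD hn h))
      (hins y _ _ hy hD₁₂ hn (hdiff y _ _ hD₁₂ hD' hn h'))
  have a01 := t12 y₃ (hYΩ _ hy₃) n3_12 D₁₃ D₂₃ hD₁₃ hD₂₃ h13b h23b
  have a02 := t12 y₄ (hYΩ _ hy₄) n4_12 D₁₄ D₂₄ hD₁₄ hD₂₄ h14b h24b
  have aux : ∀ D D', G.IsComponentIn Ωᶜ D → G.IsComponentIn Ωᶜ D' → G.Touches y₃ D →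
      ¬ G.Touches y₄ D → ¬ G.Touches y₃ D' → G.Anticomplete (insert y₃ D) (insert y₄ D') := by
    intro D D' hD hD' h3 h4 h3'
    have hDD : G.Anticomplete D D' := (hdiff y₃ D' D hD' hD h3' h3).symm
    constructor
    · rw [Set.disjoint_left]
      rintro a (rfl | ha) (h | ha')
      · exact h34 h
      · exact hD'.subset ha' (hYΩ _ hy₃)
      · exact hD.subset ha (h ▸ hYΩ _ hy₄)
      · exact Set.disjoint_left.1 hDD.1 ha ha'
    · rintro a (rfl | ha) b (rfl | hb) hab
      · exact hYs _ hy₃ _ hy₄ hab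
      · exact h3' ⟨b, hb, hab⟩
      · exact h4 ⟨a, ha, hab.symm⟩
      · exact hDD.2 a ha b hb hab
  have a12 : G.Anticomplete (insert y₃ D₁₃ ∪ insert y₃ D₂₃) (insert y₄ D₁₄ ∪ insert y₄ D₂₄) := by
    refine hun _ _ _ (hun _ _ _ ?_ ?_).symm (hun _ _ _ ?_ ?_).symm
    · exact (aux _ _ hD₁₃ hD₁₄ h13b n4_13 n3_14).symm
    · exact (aux _ _ hD₂₃ hD₁₄ h23b n4_23 n3_14).symm
    · exact (aux _ _ hD₁₃ hD₂₄ h13b n4_13 n3_24).symm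
    · exact (aux _ _ hD₂₃ hD₂₄ h23b n4_23 n3_24).symm
  -- The theta joins `y₁` and `y₂` directly through `D₁₂`, through `y₃` with the components it
  -- shares with each of them, and likewise through `y₄`.
  refine not_isEmpty_iff.2 (nonempty_theta h12 (hYs _ hy₁ _ hy₂)
    ![D₁₂, insert y₃ D₁₃ ∪ insert y₃ D₂₃, insert y₄ D₁₄ ∪ insert y₄ D₂₄] ?_ ?_ ?_ ?_) hθ
  · intro k
    fin_cases k
    · exact hD₁₂.isLinked
    · exact hl _ _ _ hD₁₃.isLinked hD₂₃.isLinked h13b h23b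
    · exact hl _ _ _ hD₁₄.isLinked hD₂₄.isLinked h14b h24b
  · intro k
    fin_cases k
    · exact h12a
    · exact h13a.mono ((Set.subset_insert _ _).trans Set.subset_union_left)
    · exact h14a.mono ((Set.subset_insert _ _).trans Set.subset_union_left)
  · intro k
    fin_cases k
    · exact h12b
    · exact h23a.mono ((Set.subset_insert _ _).trans Set.subset_union_right)
    · exact h24a.mono ((Set.subset_insert _ _).trans Set.subset_union_right)
  · intro k k' hk
    fin_cases k <;> fin_cases k' <;> first | exact a01 | exact a02 | exact a12 | simp at hk

end SimpleGraph

/-! ### The two bounds -/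

theorem theorem6p3 (t : ℕ) (ht : 1 ≤ t) :
    ∃ τ : ℕ, 1 ≤ τ ∧
      ∀ (V : Type*) [Finite V] (G : SimpleGraph V), G.InClassCtt t →
        (∀ S Y : Set V, G.IsMinimalSeparator S → Y ⊆ S \ G.hubs → G.IsIndepSet Y →
          Y.ncard ≤ τ) ∧
        (∀ (W : Type*) (T : SimpleGraph W) (χ : W → Set V),
          G.IsStructuredTreeDecomposition T χ →
          ∀ (v : W) (Y : Set V), Y ⊆ χ v \ G.hubs → G.IsIndepSet Y → Y.ncard ≤ 4 * τ) := by
  classical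
  obtain ⟨N, hN⟩ := SimpleGraph.exists_card_lt_of_anticomplete t
  -- Part 1 needs only `N ≤ τ`; part 2 needs `6 * N + 1 ≤ 4 * τ`.
  refine ⟨2 * N + 1, by omega, fun V _ G hG => ⟨?_, ?_⟩⟩
  · intro S Y hS hY hYs
    have := Fintype.ofFinite V
    obtain ⟨A, B, hA, hB, hAB, hSt⟩ := hS.exists_components
    have := hN A B Y.toFinset hG hA.isLinked hB.isLinked (hA.anticomplete hB hAB)
      (fun y hy => (hY (Set.mem_toFinset.1 hy)).2)
      (fun y hy y' hy' hadj => hYs (Set.mem_toFinset.1 hy) (Set.mem_toFinset.1 hy') hadj.ne hadj)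
      (fun y hy => (hSt y (hY (Set.mem_toFinset.1 hy)).1).1)
      (fun y hy => (hSt y (hY (Set.mem_toFinset.1 hy)).1).2)
    rw [Set.ncard_eq_toFinset_card']
    omega
  · intro W T χ hχ v Y hY hYs
    have := Fintype.ofFinite V
    obtain ⟨G', hG', hΩ⟩ := hχ.isPMC v
    have hYs' : ∀ y ∈ Y.toFinset, ∀ y' ∈ Y.toFinset, ¬ G.Adj y y' := fun y hy y' hy' hadj =>
      hYs (Set.mem_toFinset.1 hy) (Set.mem_toFinset.1 hy') hadj.ne hadj
    have hYΩ : ∀ y ∈ Y.toFinset, y ∈ χ v := fun y hy => (hY (Set.mem_toFinset.1 hy)).1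
    have := SimpleGraph.card_le_of_components hG.theta_free (Y := Y.toFinset) (N := N) hYΩ hYs'
      (fun y hy y' hy' hne => hG'.exists_component hΩ.prop (hYΩ y hy) (hYΩ y' hy') hne
        (hYs' y hy y' hy')) (fun D hD => by
        obtain ⟨B, hB, hDB, hyB⟩ := hG'.exists_opposite hΩ hD
        have := hN D B (Y.toFinset.filter fun y => G.Touches y D) hG hD.isLinked hB hDB
          (fun y hy => (hY (Set.mem_toFinset.1 (Finset.mem_filter.1 hy).1)).2)
          (fun y hy y' hy' => hYs' y (Finset.mem_filter.1 hy).1 y' (Finset.mem_filter.1 hy').1)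
          (fun y hy => (Finset.mem_filter.1 hy).2)
          (fun y hy => hyB y (hYΩ y (Finset.mem_filter.1 hy).1) (Finset.mem_filter.1 hy).2)
        rw [← Set.ncard_coe_finset] at this
        simpa using this)
    rw [Set.ncard_eq_toFinset_card']
    omega
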